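/- **Lattice.** For integers $m,n\ge 0$, $m\ne 1$, $n\ne 1$, let $\Lambda_{m,n}$ be the $[3.12.12]$ (star) lattice with unit cells $\mathbb Z/m\times\mathbb Z/n$, where $\mathbb Z/0=\mathbb Z$ (so $\Lambda_{0,0}$ is the infinite star lattice, $\Lambda_{m,n}$ with $m,n\ge 2$ is its quotient on the $m\times n$ torus, and the remaining ones are cylinders): each cell $c$ carries two triangles $(c,A)$, $(c,B)$ with corners $0,1,2$, and corner $k$ of $(c,A)$ is joined by an edge to corner $k$ of $(c+t_k,B)$, where $t_0=(0,0)$, $t_1=(1,0)$, $t_2=(0,1)$. For each such joining edge $i$ let $\Gamma_i$ be the subgraph consisting of this edge and the two triangular plaquettes it connects. Two terms $\Gamma_i,\Gamma_j$, $i\neq j$, *overlap* if they have a common vertex. **AKLT model.** Each vertex carries a spin $3/2$ (space $\mathbb C^4$). For an edge $e$ let $H^{(e)}$ be the projection onto total spin $3$ of its two ends, and for a finite subgraph $\Gamma$ let $H_\Gamma=\sum_{e\in\Gamma}H^{(e)}$. Let $\Psi_\Gamma:\mathcal H^\Gamma_{\rm virt}\to\mathcal H^\Gamma_{\rm phys}$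 be the AKLT construction: three virtual spins $1/2$ per vertex, one for each edge of the lattice at that vertex, are projected onto the symmetric subspace $\cong\mathbb C^4$, and the two virtual spins of each edge of $\Gamma$ are contracted with the singlet; the remaining (free) virtual spins span $\mathcal H^\Gamma_{\rm virt}$. Let $\mathcal H_\Gamma=\operatorname{im}\Psi_\Gamma$, let $\Pi_\Gamma$ be the orthogonal projection onto $\mathcal H_\Gamma$, and put $\tilde H_i=1-\Pi_{\Gamma_i}$ (tensored with the identity on the other vertices). **Claim.** There is a real number $\eta$ with $|\eta-0.1110430220|<5\cdot10^{-11}$, in particular $\eta<1/4$, such that the following holds. 1. For all $m,n$ as above, each $\Gamma_i$ overlaps exactly four other terms $\Gamma_j$. 2. For all $m,n$ as above and all overlapping $\Gamma_i,\Gamma_j$, with $L=\Gamma_i\setminus\Gamma_j$, $C=\Gamma_i\cap\Gamma_j$, $R=\Gamma_j\setminus\Gamma_i$, $Y=\Gamma_i\cup\Gamma_j$ and with $E=\Pi_{\Gamma_i}$, $F=\Pi_{\Gamma_j}$ acting on $\mathcal H^Y_{\rm phys}$: (a) $\eta$ is the least real number $x$ with $\tilde H_i\tilde H_j+\tilde H_j\tilde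 H_i\ge -x(\tilde H_i+\tilde H_j)$; (b) $\dim\mathcal H_{\Gamma_i}=2^4$, $\dim\mathcal H_L=\dim\mathcal H_C=\dim\mathcal H_R=2^3$, $\dim\mathcal H_Y=2^5$, and the eigenspace of $E+F$ for the eigenvalue $2$ is $\mathcal H_Y$; (c) the reduced operator, i.e. the compression of $E+F$ to $\mathcal H_L\otimes\mathcal H_C\otimes\mathcal H_R\subset\mathcal H^Y_{\rm phys}$, acts on a space of dimension $2^9$, has the same non-integer eigenvalues as $E+F$, and its greatest and least non-integer eigenvalues are $1+\eta$ and $1-\eta$. 3. For all $m,n$ as above and every finite set $S$ of joining edges, the operator $\tilde H_S=\sum_{i\in S}\tilde H_i$ on the physical space of $\bigcup_{i\in S}\Gamma_i$ satisfies $\tilde H_S^2\ge(1-4\eta)\tilde H_S$. 4. (The model is gapped.) There is $\gamma>0$, independent of $m$, $n$ and $S$, such that for all $m,n$ as above and every finite set $S$ of joining edges, the AKLT Hamiltonian $H_\Gamma$ on $\Gamma=\bigcup_{i\in S}\Gamma_i$ has smallest eigenvalue $0$, and all its other eigenvalues are at least $\gamma$. (This includes finite patches of the infinite star lattice with open boundary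 and all tori with $m,n\ge2$.) -/

import Mathlib

open scoped Kronecker ComplexOrder

/-! ## Linear algebra -/

/-- The orthogonal projection onto a subspace of `ℂ^ι`, as a matrix. -/
noncomputable def orthProj {ι : Type} [Fintype ι] [DecidableEq ι]
    (K : Submodule ℂ (EuclideanSpace ℂ ι)) : Matrix ι ι ℂ :=
  (Matrix.toEuclideanCLM (n := ι) (𝕜 := ℂ)).symm K.starProjection

/-- The real numbers `x` for which the operator inequality `PQ + QP ≥ -x (P + Q)` holds. -/
def anticommutatorBounds {ι : Type} [Fintype ι] (P Q : Matrix ι ι ℂ) : Set ℝ :=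
  {x : ℝ | (P * Q + Q * P + (x : ℂ) • (P + Q)).PosSemidef}

/-- The compression of a matrix `A` to a subspace `K` of `ℂ^ι`, i.e. `U† A U` for the inclusion
`U : K → ℂ^ι`. -/
noncomputable def compression {ι : Type} [Fintype ι] [DecidableEq ι]
    (K : Submodule ℂ (EuclideanSpace ℂ ι)) (A : Matrix ι ι ℂ) : Module.End ℂ K :=
  (K.orthogonalProjectionOnto : EuclideanSpace ℂ ι →ₗ[ℂ] K) ∘ₗ
    Matrix.toEuclideanLin A ∘ₗ K.subtype

/-- The real eigenvalues of `T` that are not integers. -/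
def nonintegerEigenvalues {M : Type} [AddCommGroup M] [Module ℂ M] (T : Module.End ℂ M) : Set ℝ :=
  {x : ℝ | T.HasEigenvalue (x : ℂ) ∧ ∀ z : ℤ, (z : ℝ) ≠ x}

/-- `H` is Hermitian with smallest eigenvalue `E₀`, and every other eigenvalue is at
least `E₀ + γ`. -/
def HasSpectralGap {ι : Type} [Fintype ι] [DecidableEq ι] (H : Matrix ι ι ℂ) (E₀ γ : ℝ) : Prop :=
  H.IsHermitian ∧ IsLeast (spectrum ℝ H) E₀ ∧ ∀ x ∈ spectrum ℝ H, x ≠ E₀ → E₀ + γ ≤ x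

/-! ## Spin 3/2

The basis vector `k : Fin 4` of the spin-3/2 space `ℂ⁴` has magnetic quantum
number `3/2 - k`. -/

/-- The spin-3/2 raising operator. -/
noncomputable def spinRaise : Matrix (Fin 4) (Fin 4) ℂ :=
  !![0, (√3 : ℝ), 0, 0;
     0, 0, 2, 0;
     0, 0, 0, (√3 : ℝ);
     0, 0, 0, 0]

/-- The spin-3/2 operators `S_x, S_y, S_z`. -/
noncomputable def spin : Fin 3 → Matrix (Fin 4) (Fin 4) ℂ :=
  ![(1 / 2 : ℂ) • (spinRaise + spinRaise.conjTranspose),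
    (-Complex.I / 2) • (spinRaise - spinRaise.conjTranspose),
    Matrix.diagonal fun k => 3 / 2 - ((k : ℕ) : ℂ)]

/-- The square of the total spin of two spins 3/2. -/
noncomputable def totalSpinSq : Matrix (Fin 4 × Fin 4) (Fin 4 × Fin 4) ℂ :=
  ∑ a : Fin 3, (spin a ⊗ₖ 1 + 1 ⊗ₖ spin a) ^ 2

/-- The projection of two spins 3/2 onto the subspace of maximal total spin `3`, which is the
eigenspace of the square of the total spin for the eigenvalue `3 (3 + 1) = 12`. -/
noncomputable def maxSpinProj : Matrix (Fin 4 × Fin 4) (Fin 4 × Fin 4) ℂ :=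
  orthProj (Module.End.eigenspace (Matrix.toEuclideanLin totalSpinSq) 12)

/-! ## The AKLT model on a 3-regular graph -/

/-- A 3-regular graph with vertices `V` and edges `E`. The edges carry an (arbitrary) orientation,
which only affects the overall sign of the tensors below. -/
structure CubicGraph (V E : Type) where
  src : E → V
  tgt : E → V
  src_ne_tgt : ∀ e, src e ≠ tgt e
  /-- the edges at a vertex -/
  inc : V → Finset E
  mem_inc : ∀ v e, e ∈ inc v ↔ v = src e ∨ v = tgt e
  card_inc : ∀ v, (inc v).card = 3

/-- A finite subgraph. -/
@[ext]
structure Region {V E : Type} (G : CubicGraph V E) where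
  verts : Finset V
  edges : Finset E
  src_mem : ∀ e ∈ edges, G.src e ∈ verts
  tgt_mem : ∀ e ∈ edges, G.tgt e ∈ verts

namespace Region

variable {V E : Type} [DecidableEq V] [DecidableEq E] {G : CubicGraph V E}

/-- `A ∪ B`. -/
def union (A B : Region G) : Region G where
  verts := A.verts ∪ B.verts
  edges := A.edges ∪ B.edges
  src_mem e he := by
    rcases Finset.mem_union.1 he with h | h
    · exact Finset.mem_union_left _ (A.src_mem e h)
    · exact Finset.mem_union_right _ (B.src_mem e h)
  tgt_mem e he := by
    rcases Finset.mem_union.1 he with h | h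
    · exact Finset.mem_union_left _ (A.tgt_mem e h)
    · exact Finset.mem_union_right _ (B.tgt_mem e h)

/-- `A ∩ B`. -/
def inter (A B : Region G) : Region G where
  verts := A.verts ∩ B.verts
  edges := A.edges ∩ B.edges
  src_mem e he := Finset.mem_inter.2
    ⟨A.src_mem e (Finset.mem_inter.1 he).1, B.src_mem e (Finset.mem_inter.1 he).2⟩
  tgt_mem e he := Finset.mem_inter.2
    ⟨A.tgt_mem e (Finset.mem_inter.1 he).1, B.tgt_mem e (Finset.mem_inter.1 he).2⟩

/-- `A \ B`: the vertices of `A` that are not in `B`, with the edges of `A` between them. -/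
def diff (A B : Region G) : Region G where
  verts := A.verts \ B.verts
  edges := A.edges.filter fun e => G.src e ∉ B.verts ∧ G.tgt e ∉ B.verts
  src_mem e he := Finset.mem_sdiff.2
    ⟨A.src_mem e (Finset.mem_filter.1 he).1, (Finset.mem_filter.1 he).2.1⟩
  tgt_mem e he := Finset.mem_sdiff.2
    ⟨A.tgt_mem e (Finset.mem_filter.1 he).1, (Finset.mem_filter.1 he).2.2⟩

/-- The union of finitely many subgraphs. -/
def biUnion {I : Type} (S : Finset I) (A : I → Region G) : Region G where
  verts := S.biUnion fun i => (A i).verts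
  edges := S.biUnion fun i => (A i).edges
  src_mem e he := by
    obtain ⟨i, hi, h⟩ := Finset.mem_biUnion.1 he
    exact Finset.mem_biUnion.2 ⟨i, hi, (A i).src_mem e h⟩
  tgt_mem e he := by
    obtain ⟨i, hi, h⟩ := Finset.mem_biUnion.1 he
    exact Finset.mem_biUnion.2 ⟨i, hi, (A i).tgt_mem e h⟩

/-- The basis labels of the physical space of `A`: a spin-3/2 state for each vertex. -/
abbrev Config (A : Region G) : Type := A.verts → Fin 4

/-- The physical space of `A`, a spin 3/2 at each vertex. -/
abbrev Phys (A : Region G) : Type := EuclideanSpace ℂ A.Config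

/-- The free legs of `A`: the pairs of a vertex of `A` and an edge of the full graph at that
vertex that does not belong to `A`. Each carries a virtual spin 1/2. -/
def freeLegs (A : Region G) : Finset (Σ _ : V, E) :=
  A.verts.sigma fun v => G.inc v \ A.edges

/-- Matrix elements of the map `(ℂ²)^{⊗3} → ℂ⁴` given by the projection onto the symmetric
(spin-3/2) subspace: a product basis state of three spins 1/2 with `d` of them down is mapped to
`C(3,d)^{-1/2}` times the basis state `d`. -/
noncomputable def symCoeff (k : Fin 4) (d : ℕ) : ℂ :=
  if (k : ℕ) = d then ((1 / √(Nat.choose 3 d : ℝ) : ℝ) : ℂ) else 0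

/-- Coefficients of the singlet `(|01⟩ - |10⟩)/√2`, where `a` is the state of the first spin
and `1 - a` that of the second one. -/
noncomputable def singletCoeff (a : Fin 2) : ℂ :=
  if a = 0 then ((1 / √2 : ℝ) : ℂ) else ((-(1 / √2) : ℝ) : ℂ)

/-- The state (0 is up, 1 is down) of the virtual spin 1/2 at the vertex `v` for the edge `e`, when
the free legs are in the state `β` and, for each edge of `A`, its source is in the state `α`
and its target in the opposite state. -/
def legState (A : Region G) (α : A.edges → Fin 2) (β : A.freeLegs → Fin 2) (v : V) (e : E) :
    Fin 2 :=
  if he : e ∈ A.edges then (if v = G.src e then α ⟨e, he⟩ else 1 - α ⟨e, he⟩)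
  else if hf : (⟨v, e⟩ : Σ _ : V, E) ∈ A.freeLegs then β ⟨⟨v, e⟩, hf⟩ else 0

/-- The AKLT construction on `A`, as a map from the virtual space (a spin 1/2 for each
free leg) to the physical space: the spin-3/2 projector at each vertex, contracted with the singlet
on each edge of `A`. -/
noncomputable def tensor (A : Region G) : Matrix A.Config (A.freeLegs → Fin 2) ℂ :=
  Matrix.of fun σ β => ∑ α : A.edges → Fin 2,
    (∏ e : A.edges, singletCoeff (α e)) *
      ∏ v : A.verts, symCoeff (σ v) (∑ e ∈ G.inc v.1, (A.legState α β v.1 e : ℕ))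

/-- The image of the AKLT construction. -/
noncomputable def vbs (A : Region G) : Submodule ℂ A.Phys :=
  LinearMap.range (Matrix.toEuclideanLin A.tensor)

/-- `M ⊗ 1` on the physical space of `B`, for an operator `M` on the physical space of `A ⊆ B`. -/
def extend {A B : Region G} (_h : A.verts ⊆ B.verts) (M : Matrix A.Config A.Config ℂ) :
    Matrix B.Config B.Config ℂ :=
  Matrix.of fun σ τ =>
    if ∀ v : B.verts, v.1 ∉ A.verts → σ v = τ v
    then M (Finset.restrict₂ (π := fun _ => Fin 4) _h σ) (Finset.restrict₂ (π := fun _ => Fin 4) _h τ)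
    else 0

/-- The projection onto the image of the AKLT construction on `A`, acting on the
physical space of `B ⊇ A`. -/
noncomputable def vbsProj {A B : Region G} (h : A.verts ⊆ B.verts) : Matrix B.Config B.Config ℂ :=
  extend h (orthProj A.vbs)

/-- The AKLT term of an edge: the projection onto total spin 3 of its two ends. -/
noncomputable def edgeTerm (A : Region G) (e : A.edges) : Matrix A.Config A.Config ℂ :=
  let u : A.verts := ⟨G.src e.1, A.src_mem e.1 e.2⟩
  let v : A.verts := ⟨G.tgt e.1, A.tgt_mem e.1 e.2⟩
  Matrix.of fun σ τ =>
    if ∀ w : A.verts, w ≠ u → w ≠ v → σ w = τ w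
    then maxSpinProj (σ u, σ v) (τ u, τ v) else 0

/-- The AKLT Hamiltonian on `A`. -/
noncomputable def hamiltonian (A : Region G) : Matrix A.Config A.Config ℂ :=
  ∑ e : A.edges, A.edgeTerm e

/-- The tensor product of the spaces `vbs A₁`, `vbs A₂`, `vbs A₃` inside the physical space of `B`,
for subgraphs whose vertex sets partition that of `B`. -/
noncomputable def vbsTensor {A₁ A₂ A₃ B : Region G} (h₁ : A₁.verts ⊆ B.verts)
    (h₂ : A₂.verts ⊆ B.verts) (h₃ : A₃.verts ⊆ B.verts) : Submodule ℂ B.Phys :=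
  Submodule.span ℂ {ψ | ∃ a ∈ A₁.vbs, ∃ b ∈ A₂.vbs, ∃ c ∈ A₃.vbs, ∀ σ : B.Config,
    ψ σ = a (Finset.restrict₂ (π := fun _ => Fin 4) h₁ σ) *
      b (Finset.restrict₂ (π := fun _ => Fin 4) h₂ σ) *
      c (Finset.restrict₂ (π := fun _ => Fin 4) h₃ σ)}

theorem subset_union_left (A B : Region G) : A.verts ⊆ (A.union B).verts :=
  Finset.subset_union_left

theorem subset_union_right (A B : Region G) : B.verts ⊆ (A.union B).verts :=
  Finset.subset_union_right

theorem diff_subset_left (A B : Region G) : (A.diff B).verts ⊆ (A.union B).verts :=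
  Finset.sdiff_subset.trans Finset.subset_union_left

theorem inter_subset (A B : Region G) : (A.inter B).verts ⊆ (A.union B).verts :=
  Finset.inter_subset_left.trans Finset.subset_union_left

theorem diff_subset_right (A B : Region G) : (B.diff A).verts ⊆ (A.union B).verts :=
  Finset.sdiff_subset.trans Finset.subset_union_right

theorem subset_biUnion {I : Type} {S : Finset I} (A : I → Region G) (i : S) :
    (A i.1).verts ⊆ (biUnion S A).verts :=
  Finset.subset_biUnion_of_mem (fun i => (A i).verts) i.2

end Region

/-! ## The star lattice

The star lattice is the honeycomb lattice with each vertex replaced by a triangle. The unit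
cells are labelled by `ZMod m × ZMod n`. As `ZMod 0 = ℤ`, the infinite lattice is `m = n = 0`; for
`m, n > 0` one gets the `m × n` torus, and if exactly one of them is `0` a cylinder. -/

namespace Star

/-- The unit cells. -/
abbrev Cell (m n : ℕ) : Type := ZMod m × ZMod n

/-- The vertices: `(c, s, k)` is the corner `k` of the triangle `s` of the cell `c`. -/
abbrev Site (m n : ℕ) : Type := Cell m n × Bool × Fin 3

/-- The edges between triangles. -/
abbrev Bond (m n : ℕ) : Type := Cell m n × Fin 3

/-- All edges: `inl (c, s, k)` joins the corners `k` and `k + 1` of the triangle `(c, s)`, and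
`inr (c, k)` joins the corners `k` of the triangles `(c, false)` and `(c + shift k, true)`. -/
abbrev Edge (m n : ℕ) : Type := Site m n ⊕ Bond m n

/-- The three translations between a triangle and the adjacent ones. -/
def shift (m n : ℕ) : Fin 3 → Cell m n := ![(0, 0), (1, 0), (0, 1)]

/-- The star lattice `[3.12.12]`. -/
def lattice (m n : ℕ) : CubicGraph (Site m n) (Edge m n) where
  src
    | Sum.inl (c, s, k) => (c, s, k)
    | Sum.inr (c, k) => (c, false, k)
  tgt
    | Sum.inl (c, s, k) => (c, s, k + 1)
    | Sum.inr (c, k) => (c + shift m n k, true, k)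
  src_ne_tgt := by
    rintro (⟨c, s, k⟩ | ⟨c, k⟩)
    · simp
    · simp
  inc := fun (c, s, k) =>
    {Sum.inl (c, s, k), Sum.inl (c, s, k - 1), Sum.inr (if s then c - shift m n k else c, k)}
  mem_inc := by
    rintro ⟨c, s, k⟩ (⟨c', s', k'⟩ | ⟨c', k'⟩)
    · simp only [Finset.mem_insert, Finset.mem_singleton, Sum.inl.injEq, Prod.mk.injEq,
        reduceCtorEq, or_false, eq_sub_iff_add_eq]
      constructor <;> rintro (⟨h₁, h₂, h₃⟩ | ⟨h₁, h₂, h₃⟩) <;> simp [h₁, h₂, h₃]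
    · cases s
      · simp [eq_comm]
      · simp only [Finset.mem_insert, Finset.mem_singleton, reduceCtorEq, Sum.inr.injEq,
          Prod.mk.injEq, false_or, if_true, Bool.true_eq_false, false_and, and_false, true_and,
          eq_sub_iff_add_eq]
        constructor <;> rintro ⟨h₁, h₂⟩ <;> subst h₂ <;> exact ⟨h₁.symm, rfl⟩
  card_inc := by
    rintro ⟨c, s, k⟩
    rw [Finset.card_insert_of_notMem, Finset.card_insert_of_notMem, Finset.card_singleton]
    · simp
    · simp only [Finset.mem_insert, Finset.mem_singleton, Sum.inl.injEq, Prod.mk.injEq, true_and,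
        reduceCtorEq, or_false]
      fin_cases k <;> decide

/-- The vertices of a triangular plaquette. -/
def triVerts {m n : ℕ} (c : Cell m n) (s : Bool) : Finset (Site m n) :=
  Finset.univ.image fun k : Fin 3 => (c, s, k)

/-- The edges of a triangular plaquette. -/
def triEdges {m n : ℕ} (c : Cell m n) (s : Bool) : Finset (Edge m n) :=
  Finset.univ.image fun k : Fin 3 => Sum.inl (c, s, k)

/-- The subgraph of an edge between two triangles: this edge and the two triangular plaquettes
that it joins. -/
def term {m n : ℕ} (b : Bond m n) : Region (lattice m n) where
  verts := triVerts b.1 false ∪ triVerts (b.1 + shift m n b.2) true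
  edges := insert (Sum.inr b) (triEdges b.1 false ∪ triEdges (b.1 + shift m n b.2) true)
  src_mem := by
    obtain ⟨c, k⟩ := b
    intro e he
    simp only [triEdges, Finset.mem_insert, Finset.mem_union, Finset.mem_image, Finset.mem_univ,
      true_and] at he
    rcases he with rfl | ⟨l, rfl⟩ | ⟨l, rfl⟩ <;> simp [lattice, triVerts]
  tgt_mem := by
    obtain ⟨c, k⟩ := b
    intro e he
    simp only [triEdges, Finset.mem_insert, Finset.mem_union, Finset.mem_image, Finset.mem_univ,
      true_and] at he
    rcases he with rfl | ⟨l, rfl⟩ | ⟨l, rfl⟩ <;> simp [lattice, triVerts]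

/-- Two different terms overlap if they have a common vertex. -/
def Overlap {m n : ℕ} (i j : Bond m n) : Prop :=
  j ≠ i ∧ ¬ Disjoint (term i).verts (term j).verts

/-- The union of the subgraphs `term i` for `i ∈ S`. -/
def patch {m n : ℕ} (S : Finset (Bond m n)) : Region (lattice m n) :=
  Region.biUnion S term

/-- The regrouped Hamiltonian: the sum of `1 - Π_i` over `i ∈ S`, where `Π_i` is the projection onto
the image of the AKLT construction on `term i`. -/
noncomputable def regrouped {m n : ℕ} (S : Finset (Bond m n)) :
    Matrix (patch S).Config (patch S).Config ℂ :=
  ∑ i : S, (1 - Region.vbsProj (B := patch S) (Region.subset_biUnion term i))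

/-- The projection `Π_i` on the physical space of `term i ∪ term j`. -/
noncomputable def projLeft {m n : ℕ} (i j : Bond m n) :
    Matrix ((term i).union (term j)).Config ((term i).union (term j)).Config ℂ :=
  Region.vbsProj (Region.subset_union_left (term i) (term j))

/-- The projection `Π_j` on the physical space of `term i ∪ term j`. -/
noncomputable def projRight {m n : ℕ} (i j : Bond m n) :
    Matrix ((term i).union (term j)).Config ((term i).union (term j)).Config ℂ :=
  Region.vbsProj (Region.subset_union_right (term i) (term j))

/-- The space `ℋ_L ⊗ ℋ_C ⊗ ℋ_R` inside the physical space of `term i ∪ term j`, for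
`L = term i \ term j`, `C = term i ∩ term j`, `R = term j \ term i`. -/
noncomputable def reducedSpace {m n : ℕ} (i j : Bond m n) :
    Submodule ℂ ((term i).union (term j)).Phys :=
  Region.vbsTensor (Region.diff_subset_left (term i) (term j))
    (Region.inter_subset (term i) (term j)) (Region.diff_subset_right (term i) (term j))

/-- The reduced operator: the compression of `Π_i + Π_j` to `ℋ_L ⊗ ℋ_C ⊗ ℋ_R`. -/
noncomputable def reducedOperator {m n : ℕ} (i j : Bond m n) : Module.End ℂ (reducedSpace i j) :=
  compression (reducedSpace i j) (projLeft i j + projRight i j)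

end Star

open scoped Kronecker ComplexOrder

set_option linter.unusedSectionVars false

/-! A state of spins 3/2 is encoded as a polynomial of degree at most 3 in one variable per site,
the basis state `k` becoming `√C(3,k) x^k`. The projection onto total spin 3 of two sites
annihilates a state exactly when its polynomial vanishes for equal variables, that is, when `X u - X
v` divides it. The AKLT construction yields, up to a constant, the product of such differences over
the edges times a monomial in the free legs. Differences for different edges are coprime and degrees
add, so the common kernel of the edge terms is precisely the image of the construction
(`vbs_eq_iInf`). If no vertex has two free legs, distinct leg states give distinct monomials, which
yields all dimensions (`finrank_vbs`).

Two overlapping terms share exactly one triangle, so their union is a row of three triangles with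
two links. The number `η` is the cosine of the Friedrichs angle between the ranges of `E` and `F`:
the largest inner product of unit vectors of the two ranges that are orthogonal to the intersection.
With `T = (1 - E) + (1 - F)` the anticommutator inequality reads `T² ≥ (1 - x) T`, so it depends
only on the eigenvalues of `E + F`, which are `0`, `1`, `2` or within `η` of `1`, with `1 ± η`
attained. Each of `E`, `F` commutes with the projection of the outer triangle of the other term, so
the angle may be computed among states with singlets on all three triangles
(`FriedrichsAngle.of_reducing`).

There the Gram matrices of explicit bases are integral up to the factor `(2/27)^3`. The upper bound
on `η` is the positivity of `η · (Gram) ± (cross Gram)` modulo the common vectors, certified by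
rational elimination in blocks of fixed magnetisation (`cross_le`). The lower bound comes from an
explicit integer vector (`exists_test_vectors`). Together they confine `η` to an interval of length
`4.5 · 10⁻¹¹`; its existence as an exact maximum is compactness.

For the gap, the square of `∑ (1 - Π_i)` is expanded: disjoint terms commute and have nonnegative
products, and each of the at most four overlapping neighbours costs `η` (`posSemidef_sum_sq_sub`).
Finally the AKLT Hamiltonian is compared with the regrouped one: the Hamiltonian of a term has a gap
`g` that is uniform because only finitely many graphs with 6 vertices and 7 edges exist, and an edge
lies in at most three terms, whence `γ = g (1 - 4 η) / 3`. -/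

namespace AKLT

open MvPolynomial Function

/-! ### Spin states as polynomials. -/

section Polynomials

variable {ι : Type} [Fintype ι] [DecidableEq ι]

/-- The square root of the binomial coefficient `C(3,k)`. -/
noncomputable def weight (k : Fin 4) : ℂ := ((√(Nat.choose 3 k : ℝ) : ℝ) : ℂ)

theorem weight_ne_zero (k : Fin 4) : weight k ≠ 0 := by
  unfold weight
  rw [Complex.ofReal_ne_zero, Real.sqrt_ne_zero']
  exact_mod_cast Nat.choose_pos (by omega)

theorem prod_weight_ne_zero {s : Finset ι} (σ : ι → Fin 4) : ∏ i ∈ s, weight (σ i) ≠ 0 :=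
  Finset.prod_ne_zero_iff.2 fun _ _ => weight_ne_zero _

/-- The exponent vector of a configuration. -/
noncomputable def expo (σ : ι → Fin 4) : ι →₀ ℕ := Finsupp.equivFunOnFinite.symm fun i => (σ i : ℕ)

@[simp] theorem expo_apply (σ : ι → Fin 4) (i : ι) : expo σ i = σ i := rfl

theorem expo_injective : Injective (expo : (ι → Fin 4) → ι →₀ ℕ) := fun σ τ h => by
  funext i
  exact Fin.ext (DFunLike.congr_fun h i)

/-- The polynomial of a state of spins 3/2: the basis state `k` of a spin corresponds to
`√C(3,k) x^k`. -/
noncomputable def toPoly : EuclideanSpace ℂ (ι → Fin 4) →ₗ[ℂ] MvPolynomial ι ℂ where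
  toFun ψ := ∑ σ, monomial (expo σ) (ψ σ * ∏ i, weight (σ i))
  map_add' ψ φ := by simp [add_mul, Finset.sum_add_distrib]
  map_smul' c ψ := by simp [mul_assoc, Finset.smul_sum, smul_monomial]

theorem toPoly_apply (ψ : EuclideanSpace ℂ (ι → Fin 4)) :
    toPoly ψ = ∑ σ, monomial (expo σ) (ψ σ * ∏ i, weight (σ i)) := rfl

theorem coeff_toPoly (ψ : EuclideanSpace ℂ (ι → Fin 4)) (σ : ι → Fin 4) :
    coeff (expo σ) (toPoly ψ) = ψ σ * ∏ i, weight (σ i) := by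
  simp [toPoly_apply, coeff_sum, coeff_monomial, expo_injective.eq_iff]

theorem toPoly_injective : Injective (toPoly (ι := ι)) := fun ψ φ h => by
  ext σ
  have := congrArg (coeff (expo σ)) h
  rw [coeff_toPoly, coeff_toPoly] at this
  exact mul_right_cancel₀ (prod_weight_ne_zero σ) this

theorem degreeOf_toPoly_le (ψ : EuclideanSpace ℂ (ι → Fin 4)) (i : ι) :
    degreeOf i (toPoly ψ) ≤ 3 := by
  rw [degreeOf_le_iff]
  intro m hm
  rw [mem_support_iff, toPoly_apply, coeff_sum] at hm
  obtain ⟨σ, -, hσ⟩ := Finset.exists_ne_zero_of_sum_ne_zero hm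
  rw [coeff_monomial] at hσ
  split_ifs at hσ with h
  · rw [← h, expo_apply]; omega
  · exact absurd rfl hσ

/-- The coefficient of total exponent `M` of the two sites `u`, `v`, after identification of their
variables. -/
noncomputable def diagSum (u v : ι) (ψ : EuclideanSpace ℂ (ι → Fin 4)) (σ : ι → Fin 4) (M : ℕ) :
    ℂ :=
  ∑ p : Fin 4 × Fin 4 with (p.1 : ℕ) + p.2 = M,
    weight p.1 * weight p.2 * ψ (update (update σ u p.1) v p.2)

/-- The states whose polynomial vanishes when the variables of the sites `u` and `v` are
identified. -/
noncomputable def diagKernel (u v : ι) : Submodule ℂ (EuclideanSpace ℂ (ι → Fin 4)) where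
  carrier := {ψ | ∀ σ M, diagSum u v ψ σ M = 0}
  add_mem' {ψ φ} h h' σ M := by
    have h1 := h σ M
    have h2 := h' σ M
    simp only [diagSum] at h1 h2 ⊢
    simp [mul_add, Finset.sum_add_distrib, h1, h2]
  zero_mem' σ M := by simp [diagSum]
  smul_mem' c ψ h σ M := by
    have h1 := h σ M
    simp only [diagSum] at h1 ⊢
    simp only [PiLp.smul_apply, smul_eq_mul, mul_left_comm _ c, ← Finset.mul_sum, h1, mul_zero]

theorem mem_diagKernel {u v : ι} {ψ : EuclideanSpace ℂ (ι → Fin 4)} :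
    ψ ∈ diagKernel u v ↔ ∀ σ M, diagSum u v ψ σ M = 0 := Iff.rfl

theorem diagKernel_comm {u v : ι} (h : u ≠ v) : diagKernel u v = diagKernel v u := by
  ext ψ
  simp only [mem_diagKernel]
  refine forall₂_congr fun σ M => ?_
  have : diagSum u v ψ σ M = diagSum v u ψ σ M := by
    unfold diagSum
    refine Finset.sum_nbij' Prod.swap Prod.swap ?_ ?_ ?_ ?_ ?_ <;>
      simp +contextual [add_comm, mul_comm, update_comm h]
  rw [this]

/-- The substitution of the variable of `u` for that of `v`. -/
noncomputable def identify (u v : ι) : MvPolynomial ι ℂ →ₐ[ℂ] MvPolynomial ι ℂ :=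
  rename (update id v u)

/-- Identification moves the exponent of `v` onto `u`, so only the sum of these two exponents and
the exponents of the other sites survive. -/
theorem mapDomain_eq_iff {u v : ι} (huv : u ≠ v) (σ τ : ι → Fin 4) :
    (expo σ).mapDomain (update id v u) = (expo τ).mapDomain (update id v u) ↔
      (σ u : ℕ) + σ v = τ u + τ v ∧ ∀ i, i ≠ u → i ≠ v → σ i = τ i := by
  have key (ρ : ι → Fin 4) (i : ι) : (expo ρ).mapDomain (update id v u) i =
      if i = u then (ρ u : ℕ) + ρ v else if i = v then 0 else ρ i := by
    rw [Finsupp.mapDomain, Finsupp.sum_fintype _ _ (by simp), Finsupp.finsetSum_apply]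
    simp only [expo_apply, Finsupp.single_apply]
    rw [← Finset.add_sum_erase _ _ (Finset.mem_univ v),
      ← Finset.add_sum_erase _ _ (Finset.mem_erase.2 ⟨huv, Finset.mem_univ u⟩)]
    have : ∑ x ∈ (Finset.univ.erase v).erase u, (if update id v u x = i then (ρ x : ℕ) else 0) =
        if i = u then 0 else if i = v then 0 else ρ i := by
      rw [Finset.sum_congr rfl (g := fun x => if x = i then (ρ x : ℕ) else 0)]
      · rw [Finset.sum_ite_eq']
        split_ifs <;> simp_all
      · intro x hx
        rw [update_of_ne (by simp_all)]; rfl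
    rw [this, update_self, update_of_ne huv]
    simp only [id]
    by_cases hu : i = u
    · subst hu
      simp [add_comm]
    · simp only [hu, Ne.symm hu, if_false, zero_add]
      split_ifs <;> rfl
  rw [DFunLike.ext_iff]
  simp only [key]
  constructor
  · intro h
    refine ⟨by simpa using h u, fun i hu hv => ?_⟩
    have := h i
    rw [if_neg hu, if_neg hv, if_neg hu, if_neg hv] at this
    exact Fin.ext this
  · rintro ⟨h, h'⟩ i
    split_ifs with hu hv
    · exact h
    · rfl
    · rw [h' i hu hv]

/-- The weights of `u` and `v` vary within the sum and stay in `diagSum`; those of the other sites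
are common to all terms and factor out. They are nonzero, so the vanishing of every `diagSum` is the
vanishing of the identified polynomial. -/
theorem coeff_identify_toPoly {u v : ι} (huv : u ≠ v) (ψ : EuclideanSpace ℂ (ι → Fin 4))
    (σ : ι → Fin 4) :
    coeff ((expo σ).mapDomain (update id v u)) (identify u v (toPoly ψ)) =
      (∏ i ∈ (Finset.univ.erase v).erase u, weight (σ i)) * diagSum u v ψ σ (σ u + σ v) := by
  rw [toPoly_apply, map_sum, coeff_sum]
  simp only [identify, rename_monomial, coeff_monomial, mapDomain_eq_iff huv]
  rw [← Finset.sum_filter, diagSum, Finset.mul_sum]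
  refine Finset.sum_nbij' (fun τ => (τ u, τ v)) (fun p => update (update σ u p.1) v p.2)
    ?_ ?_ ?_ ?_ ?_
  · intro τ hτ
    simpa using (Finset.mem_filter.1 hτ).2.1
  · intro p hp
    have := (Finset.mem_filter.1 hp).2
    simp only [Finset.mem_filter, Finset.mem_univ, true_and, update_self, update_of_ne huv]
    exact ⟨this, fun i hu hv => by rw [update_of_ne hv, update_of_ne hu]⟩
  · intro τ hτ
    have := (Finset.mem_filter.1 hτ).2.2
    funext i
    by_cases hv : i = v
    · subst hv; simp
    by_cases hu : i = u
    · subst hu; simp [update_of_ne huv]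
    rw [update_of_ne hv, update_of_ne hu, this i hu hv]
  · intro p hp
    simp [update_of_ne huv]
  · intro τ hτ
    have h := (Finset.mem_filter.1 hτ).2.2
    have e : update (update σ u (τ u)) v (τ v) = τ := by
      funext i
      by_cases hv : i = v
      · subst hv; simp
      by_cases hu : i = u
      · subst hu; simp [update_of_ne huv]
      rw [update_of_ne hv, update_of_ne hu, h i hu hv]
    rw [e, ← Finset.mul_prod_erase _ _ (Finset.mem_univ v),
      ← Finset.mul_prod_erase _ _ (Finset.mem_erase.2 ⟨huv, Finset.mem_univ u⟩),
      Finset.prod_congr rfl (fun i hi => by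
        rw [h i (Finset.ne_of_mem_erase hi) (Finset.ne_of_mem_erase (Finset.mem_of_mem_erase hi))])]
    ring

theorem mem_diagKernel_iff_identify {u v : ι} (huv : u ≠ v) (ψ : EuclideanSpace ℂ (ι → Fin 4)) :
    ψ ∈ diagKernel u v ↔ identify u v (toPoly ψ) = 0 := by
  constructor
  · intro h
    ext m
    rw [coeff_zero]
    by_cases hm : ∃ σ : ι → Fin 4, (expo σ).mapDomain (update id v u) = m
    · obtain ⟨σ, rfl⟩ := hm
      rw [coeff_identify_toPoly huv, h, mul_zero]
    · rw [toPoly_apply, map_sum, coeff_sum]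
      refine Finset.sum_eq_zero fun σ _ => ?_
      simp only [identify, rename_monomial, coeff_monomial]
      exact if_neg fun hσ => hm ⟨σ, hσ⟩
  · intro h σ M
    by_cases hM : ∃ p : Fin 4 × Fin 4, (p.1 : ℕ) + p.2 = M
    · obtain ⟨p, hp⟩ := hM
      have := coeff_identify_toPoly huv ψ (update (update σ u p.1) v p.2)
      rw [h, coeff_zero, eq_comm, mul_eq_zero, or_iff_right (prod_weight_ne_zero _)] at this
      simp only [update_self, update_of_ne huv, hp] at this
      rw [← this]
      unfold diagSum
      simp [update_comm huv]
    · unfold diagSum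
      rw [Finset.filter_false_of_mem fun p _ hp => hM ⟨p, hp⟩, Finset.sum_empty]

/-- Modulo `X u - X v` the substitution is the identity: the two algebra maps to the quotient agree
on the variables. -/
theorem dvd_sub_identify (u v : ι) (p : MvPolynomial ι ℂ) : X u - X v ∣ p - identify u v p := by
  rw [← Ideal.mem_span_singleton, ← Ideal.Quotient.eq]
  have : (Ideal.Quotient.mkₐ ℂ (Ideal.span {(X u - X v : MvPolynomial ι ℂ)})) =
      (Ideal.Quotient.mkₐ ℂ (Ideal.span {(X u - X v : MvPolynomial ι ℂ)})).comp
        (identify u v) := by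
    refine algHom_ext fun i => ?_
    simp only [AlgHom.comp_apply, identify, rename_X, Ideal.Quotient.mkₐ_eq_mk]
    by_cases hi : i = v
    · subst hi
      rw [update_self, eq_comm, Ideal.Quotient.eq]
      exact Ideal.mem_span_singleton_self _
    · rw [update_of_ne hi]; rfl
  exact DFunLike.congr_fun this p

theorem identify_eq_zero_iff {u v : ι} (p : MvPolynomial ι ℂ) :
    identify u v p = 0 ↔ X u - X v ∣ p := by
  constructor
  · intro h
    simpa [h] using dvd_sub_identify u v p
  · rintro ⟨q, rfl⟩
    have : identify u v (X u - X v) = 0 := by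
      by_cases huv : u = v
      · subst huv; simp
      · simp [identify, update_of_ne huv]
    rw [map_mul, this, zero_mul]

theorem mem_diagKernel_iff_dvd {u v : ι} (huv : u ≠ v) (ψ : EuclideanSpace ℂ (ι → Fin 4)) :
    ψ ∈ diagKernel u v ↔ X u - X v ∣ toPoly ψ := by
  rw [mem_diagKernel_iff_identify huv, identify_eq_zero_iff]

theorem X_sub_X_ne_zero {u v : ι} (huv : u ≠ v) : (X u - X v : MvPolynomial ι ℂ) ≠ 0 :=
  sub_ne_zero.2 fun h => huv (X_injective h)

/-- Differences of variables for different pairs are coprime. -/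
theorem prod_dvd_of_forall_dvd {κ : Type} {s t : κ → ι} (hst : ∀ e, s e ≠ t e) (D : Finset κ)
    (hD : ∀ e ∈ D, ∀ e' ∈ D, s(s e, t e) = s(s e', t e') → e = e') (p : MvPolynomial ι ℂ)
    (h : ∀ e ∈ D, (X (s e) - X (t e) : MvPolynomial ι ℂ) ∣ p) :
    ∏ e ∈ D, (X (s e) - X (t e) : MvPolynomial ι ℂ) ∣ p := by
  classical
  induction D using Finset.induction_on with
  | empty => simp
  | insert a D ha ih =>
    rw [Finset.prod_insert ha, mul_comm]
    obtain ⟨q, hq⟩ := ih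
      (fun e he e' he' => hD e (Finset.mem_insert_of_mem he) e' (Finset.mem_insert_of_mem he'))
      (fun e he => h e (Finset.mem_insert_of_mem he))
    rw [hq]
    refine mul_dvd_mul_left _ ?_
    -- Identifying the ends of `a` is a homomorphism into a domain, so it kills an earlier factor or
    -- the cofactor `q`. It can kill the difference of `e` only if `e` and `a` have the same two
    -- ends.
    have h1 := (identify_eq_zero_iff _).2 (h a (Finset.mem_insert_self _ _))
    rw [hq, map_mul, mul_eq_zero, map_prod, Finset.prod_eq_zero_iff] at h1
    rcases h1 with ⟨e, he, h1⟩ | h1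
    · exfalso
      have hne : e ≠ a := fun h => ha (h ▸ he)
      refine hne (hD e (Finset.mem_insert_of_mem he) a (Finset.mem_insert_self _ _) ?_)
      simp only [identify, map_sub, rename_X, sub_eq_zero] at h1
      have h2 := X_injective h1
      have := hst e
      have := hst a
      rw [Sym2.eq_iff]
      simp only [update_apply, id] at h2
      split_ifs at h2 <;> simp_all
    · exact (identify_eq_zero_iff _).1 h1

theorem one_le_degreeOf_X_sub_X {u v i : ι} (huv : u ≠ v) (hi : i = u ∨ i = v) :
    1 ≤ degreeOf i (X u - X v : MvPolynomial ι ℂ) := by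
  have hs : (Finsupp.single i 1 : ι →₀ ℕ) ∈ (X u - X v : MvPolynomial ι ℂ).support := by
    rw [mem_support_iff, coeff_sub, coeff_X, coeff_X]
    rcases hi with rfl | rfl
    · simp [Finsupp.single_left_inj, huv.symm]
    · simp [Finsupp.single_left_inj, huv]
  simpa using degreeOf_le_iff.1 (le_refl (degreeOf i (X u - X v : MvPolynomial ι ℂ))) _ hs

/-- Degrees in each variable add in a domain, and every difference that involves `i` uses up one of
the three available units. What remains for the cofactor is, when `D` consists of all edges of a
region, the number of free legs at `i`. -/
theorem exists_factor {κ : Type} {s t : κ → ι} (hst : ∀ e, s e ≠ t e) (D : Finset κ)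
    (hD : ∀ e ∈ D, ∀ e' ∈ D, s(s e, t e) = s(s e', t e') → e = e')
    (ψ : EuclideanSpace ℂ (ι → Fin 4)) (h : ∀ e ∈ D, ψ ∈ diagKernel (s e) (t e)) :
    ∃ f : MvPolynomial ι ℂ, toPoly ψ = (∏ e ∈ D, (X (s e) - X (t e))) * f ∧
      ∀ m ∈ f.support, ∀ i, m i + (D.filter fun e => i = s e ∨ i = t e).card ≤ 3 := by
  obtain ⟨f, hf⟩ := prod_dvd_of_forall_dvd hst D hD (toPoly ψ)
    fun e he => (mem_diagKernel_iff_dvd (hst e) ψ).1 (h e he)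
  refine ⟨f, hf, fun m hm i => ?_⟩
  have hf0 : f ≠ 0 := by rintro rfl; simp at hm
  have h0 : ∀ e ∈ D, (X (s e) - X (t e) : MvPolynomial ι ℂ) ≠ 0 :=
    fun e _ => X_sub_X_ne_zero (hst e)
  have h3 := degreeOf_toPoly_le ψ i
  rw [hf, degreeOf_mul_eq (Finset.prod_ne_zero_iff.2 h0) hf0, degreeOf_prod_eq _ _ h0] at h3
  have h1 := degreeOf_le_iff.1 (le_refl (degreeOf i f)) m hm
  have h2 : (D.filter fun e => i = s e ∨ i = t e).card ≤
      ∑ e ∈ D, degreeOf i (X (s e) - X (t e) : MvPolynomial ι ℂ) := by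
    rw [Finset.card_filter]
    refine Finset.sum_le_sum fun e _ => ?_
    split_ifs with hi
    · exact one_le_degreeOf_X_sub_X (hst e) hi
    · exact Nat.zero_le _
  omega

end Polynomials

end AKLT

namespace AKLT

open MvPolynomial Function

/-! ### The AKLT construction in terms of polynomials. -/

section Tensor

variable {V E : Type} [DecidableEq V] [DecidableEq E] {G : CubicGraph V E}

/-- The source of an edge of a region, as a vertex of the region. -/
def src (A : Region G) (e : A.edges) : A.verts := ⟨G.src e.1, A.src_mem e.1 e.2⟩

/-- The target of an edge of a region, as a vertex of the region. -/
def tgt (A : Region G) (e : A.edges) : A.verts := ⟨G.tgt e.1, A.tgt_mem e.1 e.2⟩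

theorem src_ne_tgt (A : Region G) (e : A.edges) : src A e ≠ tgt A e := fun h =>
  G.src_ne_tgt e.1 (congrArg Subtype.val h)

/-- The vertex of a free leg. -/
def legVert (A : Region G) (l : A.freeLegs) : A.verts :=
  ⟨l.1.1, (Finset.mem_sigma.1 l.2).1⟩

/-- The column of the tensor of a region for the virtual state `β`. -/
noncomputable def column (A : Region G) (β : A.freeLegs → Fin 2) : A.Phys :=
  WithLp.toLp 2 fun σ => A.tensor σ β

/-- The polynomial of the singlets on the edges of a region. -/
noncomputable def edgePoly (A : Region G) : MvPolynomial A.verts ℂ :=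
  ∏ e : A.edges, (X (src A e) - X (tgt A e))

theorem edgePoly_ne_zero (A : Region G) : edgePoly A ≠ 0 :=
  Finset.prod_ne_zero_iff.2 fun e _ => X_sub_X_ne_zero (src_ne_tgt A e)

theorem sum_legState_lt (A : Region G) (α : A.edges → Fin 2) (β : A.freeLegs → Fin 2) (v : V) :
    ∑ e ∈ G.inc v, (A.legState α β v e : ℕ) < 4 := by
  refine Nat.lt_succ_of_le ((Finset.sum_le_card_nsmul _ _ 1 fun e _ => by omega).trans ?_)
  simp [G.card_inc]

/-- The normalisation of the symmetric projector is inverse to that of `toPoly`, so a product of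
virtual basis states becomes a monomial with coefficient 1. -/
theorem symCoeff_mul_weight (k : Fin 4) (d : ℕ) :
    Region.symCoeff k d * weight k = if (k : ℕ) = d then 1 else 0 := by
  unfold Region.symCoeff weight
  split_ifs with h
  · subst h
    rw [← Complex.ofReal_mul, one_div, inv_mul_cancel₀, Complex.ofReal_one]
    rw [Real.sqrt_ne_zero']
    exact_mod_cast Nat.choose_pos (by omega)
  · rw [zero_mul]

theorem sum_monomial_prod_ite {ι : Type} [Fintype ι] [DecidableEq ι] (d : ι → ℕ)
    (hd : ∀ i, d i < 4) :
    ∑ σ : ι → Fin 4, monomial (expo σ) (∏ i, if (σ i : ℕ) = d i then (1 : ℂ) else 0) =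
      ∏ i, X i ^ d i := by
  rw [Finset.sum_eq_single (fun i => ⟨d i, hd i⟩)]
  · simp only [if_true, Finset.prod_const_one]
    rw [monomial_eq, map_one, one_mul, Finsupp.prod_fintype _ _ (by simp)]
    rfl
  · intro σ _ h
    obtain ⟨i, hi⟩ := Function.ne_iff.1 h
    rw [Finset.prod_eq_zero (Finset.mem_univ i), map_zero]
    exact if_neg fun h => hi (Fin.ext h)
  · simp

/-- The exponent of a vertex counts its legs in the state 1. Regrouped by legs, an internal edge
contributes at both of its ends, in opposite states, and a free leg at its only vertex. -/
theorem prod_legState (A : Region G) (α : A.edges → Fin 2) (β : A.freeLegs → Fin 2) :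
    ∏ v : A.verts, (X v : MvPolynomial A.verts ℂ) ^ (∑ e ∈ G.inc v.1, (A.legState α β v.1 e : ℕ)) =
      (∏ e : A.edges, X (src A e) ^ (α e : ℕ) * X (tgt A e) ^ ((1 - α e : Fin 2) : ℕ)) *
        ∏ l : A.freeLegs, X (legVert A l) ^ (β l : ℕ) := by
  let F : V → E → MvPolynomial A.verts ℂ := fun v e =>
    if h : v ∈ A.verts then X ⟨v, h⟩ ^ (A.legState α β v e : ℕ) else 1
  have h1 : ∏ v : A.verts, (X v : MvPolynomial A.verts ℂ) ^
      (∑ e ∈ G.inc v.1, (A.legState α β v.1 e : ℕ)) = ∏ v ∈ A.verts, ∏ e ∈ G.inc v, F v e := by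
    rw [← Finset.prod_coe_sort A.verts]
    refine Finset.prod_congr rfl fun v _ => ?_
    rw [← Finset.prod_pow_eq_pow_sum]
    refine Finset.prod_congr rfl fun e _ => ?_
    simp only [F]
    rw [dif_pos v.2]
  have h2 : ∏ v ∈ A.verts, ∏ e ∈ G.inc v \ A.edges, F v e =
      ∏ l : A.freeLegs, X (legVert A l) ^ (β l : ℕ) := by
    have : ∏ v ∈ A.verts, ∏ e ∈ G.inc v \ A.edges, F v e =
        ∏ x ∈ A.freeLegs, F x.1 x.2 := by
      rw [Region.freeLegs, Finset.prod_sigma]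
    rw [this, ← Finset.prod_coe_sort A.freeLegs]
    refine Finset.prod_congr rfl fun l _ => ?_
    have hl := Finset.mem_sigma.1 l.2
    have he : l.1.2 ∉ A.edges := (Finset.mem_sdiff.1 hl.2).2
    simp only [F]
    rw [dif_pos hl.1, Region.legState, dif_neg he, dif_pos l.2]
    rfl
  have h3 : ∏ v ∈ A.verts, ∏ e ∈ G.inc v ∩ A.edges, F v e =
      ∏ e : A.edges, X (src A e) ^ (α e : ℕ) * X (tgt A e) ^ ((1 - α e : Fin 2) : ℕ) := by
    rw [Finset.prod_comm' (t' := A.edges) (s' := fun e => {G.src e, G.tgt e}),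
      ← Finset.prod_coe_sort A.edges]
    · refine Finset.prod_congr rfl fun e _ => ?_
      rw [Finset.prod_pair (G.src_ne_tgt _)]
      simp only [F]
      rw [dif_pos (A.src_mem _ e.2), dif_pos (A.tgt_mem _ e.2), Region.legState, Region.legState,
        dif_pos e.2, dif_pos e.2, if_pos rfl, if_neg (G.src_ne_tgt _).symm]
      rfl
    · intro v e
      simp only [Finset.mem_inter, G.mem_inc, Finset.mem_insert, Finset.mem_singleton]
      constructor
      · tauto
      · rintro ⟨h | h, he⟩
        · exact ⟨h ▸ A.src_mem e he, Or.inl h, he⟩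
        · exact ⟨h ▸ A.tgt_mem e he, Or.inr h, he⟩
  rw [h1, ← h2, ← h3, ← Finset.prod_mul_distrib]
  exact Finset.prod_congr rfl fun v _ => (Finset.prod_inter_mul_prod_sdiff _ _ _).symm

/-- The polynomial of a column of the tensor of a region. -/
theorem toPoly_column (A : Region G) : ∃ c : ℂ, c ≠ 0 ∧ ∀ β : A.freeLegs → Fin 2,
    toPoly (column A β) = C c * (edgePoly A * ∏ l, X (legVert A l) ^ (β l : ℕ)) := by
  -- A singlet contributes target minus source, divided by `√2`; `edgePoly` has source minus target.
  refine ⟨∏ _e : A.edges, (-((1 / √2 : ℝ) : ℂ)), ?_, fun β => ?_⟩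
  · refine Finset.prod_ne_zero_iff.2 fun _ _ => neg_ne_zero.2 ?_
    rw [Complex.ofReal_ne_zero]
    positivity
  have h1 (σ : A.verts → Fin 4) : (column A β) σ * ∏ i, weight (σ i) =
      ∑ α : A.edges → Fin 2, (∏ e, Region.singletCoeff (α e)) *
        ∏ v, if (σ v : ℕ) = ∑ e ∈ G.inc v.1, (A.legState α β v.1 e : ℕ) then 1 else 0 := by
    simp only [column, Region.tensor, Matrix.of_apply, Finset.sum_mul, mul_assoc,
      ← Finset.prod_mul_distrib, symCoeff_mul_weight]
  simp only [toPoly_apply, h1, map_sum]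
  rw [Finset.sum_comm]
  have h2 (α : A.edges → Fin 2) : ∑ σ : A.verts → Fin 4, monomial (expo σ)
      ((∏ e, Region.singletCoeff (α e)) * ∏ v, if (σ v : ℕ) =
        ∑ e ∈ G.inc v.1, (A.legState α β v.1 e : ℕ) then (1 : ℂ) else 0) =
      (∏ e : A.edges, C (Region.singletCoeff (α e)) *
        (X (src A e) ^ (α e : ℕ) * X (tgt A e) ^ ((1 - α e : Fin 2) : ℕ))) *
        ∏ l : A.freeLegs, X (legVert A l) ^ (β l : ℕ) := by
    simp only [← C_mul_monomial]
    rw [← Finset.mul_sum, sum_monomial_prod_ite (fun v : A.verts => ∑ e ∈ G.inc v.1, (A.legState α β v.1 e : ℕ))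
        fun v => sum_legState_lt A α β v.1,
      prod_legState, map_prod, ← mul_assoc, ← Finset.prod_mul_distrib]
  simp only [h2]
  rw [← Finset.sum_mul, ← mul_assoc]
  congr 1
  rw [← Fintype.prod_sum (fun (e : A.edges) (a : Fin 2) => C (Region.singletCoeff a) *
        (X (src A e) ^ (a : ℕ) * X (tgt A e) ^ ((1 - a : Fin 2) : ℕ))), map_prod, edgePoly,
    ← Finset.prod_mul_distrib]
  refine Finset.prod_congr rfl fun e _ => ?_
  rw [Fin.sum_univ_two]
  simp only [Region.singletCoeff, if_true, if_neg (one_ne_zero : (1 : Fin 2) ≠ 0), map_neg,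
    Complex.ofReal_neg, sub_self, sub_zero, Fin.val_zero, Fin.val_one, pow_zero, pow_one]
  ring

theorem toEuclideanLin_tensor (A : Region G) (x : EuclideanSpace ℂ (A.freeLegs → Fin 2)) :
    Matrix.toEuclideanLin A.tensor x = ∑ β, x β • column A β := by
  ext σ
  simp [Matrix.toLpLin_apply, Matrix.mulVec, dotProduct, column, mul_comm]

theorem column_mem_vbs (A : Region G) (β : A.freeLegs → Fin 2) : column A β ∈ A.vbs :=
  ⟨EuclideanSpace.single β 1, by
    rw [toEuclideanLin_tensor, Finset.sum_eq_single β] <;> simp +contextual⟩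

theorem vbs_eq_span (A : Region G) : A.vbs = Submodule.span ℂ (Set.range (column A)) := by
  refine le_antisymm ?_ (Submodule.span_le.2 (by rintro _ ⟨β, rfl⟩; exact column_mem_vbs A β))
  rintro _ ⟨x, rfl⟩
  rw [toEuclideanLin_tensor]
  exact Submodule.sum_mem _ fun β _ => Submodule.smul_mem _ _ (Submodule.subset_span ⟨β, rfl⟩)

/-- Provides a ground state on every region, also where the construction is not injective. -/
theorem column_ne_zero (A : Region G) (β : A.freeLegs → Fin 2) : column A β ≠ 0 := by
  intro h
  obtain ⟨c, hc, h1⟩ := toPoly_column A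
  have := h1 β
  rw [h, map_zero, eq_comm, mul_eq_zero, mul_eq_zero, Finset.prod_eq_zero_iff] at this
  rcases this with h | h | ⟨l, -, h⟩
  · exact hc (C_eq_zero.1 h)
  · exact edgePoly_ne_zero A h
  · exact pow_ne_zero _ (X_ne_zero _) h

theorem vbs_le_diagKernel (A : Region G) (e : A.edges) :
    A.vbs ≤ diagKernel (src A e) (tgt A e) := by
  rw [vbs_eq_span, Submodule.span_le]
  rintro _ ⟨β, rfl⟩
  obtain ⟨c, -, h⟩ := toPoly_column A
  rw [SetLike.mem_coe, mem_diagKernel_iff_dvd (src_ne_tgt A e), h]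
  exact ((Finset.dvd_prod_of_mem _ (Finset.mem_univ e)).mul_right _).mul_left _

/-- Different edges of a graph have different pairs of ends. -/
def IsSimple (G : CubicGraph V E) : Prop :=
  ∀ e e', s(G.src e, G.tgt e) = s(G.src e', G.tgt e') → e = e'

theorem IsSimple.region (hG : IsSimple G) (A : Region G) (e e' : A.edges)
    (h : s(src A e, tgt A e) = s(src A e', tgt A e')) : e = e' := by
  refine Subtype.ext (hG _ _ ?_)
  exact congrArg (Sym2.map Subtype.val) h

/-- Turns the degree bound of `exists_factor` into a bound by the number of free legs. -/
theorem card_edges_at (A : Region G) (v : A.verts) :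
    (Finset.univ.filter fun e => v = src A e ∨ v = tgt A e).card +
      (G.inc v.1 \ A.edges).card = 3 := by
  rw [← G.card_inc v.1, ← Finset.card_inter_add_card_sdiff (G.inc v.1) A.edges]
  congr 1
  refine Finset.card_bij (fun e _ => e.1) ?_ (fun _ _ _ _ h => Subtype.ext h) ?_
  · intro e he
    rw [Finset.mem_inter, G.mem_inc]
    exact ⟨by simpa [src, tgt, Subtype.ext_iff] using he, e.2⟩
  · intro e he
    rw [Finset.mem_inter, G.mem_inc] at he
    exact ⟨⟨e, he.2⟩, by simpa [src, tgt, Subtype.ext_iff] using he.1, rfl⟩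

/-- Every distribution of exponents that the free legs allow comes from a virtual state. -/
theorem exists_legs (A : Region G) (m : A.verts →₀ ℕ)
    (hm : ∀ v, m v ≤ (G.inc v.1 \ A.edges).card) :
    ∃ β : A.freeLegs → Fin 2,
      ∏ l, (X (legVert A l) : MvPolynomial A.verts ℂ) ^ (β l : ℕ) = monomial m 1 := by
  -- At each vertex any `m v` of its free legs are put into the state 1; which ones is irrelevant
  -- for the polynomial.
  choose T hT hTc using fun v => Finset.exists_subset_card_eq (hm v)
  refine ⟨fun l => if l.1.2 ∈ T (legVert A l) then 1 else 0, ?_⟩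
  rw [monomial_eq, map_one, one_mul, Finsupp.prod_fintype _ _ (by simp)]
  let F : V → E → MvPolynomial A.verts ℂ := fun v e =>
    if h : v ∈ A.verts then (if e ∈ T ⟨v, h⟩ then X ⟨v, h⟩ else 1) else 1
  have h2 : ∏ v ∈ A.verts, ∏ e ∈ G.inc v \ A.edges, F v e = ∏ x ∈ A.freeLegs, F x.1 x.2 := by
    rw [Region.freeLegs, Finset.prod_sigma]
  have h3 : ∏ x ∈ A.freeLegs, F x.1 x.2 = ∏ l : A.freeLegs, (X (legVert A l) :
      MvPolynomial A.verts ℂ) ^ (((if l.1.2 ∈ T (legVert A l) then 1 else 0) : Fin 2) : ℕ) := by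
    rw [← Finset.prod_coe_sort A.freeLegs]
    refine Finset.prod_congr rfl fun l _ => ?_
    simp only [F]
    rw [dif_pos (Finset.mem_sigma.1 l.2).1]
    change (if l.1.2 ∈ T (legVert A l) then _ else _) = _
    split_ifs
    · exact (pow_one _).symm
    · exact (pow_zero _).symm
  rw [← h3, ← h2, ← Finset.prod_coe_sort A.verts]
  refine Finset.prod_congr rfl fun v _ => ?_
  simp only [F]
  simp only [dif_pos v.2]
  rw [Finset.prod_ite, Finset.prod_const, Finset.prod_const_one, mul_one,
    Finset.filter_mem_eq_inter, Finset.inter_eq_right.2 (hT v), hTc]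

/-- The valence bond states are the common kernel of the edge terms. -/
theorem vbs_eq_iInf (hG : IsSimple G) (A : Region G) :
    A.vbs = ⨅ e : A.edges, diagKernel (src A e) (tgt A e) := by
  refine le_antisymm (le_iInf fun e => vbs_le_diagKernel A e) fun ψ hψ => ?_
  rw [Submodule.mem_iInf] at hψ
  obtain ⟨f, hf, hdeg⟩ := exists_factor (src_ne_tgt A) Finset.univ
    (fun e _ e' _ h => hG.region A e e' h) ψ fun e _ => hψ e
  obtain ⟨c, hc, hcol⟩ := toPoly_column A
  -- Every monomial of the cofactor fits into the free legs, so each term of the product is a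
  -- multiple of a column.
  have hm (m : A.verts →₀ ℕ) (h : m ∈ f.support) : ∃ β : A.freeLegs → Fin 2,
      toPoly (column A β) = C c * (edgePoly A * monomial m 1) := by
    obtain ⟨β, hβ⟩ := exists_legs A m fun v => by
      have := hdeg m h v
      have := card_edges_at A v
      omega
    exact ⟨β, by rw [hcol, hβ]⟩
  choose! b hb using hm
  have : ψ = ∑ m ∈ f.support, (coeff m f / c) • column A (b m) := by
    apply toPoly_injective
    rw [hf, map_sum]
    conv_lhs => rw [f.as_sum, Finset.mul_sum]
    refine Finset.sum_congr rfl fun m hm => ?_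
    rw [map_smul, hb m hm, smul_eq_C_mul, ← mul_assoc, ← C_mul, div_mul_cancel₀ _ hc, edgePoly,
      mul_left_comm, C_mul_monomial, mul_one]
  rw [this]
  exact Submodule.sum_mem _ fun m _ => Submodule.smul_mem _ _ (column_mem_vbs A _)

/-- The AKLT construction is injective if every vertex has at most one free leg. -/
theorem finrank_vbs (A : Region G) (h : Injective (legVert A)) :
    Module.finrank ℂ A.vbs = 2 ^ A.freeLegs.card := by
  rw [Region.vbs, LinearMap.finrank_range_of_inj]
  · simp
  rw [← LinearMap.ker_eq_bot, LinearMap.ker_eq_bot']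
  intro x hx
  obtain ⟨c, hc, hcol⟩ := toPoly_column A
  have h1 := congrArg toPoly hx
  rw [toEuclideanLin_tensor, map_sum, map_zero] at h1
  let m : (A.freeLegs → Fin 2) → A.verts →₀ ℕ := fun β =>
    ∑ l, Finsupp.single (legVert A l) (β l : ℕ)
  have hm (β : A.freeLegs → Fin 2) :
      ∏ l, (X (legVert A l) : MvPolynomial A.verts ℂ) ^ (β l : ℕ) = monomial (m β) 1 := by
    simp only [m, X_pow_eq_monomial, monomial_sum_one]
  -- With at most one leg per vertex the exponents determine the leg states, so different columns
  -- have different monomials after cancellation of `edgePoly`.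
  have hmi : Injective m := by
    intro β γ hβγ
    funext l
    have := DFunLike.congr_fun hβγ (legVert A l)
    simp only [m, Finsupp.finsetSum_apply, Finsupp.single_apply, h.eq_iff, Finset.sum_ite_eq',
      Finset.mem_univ, if_true] at this
    exact Fin.ext this
  have h2 : C c * (edgePoly A * ∑ β, monomial (m β) (x β)) = 0 := by
    rw [← h1, Finset.mul_sum, Finset.mul_sum]
    refine Finset.sum_congr rfl fun β _ => ?_
    rw [map_smul, hcol, hm, smul_eq_C_mul, mul_left_comm (C (x β)), mul_left_comm (C (x β)),
      C_mul_monomial, mul_one]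
  rw [mul_eq_zero, mul_eq_zero, or_iff_right fun h => hc (C_eq_zero.1 h),
    or_iff_right (edgePoly_ne_zero A)] at h2
  ext β
  have := congrArg (coeff (m β)) h2
  simpa [coeff_sum, coeff_monomial, hmi.eq_iff] using this

end Tensor

end AKLT

namespace AKLT

open Function Matrix

/-! ### Operators acting on part of the sites. -/

section LocalOperators

variable {κ μ ι : Type} [Fintype κ] [Fintype μ] [Fintype ι] [DecidableEq κ] [DecidableEq μ]
  [DecidableEq ι]

open Classical in
/-- The operator `M` of the sites `κ`, acting on more sites `ι` as `M ⊗ 1`. -/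
noncomputable def locOp (j : κ → ι) (M : Matrix (κ → Fin 4) (κ → Fin 4) ℂ) :
    Matrix (ι → Fin 4) (ι → Fin 4) ℂ :=
  Matrix.of fun σ τ => if ∀ i, i ∉ Set.range j → σ i = τ i then M (σ ∘ j) (τ ∘ j) else 0

theorem extend_comp_self {j : κ → ι} (hj : Injective j) (ρ : κ → Fin 4) (σ : ι → Fin 4) :
    extend j ρ σ ∘ j = ρ := funext fun k => hj.extend_apply _ _ k

theorem extend_of_notMem {j : κ → ι} (ρ : κ → Fin 4) (σ : ι → Fin 4) {i : ι}
    (hi : i ∉ Set.range j) : extend j ρ σ i = σ i := extend_apply' _ _ _ hi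

theorem extend_eq_iff {j : κ → ι} (hj : Injective j) (ρ : κ → Fin 4) (σ τ : ι → Fin 4) :
    extend j ρ σ = τ ↔ ρ = τ ∘ j ∧ ∀ i, i ∉ Set.range j → σ i = τ i := by
  constructor
  · rintro rfl
    exact ⟨(extend_comp_self hj _ _).symm, fun i hi => (extend_of_notMem _ _ hi).symm⟩
  · rintro ⟨rfl, h⟩
    funext i
    by_cases hi : i ∈ Set.range j
    · obtain ⟨k, rfl⟩ := hi
      rw [hj.extend_apply]; rfl
    · rw [extend_of_notMem _ _ hi, h i hi]

theorem extend_extend {j : κ → ι} (hj : Injective j) (ρ ρ' : κ → Fin 4) (σ : ι → Fin 4) :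
    extend j ρ (extend j ρ' σ) = extend j ρ σ :=
  (extend_eq_iff hj _ _ _).2 ⟨(extend_comp_self hj _ _).symm, fun i hi => by
    rw [extend_of_notMem _ _ hi, extend_of_notMem _ _ hi]⟩

/-- Only configurations that agree with `σ` outside the range of `j` contribute, and these are `σ`
overwritten by some `ρ`. The algebra of `locOp` rests on this reindexing. -/
theorem sum_locOp_mul {j : κ → ι} (hj : Injective j) (M : Matrix (κ → Fin 4) (κ → Fin 4) ℂ)
    (σ : ι → Fin 4) (f : (ι → Fin 4) → ℂ) :
    ∑ τ, locOp j M σ τ * f τ = ∑ ρ, M (σ ∘ j) ρ * f (extend j ρ σ) := by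
  classical
  simp only [locOp, of_apply, ite_mul, zero_mul]
  rw [← Finset.sum_filter]
  refine Finset.sum_nbij' (fun τ => τ ∘ j) (fun ρ => extend j ρ σ) ?_ ?_ ?_ ?_ ?_
  · simp
  · intro ρ _
    exact Finset.mem_filter.2 ⟨Finset.mem_univ _, fun i hi => (extend_of_notMem _ _ hi).symm⟩
  · intro τ hτ
    exact (extend_eq_iff hj _ _ _).2 ⟨rfl, (Finset.mem_filter.1 hτ).2⟩
  · intro ρ _
    exact extend_comp_self hj _ _
  · intro τ hτ
    rw [(extend_eq_iff hj (τ ∘ j) σ τ).2 ⟨rfl, (Finset.mem_filter.1 hτ).2⟩]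

theorem locOp_mul {j : κ → ι} (hj : Injective j) (M N : Matrix (κ → Fin 4) (κ → Fin 4) ℂ) :
    locOp j (M * N) = locOp j M * locOp j N := by
  ext σ τ
  rw [mul_apply, sum_locOp_mul hj]
  simp only [locOp, of_apply, extend_comp_self hj]
  have (ρ : κ → Fin 4) : (∀ i, i ∉ Set.range j → extend j ρ σ i = τ i) ↔
      ∀ i, i ∉ Set.range j → σ i = τ i :=
    forall₂_congr fun i hi => by rw [extend_of_notMem _ _ hi]
  simp only [this]
  split_ifs
  · rfl
  · simp

theorem locOp_one {j : κ → ι} (hj : Injective j) : locOp j 1 = 1 := by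
  ext σ τ
  simp only [locOp, of_apply, one_apply]
  by_cases h : σ = τ
  · subst h; simp
  · rw [if_neg h]
    split_ifs with h1 h2
    · exfalso
      refine h ?_
      rw [← (extend_eq_iff hj (σ ∘ j) σ σ).2 ⟨rfl, fun _ _ => rfl⟩]
      exact (extend_eq_iff hj _ _ _).2 ⟨h2, h1⟩
    · rfl
    · rfl

theorem locOp_add (j : κ → ι) (M N : Matrix (κ → Fin 4) (κ → Fin 4) ℂ) :
    locOp j (M + N) = locOp j M + locOp j N := by
  ext σ τ
  simp only [locOp, of_apply, Matrix.add_apply]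
  split_ifs <;> simp only [add_zero]

theorem locOp_smul (j : κ → ι) (c : ℂ) (M : Matrix (κ → Fin 4) (κ → Fin 4) ℂ) :
    locOp j (c • M) = c • locOp j M := by
  ext σ τ
  simp only [locOp, of_apply, Matrix.smul_apply]
  split_ifs <;> simp only [smul_zero]

/-- `locOp` as a linear map. -/
noncomputable def locOpₗ (j : κ → ι) :
    Matrix (κ → Fin 4) (κ → Fin 4) ℂ →ₗ[ℂ] Matrix (ι → Fin 4) (ι → Fin 4) ℂ where
  toFun := locOp j
  map_add' := locOp_add j
  map_smul' := locOp_smul j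

theorem locOp_sub (j : κ → ι) (M N : Matrix (κ → Fin 4) (κ → Fin 4) ℂ) :
    locOp j (M - N) = locOp j M - locOp j N := map_sub (locOpₗ j) M N

theorem locOp_sum {α : Type*} (j : κ → ι) (s : Finset α)
    (M : α → Matrix (κ → Fin 4) (κ → Fin 4) ℂ) :
    locOp j (∑ a ∈ s, M a) = ∑ a ∈ s, locOp j (M a) := map_sum (locOpₗ j) M s

theorem locOp_conjTranspose (j : κ → ι) (M : Matrix (κ → Fin 4) (κ → Fin 4) ℂ) :
    (locOp j M)ᴴ = locOp j Mᴴ := by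
  ext σ τ
  simp only [locOp, of_apply, conjTranspose_apply, apply_ite star, star_zero]
  simp only [eq_comm]

open scoped MatrixOrder in
-- A factorisation `M = B* B` survives, since `locOp` respects products and adjoints.
theorem locOp_posSemidef {j : κ → ι} (hj : Injective j) {M : Matrix (κ → Fin 4) (κ → Fin 4) ℂ}
    (hM : M.PosSemidef) : (locOp j M).PosSemidef := by
  obtain ⟨B, rfl⟩ := CStarAlgebra.nonneg_iff_eq_star_mul_self.mp hM.nonneg
  rw [locOp_mul hj, star_eq_conjTranspose, ← locOp_conjTranspose]
  exact Matrix.posSemidef_conjTranspose_mul_self _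

theorem locOp_locOp {j : κ → ι} (hj : Injective j) (i : μ → κ)
    (M : Matrix (μ → Fin 4) (μ → Fin 4) ℂ) : locOp j (locOp i M) = locOp (j ∘ i) M := by
  ext σ τ
  simp only [locOp, of_apply, ← ite_and, comp_assoc]
  refine if_congr ?_ rfl rfl
  constructor
  · rintro ⟨h, h'⟩ k hk
    by_cases hk' : k ∈ Set.range j
    · obtain ⟨l, rfl⟩ := hk'
      exact h' l fun ⟨m, hm⟩ => hk ⟨m, congrArg j hm⟩
    · exact h k hk'
  · intro h
    refine ⟨fun k hk => h k fun ⟨m, hm⟩ => hk ⟨i m, hm⟩, fun l hl => h _ fun ⟨m, hm⟩ => hl ⟨m, hj hm⟩⟩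

/-- The operators change disjoint sets of sites, so a single intermediate configuration contributes.
The formula is symmetric in the two operators, which is why they commute. -/
theorem locOp_mul_apply_of_disjoint {j : κ → ι} {j' : μ → ι} (hj : Injective j)
    (hd : ∀ k l, j k ≠ j' l) (M : Matrix (κ → Fin 4) (κ → Fin 4) ℂ)
    (N : Matrix (μ → Fin 4) (μ → Fin 4) ℂ) (σ τ : ι → Fin 4) [Decidable
      (∀ i, i ∉ Set.range j → i ∉ Set.range j' → σ i = τ i)] :
    (locOp j M * locOp j' N) σ τ = if ∀ i, i ∉ Set.range j → i ∉ Set.range j' → σ i = τ i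
      then M (σ ∘ j) (τ ∘ j) * N (σ ∘ j') (τ ∘ j') else 0 := by
  rw [mul_apply, sum_locOp_mul hj]
  have h1 (ρ : κ → Fin 4) : extend j ρ σ ∘ j' = σ ∘ j' :=
    funext fun l => extend_of_notMem _ _ fun ⟨k, hk⟩ => hd k l hk
  simp only [locOp, of_apply, h1]
  split_ifs with h
  · rw [Finset.sum_eq_single (τ ∘ j)]
    · rw [if_pos]
      intro i hi
      by_cases hi' : i ∈ Set.range j
      · obtain ⟨k, rfl⟩ := hi'
        rw [hj.extend_apply]; rfl
      · rw [extend_of_notMem _ _ hi', h i hi' hi]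
    · intro ρ _ hρ
      rw [if_neg, mul_zero]
      intro h2
      refine hρ (funext fun k => ?_)
      rw [← hj.extend_apply ρ σ k, h2 _ fun ⟨l, hl⟩ => hd k l hl.symm]; rfl
    · simp
  · refine Finset.sum_eq_zero fun ρ _ => ?_
    rw [if_neg, mul_zero]
    intro h2
    exact h fun i hi hi' => by rw [← h2 i hi', extend_of_notMem _ _ hi]

theorem locOp_commute {j : κ → ι} {j' : μ → ι} (hj : Injective j) (hj' : Injective j')
    (hd : ∀ k l, j k ≠ j' l) (M : Matrix (κ → Fin 4) (κ → Fin 4) ℂ)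
    (N : Matrix (μ → Fin 4) (μ → Fin 4) ℂ) :
    locOp j M * locOp j' N = locOp j' N * locOp j M := by
  classical
  ext σ τ
  rw [locOp_mul_apply_of_disjoint hj hd, locOp_mul_apply_of_disjoint hj' fun l k => (hd k l).symm]
  refine if_congr (forall_congr' fun i => ?_) (mul_comm _ _) rfl
  tauto

/-- The state of the sites `κ` for a fixed configuration of the other sites. -/
noncomputable def slice (j : κ → ι) (ψ : EuclideanSpace ℂ (ι → Fin 4)) (σ : ι → Fin 4) :
    EuclideanSpace ℂ (κ → Fin 4) := WithLp.toLp 2 fun τ => ψ (extend j τ σ)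

theorem locOp_apply {j : κ → ι} (hj : Injective j) (M : Matrix (κ → Fin 4) (κ → Fin 4) ℂ)
    (ψ : EuclideanSpace ℂ (ι → Fin 4)) (σ : ι → Fin 4) :
    toEuclideanLin (locOp j M) ψ σ = toEuclideanLin M (slice j ψ σ) (σ ∘ j) :=
  sum_locOp_mul hj M σ ψ

/-- `M ⊗ 1` acts on each slice separately, so kernels can be tested with the other sites frozen.
Together with `mem_diagKernel_iff_slice` this carries kernel descriptions from a pair or a region to
more sites. -/
theorem locOp_eq_zero_iff {j : κ → ι} (hj : Injective j) (M : Matrix (κ → Fin 4) (κ → Fin 4) ℂ)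
    (ψ : EuclideanSpace ℂ (ι → Fin 4)) :
    toEuclideanLin (locOp j M) ψ = 0 ↔ ∀ σ, toEuclideanLin M (slice j ψ σ) = 0 := by
  constructor
  · intro h σ
    ext ρ
    have h1 := locOp_apply hj M ψ (extend j ρ σ)
    have h2 : slice j ψ (extend j ρ σ) = slice j ψ σ := by
      ext τ
      simp only [slice, extend_extend hj]
    rw [h, h2, extend_comp_self hj] at h1
    exact h1.symm
  · intro h
    ext σ
    rw [locOp_apply hj, h]; rfl

theorem mem_diagKernel_iff_slice {j : κ → ι} (hj : Injective j) {u v : κ}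
    (ψ : EuclideanSpace ℂ (ι → Fin 4)) :
    ψ ∈ diagKernel (j u) (j v) ↔ ∀ σ, slice j ψ σ ∈ diagKernel u v := by
  have key (σ : ι → Fin 4) (τ : κ → Fin 4) (M : ℕ) :
      diagSum u v (slice j ψ σ) τ M = diagSum (j u) (j v) ψ (extend j τ σ) M := by
    unfold diagSum
    refine Finset.sum_congr rfl fun p _ => ?_
    congr 1
    refine congrArg ψ ?_
    refine (extend_eq_iff hj _ _ _).2 ⟨funext fun k => ?_, fun i hi => ?_⟩
    · simp only [Function.comp_apply, update_apply, hj.eq_iff, hj.extend_apply]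
    · rw [update_of_ne fun h => hi ⟨v, h.symm⟩, update_of_ne fun h => hi ⟨u, h.symm⟩,
        extend_of_notMem _ _ hi]
  constructor
  · intro h σ τ M
    rw [key]
    exact h _ _
  · intro h σ M
    have := h σ (σ ∘ j) M
    rwa [key, (extend_eq_iff hj (σ ∘ j) σ σ).2 ⟨rfl, fun _ _ => rfl⟩] at this

end LocalOperators

/-! ### Matrices of orthogonal projections. -/

section Projections

variable {ι : Type} [Fintype ι] [DecidableEq ι]

theorem toEuclideanLin_orthProj (K : Submodule ℂ (EuclideanSpace ℂ ι)) (x : EuclideanSpace ℂ ι) :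
    toEuclideanLin (orthProj K) x = K.starProjection x := by
  have : toEuclideanCLM (n := ι) (𝕜 := ℂ) (orthProj K) = K.starProjection :=
    StarAlgEquiv.apply_symm_apply _ _
  rw [← this]; rfl

theorem toEuclideanLin_mul (A B : Matrix ι ι ℂ) (x : EuclideanSpace ℂ ι) :
    toEuclideanLin (A * B) x = toEuclideanLin A (toEuclideanLin B x) := by
  ext i
  simp [Matrix.toLpLin_apply]

theorem toEuclideanLin_one (x : EuclideanSpace ℂ ι) :
    toEuclideanLin (1 : Matrix ι ι ℂ) x = x := by
  ext i
  simp

theorem matrix_ext_lin {A B : Matrix ι ι ℂ}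
    (h : ∀ x, toEuclideanLin A x = toEuclideanLin B x) : A = B :=
  toEuclideanLin.injective (LinearMap.ext h)

theorem orthProj_mul_self (K : Submodule ℂ (EuclideanSpace ℂ ι)) :
    orthProj K * orthProj K = orthProj K := by
  refine matrix_ext_lin fun x => ?_
  rw [toEuclideanLin_mul, toEuclideanLin_orthProj, toEuclideanLin_orthProj]
  exact Submodule.starProjection_eq_self_iff.2 (Submodule.starProjection_apply_mem _ _)

theorem orthProj_isHermitian (K : Submodule ℂ (EuclideanSpace ℂ ι)) :
    (orthProj K).IsHermitian := by
  rw [← Matrix.isSymmetric_toEuclideanLin_iff]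
  intro x y
  rw [toEuclideanLin_orthProj, toEuclideanLin_orthProj]
  exact Submodule.inner_starProjection_left_eq_right K x y

theorem orthProj_eq_self_iff (K : Submodule ℂ (EuclideanSpace ℂ ι)) (x : EuclideanSpace ℂ ι) :
    toEuclideanLin (orthProj K) x = x ↔ x ∈ K := by
  rw [toEuclideanLin_orthProj, Submodule.starProjection_eq_self_iff]

theorem orthProj_eq_zero_iff (K : Submodule ℂ (EuclideanSpace ℂ ι)) (x : EuclideanSpace ℂ ι) :
    toEuclideanLin (orthProj K) x = 0 ↔ x ∈ Kᗮ := by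
  rw [toEuclideanLin_orthProj, Submodule.starProjection_apply_eq_zero_iff]

end Projections

end AKLT

namespace AKLT

open Function Matrix

/-! ### The total spin of two spins 3/2. -/

section MaxSpin

theorem star_spinRaise (a b : Fin 4) : star (spinRaise a b) = spinRaise a b := by
  fin_cases a <;> fin_cases b <;> simp [spinRaise]

theorem sqrt_three_mul_self : ((√3 : ℝ) : ℂ) * ((√3 : ℝ) : ℂ) = 3 := by
  rw [← Complex.ofReal_mul, Real.mul_self_sqrt (by norm_num)]; norm_num

/-- The constant is `s (s + 1)` for `s = 3/2`. -/
theorem spin_sq : ∑ a : Fin 3, spin a * spin a = (15 / 4 : ℂ) • 1 := by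
  have h3 := sqrt_three_mul_self
  have hI := Complex.I_mul_I
  have e : ∑ a : Fin 3, spin a * spin a = (1 / 2 : ℂ) • (spinRaise * spinRaiseᴴ) +
      (1 / 2 : ℂ) • (spinRaiseᴴ * spinRaise) + spin 2 * spin 2 := by
    rw [Fin.sum_univ_three]
    simp only [spin, cons_val_zero, cons_val_one, smul_mul_smul_comm, add_mul, mul_add, sub_mul,
      mul_sub]
    have : -Complex.I / 2 * (-Complex.I / 2) = -(1 / 4) := by
      linear_combination (1 / 4 : ℂ) * hI
    rw [this]
    module
  rw [e]
  ext i j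
  simp only [Matrix.add_apply, Matrix.smul_apply, Matrix.mul_apply, conjTranspose_apply,
    star_spinRaise, Fin.sum_univ_four]
  fin_cases i <;> fin_cases j <;> simp [spin, spinRaise] <;> linear_combination (1 / 2 : ℂ) * h3

/-- Expands `S₁² + S₂² + 2 S₁·S₂`, with `15/2` from the two single-spin squares and the transverse
part of `S₁·S₂` written in ladder operators. All matrices are then real. -/
theorem totalSpinSq_eq : totalSpinSq = (15 / 2 : ℂ) • 1 + (2 : ℂ) • (spin 2 ⊗ₖ spin 2) +
    spinRaise ⊗ₖ spinRaiseᴴ + spinRaiseᴴ ⊗ₖ spinRaise := by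
  have h1 (a : Fin 3) : (spin a ⊗ₖ 1 + 1 ⊗ₖ spin a) ^ 2 = (spin a * spin a) ⊗ₖ 1 +
      1 ⊗ₖ (spin a * spin a) + (2 : ℂ) • (spin a ⊗ₖ spin a) := by
    rw [pow_two, add_mul, mul_add, mul_add, ← mul_kronecker_mul, ← mul_kronecker_mul,
      ← mul_kronecker_mul, ← mul_kronecker_mul]
    simp only [mul_one, one_mul, two_smul]
    abel
  have h2 : ∑ a, (spin a * spin a) ⊗ₖ (1 : Matrix (Fin 4) (Fin 4) ℂ) = (15 / 4 : ℂ) • 1 := by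
    rw [show ∑ a, (spin a * spin a) ⊗ₖ (1 : Matrix (Fin 4) (Fin 4) ℂ) =
      (∑ a, (spin a * spin a)) ⊗ₖ 1 by
        simp only [Fin.sum_univ_three, add_kronecker], spin_sq, smul_kronecker, one_kronecker_one]
  have h3 : ∑ a, (1 : Matrix (Fin 4) (Fin 4) ℂ) ⊗ₖ (spin a * spin a) = (15 / 4 : ℂ) • 1 := by
    rw [show ∑ a, (1 : Matrix (Fin 4) (Fin 4) ℂ) ⊗ₖ (spin a * spin a) =
      1 ⊗ₖ (∑ a, (spin a * spin a)) by
        simp only [Fin.sum_univ_three, kronecker_add], spin_sq, kronecker_smul, one_kronecker_one]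
  have h4 : ∑ a, (2 : ℂ) • (spin a ⊗ₖ spin a) = (2 : ℂ) • (spin 2 ⊗ₖ spin 2) +
      spinRaise ⊗ₖ spinRaiseᴴ + spinRaiseᴴ ⊗ₖ spinRaise := by
    rw [Fin.sum_univ_three]
    have h0 : spin 0 = (1 / 2 : ℂ) • (spinRaise + spinRaiseᴴ) := rfl
    have h1 : spin 1 = (-Complex.I / 2) • (spinRaise - spinRaiseᴴ) := rfl
    ext ⟨i, j⟩ ⟨k, l⟩
    simp only [h0, h1, Matrix.add_apply, Matrix.smul_apply, kroneckerMap_apply, smul_eq_mul,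
      Matrix.sub_apply]
    linear_combination (1 / 2 * ((spinRaise i k - spinRaiseᴴ i k) *
      (spinRaise j l - spinRaiseᴴ j l))) * Complex.I_mul_I
  rw [totalSpinSq]
  simp only [h1, Finset.sum_add_distrib, h2, h3, h4]
  module

theorem totalSpinSq_apply (φ : EuclideanSpace ℂ (Fin 4 × Fin 4)) (i j : Fin 4) :
    toEuclideanLin totalSpinSq φ (i, j) =
      (15 / 2 + 2 * (3 / 2 - ((i : ℕ) : ℂ)) * (3 / 2 - ((j : ℕ) : ℂ))) * φ (i, j) +
      ∑ k, ∑ l, (spinRaise i k * spinRaise l j + spinRaise k i * spinRaise j l) * φ (k, l) := by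
  have h (k l : Fin 4) : totalSpinSq (i, j) (k, l) = (if i = k then if j = l then
      (15 / 2 + 2 * (3 / 2 - ((i : ℕ) : ℂ)) * (3 / 2 - ((j : ℕ) : ℂ))) else 0 else 0) +
      (spinRaise i k * spinRaise l j + spinRaise k i * spinRaise j l) := by
    rw [totalSpinSq_eq]
    simp only [Matrix.add_apply, Matrix.smul_apply, kroneckerMap_apply, conjTranspose_apply,
      star_spinRaise, smul_eq_mul, one_apply, Prod.mk.injEq, spin, cons_val, diagonal_apply]
    split_ifs <;> simp_all
    ring
  have h' : toEuclideanLin totalSpinSq φ (i, j) =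
      ∑ p, totalSpinSq (i, j) p * φ p := rfl
  rw [h', Fintype.sum_prod_type]
  simp only [h, add_mul, Finset.sum_add_distrib, ite_mul, zero_mul]
  simp

/-- The states of total spin 3. -/
theorem totalSpinSq_eigenvector_iff (φ : EuclideanSpace ℂ (Fin 4 × Fin 4)) :
    toEuclideanLin totalSpinSq φ = (12 : ℂ) • φ ↔
      ∃ c : ℕ → ℂ, ∀ i j : Fin 4, φ (i, j) = c (i + j) * (weight i * weight j) := by
  have hs := sqrt_three_mul_self
  have w0 : weight 0 = 1 := by simp [weight]
  have w1 : weight 1 = ((√3 : ℝ) : ℂ) := by simp [weight]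
  have w2 : weight 2 = ((√3 : ℝ) : ℂ) := by simp [weight]
  have w3 : weight 3 = 1 := by simp [weight]
  have key : toEuclideanLin totalSpinSq φ = (12 : ℂ) • φ ↔
      ∀ i j, toEuclideanLin totalSpinSq φ (i, j) = 12 * φ (i, j) := by
    constructor
    · intro h i j
      rw [h]; rfl
    · intro h
      ext ⟨i, j⟩
      exact h i j
  rw [key]
  constructor
  · intro h
    simp only [totalSpinSq_apply, Fin.forall_fin_succ, Fin.sum_univ_four] at h
    simp [spinRaise] at h
    generalize ((√3 : ℝ) : ℂ) = s at *
    -- Entries with the same total `i + j` form separate linear systems; the equations kept here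
    -- suffice to express every entry by one of its system.
    obtain ⟨⟨-, e01, e02, e03⟩, ⟨-, -, e12, e13⟩, ⟨e20, -, -, e23⟩, e30, e31, -, -⟩ := h
    have a10 : φ (1, 0) = φ (0, 1) := by linear_combination (1 / 3) * e01 - (1 / 3) * φ (1, 0) * hs
    have a11 : φ (1, 1) = s * φ (0, 2) := by
      linear_combination (s / 6) * e02 - (1 / 3) * φ (1, 1) * hs
    have a20 : φ (2, 0) = φ (0, 2) := by linear_combination (1 / 6) * (e02 - e20)
    have a12 : φ (1, 2) = 3 * φ (0, 3) := by
      linear_combination (1 / 3) * e03 - (1 / 3) * φ (1, 2) * hs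
    have a21 : φ (2, 1) = 3 * φ (0, 3) := by
      linear_combination (1 / 4) * e12 - (1 / 4) * φ (0, 3) * hs + (5 / 4) * a12
    have a30 : φ (3, 0) = φ (0, 3) := by
      linear_combination (-1 / 9) * e30 + (1 / 9) * φ (2, 1) * hs + (1 / 3) * a21
    have a22 : φ (2, 2) = s * φ (1, 3) := by
      linear_combination (s / 6) * e13 - (1 / 3) * φ (2, 2) * hs
    have a31 : φ (3, 1) = φ (1, 3) := by linear_combination (1 / 6) * (e13 - e31)
    have a32 : φ (3, 2) = φ (2, 3) := by linear_combination (1 / 3) * e23 - (1 / 3) * φ (3, 2) * hs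
    -- `c M` is an entry of total `M` divided by its weights, with `1/√3` written as `√3/3`. Totals
    -- do not exceed 6, so reduction modulo 7 is harmless.
    refine ⟨fun M => ![φ (0, 0), φ (0, 1) * s / 3, φ (0, 2) * s / 3, φ (0, 3), φ (1, 3) * s / 3,
      φ (2, 3) * s / 3, φ (3, 3)] (Fin.ofNat 7 M), ?_⟩
    simp only [Fin.forall_fin_succ]
    simp [w0, w1, w2, w3, a10, a11, a20, a12, a21, a30, a22, a31, a32, Fin.ofNat]
    refine ⟨⟨?_, ?_⟩, ⟨?_, ?_, ?_, ?_⟩, ⟨?_, ?_, ?_, ?_⟩, ?_, ?_⟩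
    all_goals
      simp only [div_mul_eq_mul_div, mul_assoc, hs]
      ring
  · rintro ⟨c, hc⟩
    simp only [totalSpinSq_apply, Fin.forall_fin_succ, Fin.sum_univ_four]
    simp [spinRaise, hc, w0, w1, w2, w3]
    generalize ((√3 : ℝ) : ℂ) = s at *
    have hs3 : s ^ 3 = 3 * s := by rw [pow_succ, pow_two, hs]
    have hs4 : s ^ 4 = 9 := by rw [pow_succ, hs3]; linear_combination 3 * hs
    refine ⟨⟨?_, ?_, ?_, ?_⟩, ⟨?_, ?_, ?_, ?_⟩, ⟨?_, ?_, ?_, ?_⟩, ?_, ?_, ?_, ?_⟩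
    all_goals ring_nf
    all_goals try simp only [hs3, hs4]
    all_goals try ring_nf
    all_goals try simp

theorem star_weight (k : Fin 4) : star (weight k) = weight k := Complex.conj_ofReal _

/-- A state is orthogonal to the states of total spin 3 if and only if the polynomial
`p(x, y)` of the state satisfies `p(x, x) = 0`. -/
theorem maxSpinProj_eq_zero_iff (φ : EuclideanSpace ℂ (Fin 4 × Fin 4)) :
    toEuclideanLin maxSpinProj φ = 0 ↔ ∀ M : ℕ,
      ∑ p : Fin 4 × Fin 4 with (p.1 : ℕ) + p.2 = M, weight p.1 * weight p.2 * φ p = 0 := by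
  have inner_eq (x : EuclideanSpace ℂ (Fin 4 × Fin 4)) (c : ℕ → ℂ)
      (hc : ∀ i j : Fin 4, x (i, j) = c (i + j) * (weight i * weight j)) :
      inner ℂ x φ = ∑ p, star (c (p.1 + p.2)) * (weight p.1 * weight p.2 * φ p) := by
    rw [PiLp.inner_apply]
    refine Finset.sum_congr rfl fun p _ => ?_
    rw [← Prod.mk.eta (p := p), hc]
    simp only [RCLike.inner_apply, ← starRingEnd_apply, map_mul]
    simp only [starRingEnd_apply, star_weight]
    ring
  rw [maxSpinProj, orthProj_eq_zero_iff, Submodule.mem_orthogonal]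
  simp only [Module.End.mem_eigenspace_iff]
  constructor
  · intro h M
    -- The state of total spin 3 supported on `i + j = M`. Its inner product with `φ` is the
    -- coefficient of `x^M` in `p(x, x)`.
    let x : EuclideanSpace ℂ (Fin 4 × Fin 4) := WithLp.toLp 2 fun p =>
      (if (p.1 : ℕ) + p.2 = M then 1 else 0) * (weight p.1 * weight p.2)
    have hx (i j : Fin 4) : x (i, j) =
        (fun n => if n = M then (1 : ℂ) else 0) (i + j) * (weight i * weight j) := rfl
    have := h x ((totalSpinSq_eigenvector_iff x).2 ⟨fun n => if n = M then 1 else 0, hx⟩)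
    rw [inner_eq x (fun n => if n = M then 1 else 0) hx] at this
    rw [← this, Finset.sum_filter]
    refine Finset.sum_congr rfl fun p _ => ?_
    split_ifs <;> simp
  · intro h x hx
    obtain ⟨c, hc⟩ := (totalSpinSq_eigenvector_iff x).1 hx
    rw [inner_eq x c hc]
    have hmaps : ∀ p ∈ (Finset.univ : Finset (Fin 4 × Fin 4)),
        (p.1 : ℕ) + p.2 ∈ Finset.range 7 := fun p _ => Finset.mem_range.2 (by omega)
    rw [← Finset.sum_fiberwise_of_maps_to hmaps]
    refine Finset.sum_eq_zero fun M _ => ?_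
    rw [Finset.sum_congr rfl (g := fun p => star (c M) * (weight p.1 * weight p.2 * φ p))
      fun p hp => by rw [(Finset.mem_filter.1 hp).2], ← Finset.mul_sum, h, mul_zero]

/-- The operator that projects two sites onto total spin 3, on functions of two sites. -/
noncomputable def pairProj : Matrix (Fin 2 → Fin 4) (Fin 2 → Fin 4) ℂ :=
  maxSpinProj.submatrix (fun τ => (τ 0, τ 1)) (fun τ => (τ 0, τ 1))

/-- The projection of the sites `u`, `v` onto total spin 3. -/
noncomputable def pairTerm {ι : Type} [Fintype ι] [DecidableEq ι] (u v : ι) :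
    Matrix (ι → Fin 4) (ι → Fin 4) ℂ := locOp ![u, v] pairProj

theorem pairProj_mul_self : pairProj * pairProj = pairProj := by
  have h : maxSpinProj.submatrix (finTwoArrowEquiv (Fin 4)) (finTwoArrowEquiv (Fin 4)) *
      maxSpinProj.submatrix (finTwoArrowEquiv (Fin 4)) (finTwoArrowEquiv (Fin 4)) =
      maxSpinProj.submatrix (finTwoArrowEquiv (Fin 4)) (finTwoArrowEquiv (Fin 4)) := by
    rw [submatrix_mul_equiv, maxSpinProj, orthProj_mul_self]
  exact h

theorem pairProj_isHermitian : pairProj.IsHermitian :=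
  (orthProj_isHermitian _).submatrix _

theorem pairProj_eq_zero_iff (φ : EuclideanSpace ℂ (Fin 2 → Fin 4)) :
    toEuclideanLin pairProj φ = 0 ↔ φ ∈ diagKernel 0 1 := by
  let φ' : EuclideanSpace ℂ (Fin 4 × Fin 4) := WithLp.toLp 2 fun p => φ ![p.1, p.2]
  have h1 (τ : Fin 2 → Fin 4) :
      toEuclideanLin pairProj φ τ = toEuclideanLin maxSpinProj φ' (τ 0, τ 1) := by
    change ∑ ρ, pairProj τ ρ * φ ρ = ∑ p, maxSpinProj (τ 0, τ 1) p * φ' p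
    refine Fintype.sum_equiv (finTwoArrowEquiv (Fin 4)) _ _ fun ρ => ?_
    change _ * φ ρ = _ * φ ![ρ 0, ρ 1]
    rw [show ![ρ 0, ρ 1] = ρ by ext i; fin_cases i <;> rfl]
    rfl
  have h2 : toEuclideanLin pairProj φ = 0 ↔ toEuclideanLin maxSpinProj φ' = 0 := by
    constructor
    · intro h
      ext ⟨i, j⟩
      have := h1 ![i, j]
      rw [h] at this
      exact this.symm
    · intro h
      ext τ
      rw [h1, h]; rfl
  rw [h2, maxSpinProj_eq_zero_iff, mem_diagKernel]
  have h3 (σ : Fin 2 → Fin 4) (p : Fin 4 × Fin 4) :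
      update (update σ 0 p.1) 1 p.2 = ![p.1, p.2] := by
    ext i; fin_cases i <;> rfl
  simp only [diagSum, h3]
  exact ⟨fun h _ M => h M, fun h M => h 0 M⟩

section PairTerm

variable {ι : Type} [Fintype ι] [DecidableEq ι] {u v : ι}

theorem vecPair_injective (h : u ≠ v) : Injective ![u, v] := by
  intro i j hij
  fin_cases i <;> fin_cases j <;> simp_all [eq_comm]

theorem pairTerm_mul_self (h : u ≠ v) : pairTerm u v * pairTerm u v = pairTerm u v := by
  rw [pairTerm, ← locOp_mul (vecPair_injective h), pairProj_mul_self]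

theorem pairTerm_isHermitian (u v : ι) : (pairTerm u v).IsHermitian := by
  rw [Matrix.IsHermitian, pairTerm, locOp_conjTranspose, pairProj_isHermitian]

/-- With `mem_diagKernel_iff_dvd` this makes the kernel of an edge term a divisibility condition. -/
theorem pairTerm_eq_zero_iff (h : u ≠ v) (ψ : EuclideanSpace ℂ (ι → Fin 4)) :
    toEuclideanLin (pairTerm u v) ψ = 0 ↔ ψ ∈ diagKernel u v := by
  rw [pairTerm, locOp_eq_zero_iff (vecPair_injective h)]
  simp only [pairProj_eq_zero_iff]
  exact (mem_diagKernel_iff_slice (vecPair_injective h) ψ).symm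

end PairTerm

end MaxSpin

/-! ### Projections and edge terms of regions. -/

section RegionOperators

variable {V E : Type} [DecidableEq V] [DecidableEq E] {G : CubicGraph V E}

/-- The inclusion of the vertices of a region. -/
def incl {A B : Region G} (h : A.verts ⊆ B.verts) (v : A.verts) : B.verts := ⟨v.1, h v.2⟩

theorem incl_injective {A B : Region G} (h : A.verts ⊆ B.verts) : Injective (incl h) :=
  fun _ _ hv => Subtype.ext (congrArg (fun w : B.verts => w.1) hv)

theorem notMem_range_incl {A B : Region G} (h : A.verts ⊆ B.verts) (v : B.verts) :
    v ∉ Set.range (incl h) ↔ v.1 ∉ A.verts := by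
  refine not_congr ⟨?_, fun hv => ⟨⟨v.1, hv⟩, rfl⟩⟩
  rintro ⟨w, rfl⟩
  exact w.2

theorem extend_eq_locOp {A B : Region G} (h : A.verts ⊆ B.verts)
    (M : Matrix A.Config A.Config ℂ) : Region.extend h M = locOp (incl h) M := by
  ext σ τ
  simp only [Region.extend, locOp, of_apply, notMem_range_incl]
  rfl

theorem edgeTerm_eq_pairTerm (A : Region G) (e : A.edges) :
    A.edgeTerm e = pairTerm (src A e) (tgt A e) := by
  ext σ τ
  simp only [Region.edgeTerm, pairTerm, locOp, of_apply]
  refine if_congr (forall_congr' fun w => ?_) rfl rfl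
  simp only [Matrix.range_cons, Matrix.range_empty, Set.union_empty, Set.mem_union,
    Set.mem_singleton_iff, not_or, and_imp]
  rfl

theorem vbsProj_mul_self {A B : Region G} (h : A.verts ⊆ B.verts) :
    Region.vbsProj h * Region.vbsProj h = Region.vbsProj h := by
  rw [Region.vbsProj, extend_eq_locOp, ← locOp_mul (incl_injective h), orthProj_mul_self]

theorem vbsProj_isHermitian {A B : Region G} (h : A.verts ⊆ B.verts) :
    (Region.vbsProj h).IsHermitian := by
  rw [Matrix.IsHermitian, Region.vbsProj, extend_eq_locOp, locOp_conjTranspose,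
    orthProj_isHermitian]

/-- The range of `vbsProj` is cut out by the edges of the smaller region. -/
theorem vbsProj_eq_self_iff (hG : IsSimple G) {A B : Region G} (h : A.verts ⊆ B.verts)
    (ψ : B.Phys) : toEuclideanLin (Region.vbsProj h) ψ = ψ ↔
      ∀ e : A.edges, ψ ∈ diagKernel (incl h (src A e)) (incl h (tgt A e)) := by
  have h1 : toEuclideanLin (Region.vbsProj h) ψ = ψ ↔
      toEuclideanLin (locOp (incl h) (1 - orthProj A.vbs)) ψ = 0 := by
    rw [locOp_sub, locOp_one (incl_injective h), Region.vbsProj, extend_eq_locOp, map_sub,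
      LinearMap.sub_apply, toEuclideanLin_one, sub_eq_zero, eq_comm]
  have h2 (φ : A.Phys) : toEuclideanLin (1 - orthProj A.vbs) φ = 0 ↔
      ∀ e : A.edges, φ ∈ diagKernel (src A e) (tgt A e) := by
    rw [map_sub, LinearMap.sub_apply, toEuclideanLin_one, sub_eq_zero, eq_comm,
      orthProj_eq_self_iff, vbs_eq_iInf hG, Submodule.mem_iInf]
  rw [h1, locOp_eq_zero_iff (incl_injective h)]
  simp only [h2,
    mem_diagKernel_iff_slice (incl_injective h)]
  exact forall_comm

end RegionOperators

end AKLT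

namespace AKLT

open Matrix

/-! ### Quadratic forms and spectra of Hermitian matrices. -/

section PosSemidef

variable {n : Type} [Fintype n] [DecidableEq n]

theorem posSemidef_iff_inner {A : Matrix n n ℂ} : A.PosSemidef ↔
    A.IsHermitian ∧ ∀ x, 0 ≤ RCLike.re (inner ℂ (toEuclideanLin A x) x) := by
  rw [← Matrix.isPositive_toEuclideanLin_iff, LinearMap.IsPositive,
    Matrix.isSymmetric_toEuclideanLin_iff]

theorem inner_toEuclideanLin {A : Matrix n n ℂ} (hA : A.IsHermitian) (x y : EuclideanSpace ℂ n) :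
    inner ℂ (toEuclideanLin A x) y = inner ℂ x (toEuclideanLin A y) :=
  Matrix.isSymmetric_toEuclideanLin_iff.2 hA x y

/-- An eigenvector of the spectral decomposition. -/
theorem exists_eigenvectorBasis {A : Matrix n n ℂ} (hA : A.IsHermitian) :
    ∃ (b : OrthonormalBasis n ℂ (EuclideanSpace ℂ n)) (l : n → ℝ),
      (∀ i, toEuclideanLin A (b i) = (l i : ℂ) • b i) ∧ ∀ i, l i ∈ spectrum ℝ A := by
  refine ⟨hA.eigenvectorBasis, hA.eigenvalues, fun i => ?_, fun i => ?_⟩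
  · have := hA.mulVec_eigenvectorBasis i
    ext k
    have h := congrFun this k
    rw [Matrix.toLpLin_apply]
    simpa using h
  · rw [hA.spectrum_real_eq_range_eigenvalues]
    exact ⟨i, rfl⟩

theorem mem_spectrum_iff {A : Matrix n n ℂ} {l : ℝ} :
    l ∈ spectrum ℝ A ↔ ∃ x : EuclideanSpace ℂ n, x ≠ 0 ∧ toEuclideanLin A x = (l : ℂ) • x := by
  have h1 : l ∈ spectrum ℝ A ↔ (l : ℂ) ∈ spectrum ℂ A := by
    rw [spectrum.mem_iff, spectrum.mem_iff]; rfl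
  rw [h1, ← Matrix.spectrum_toLpLin, ← Module.End.hasEigenvalue_iff_mem_spectrum]
  constructor
  · intro h
    obtain ⟨x, hx⟩ := h.exists_hasEigenvector
    exact ⟨x, hx.2, hx.apply_eq_smul⟩
  · rintro ⟨x, hx, h⟩
    exact Module.End.hasEigenvalue_of_hasEigenvector ⟨Module.End.mem_eigenspace_iff.2 h, hx⟩

theorem norm_sq_eq_sum (b : OrthonormalBasis n ℂ (EuclideanSpace ℂ n)) (x : EuclideanSpace ℂ n) :
    ‖x‖ ^ 2 = ∑ i, ‖inner ℂ (b i) x‖ ^ 2 := (b.sum_sq_norm_inner_right x).symm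

/-- The quadratic form of an operator that is diagonal in an orthonormal basis. -/
theorem re_inner_eq_sum {A : Matrix n n ℂ} (hA : A.IsHermitian)
    (b : OrthonormalBasis n ℂ (EuclideanSpace ℂ n)) (l : n → ℝ)
    (hb : ∀ i, toEuclideanLin A (b i) = (l i : ℂ) • b i) (x : EuclideanSpace ℂ n) :
    RCLike.re (inner ℂ (toEuclideanLin A x) x) = ∑ i, l i * ‖inner ℂ (b i) x‖ ^ 2 := by
  rw [← b.sum_inner_mul_inner, map_sum]
  refine Finset.sum_congr rfl fun i _ => ?_
  rw [inner_toEuclideanLin hA, hb, inner_smul_right, mul_assoc, ← inner_conj_symm,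
    RCLike.conj_mul]
  have : ((l i : ℂ) * ((‖inner ℂ (b i) x‖ : ℝ) : ℂ) ^ 2) = ((l i * ‖inner ℂ (b i) x‖ ^ 2 : ℝ) : ℂ) := by
    push_cast; rfl
  exact (congrArg Complex.re this).trans (Complex.ofReal_re _)

/-- A quadratic inequality for a Hermitian matrix is one for its eigenvalues. -/
theorem posSemidef_sq_sub_smul_iff {A : Matrix n n ℂ} (hA : A.IsHermitian) (c : ℝ) :
    (A * A - (c : ℂ) • A).PosSemidef ↔ ∀ l ∈ spectrum ℝ A, 0 ≤ l * l - c * l := by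
  have hH : (A * A - (c : ℂ) • A).IsHermitian := by
    refine Matrix.IsHermitian.sub ?_ ?_
    · rw [Matrix.IsHermitian, conjTranspose_mul, hA]
    · rw [Matrix.IsHermitian, conjTranspose_smul, hA]; simp
  have happ (x : EuclideanSpace ℂ n) (l : ℝ) (h : toEuclideanLin A x = (l : ℂ) • x) :
      toEuclideanLin (A * A - (c : ℂ) • A) x = ((l * l - c * l : ℝ) : ℂ) • x := by
    rw [map_sub, LinearMap.sub_apply, toEuclideanLin_mul, map_smul, LinearMap.smul_apply, h,
      map_smul, h, smul_smul, smul_smul, ← sub_smul]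
    push_cast; rfl
  rw [posSemidef_iff_inner, and_iff_right hH]
  constructor
  · intro h l hl
    obtain ⟨x, hx, hAx⟩ := mem_spectrum_iff.1 hl
    have h1 := h x
    rw [happ x l hAx, inner_smul_left, inner_self_eq_norm_sq_to_K] at h1
    have e : (starRingEnd ℂ) ((l * l - c * l : ℝ) : ℂ) * ((‖x‖ : ℝ) : ℂ) ^ 2 =
        (((l * l - c * l) * ‖x‖ ^ 2 : ℝ) : ℂ) := by
      rw [Complex.conj_ofReal]; push_cast; rfl
    have h2 : 0 ≤ (l * l - c * l) * ‖x‖ ^ 2 := by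
      refine le_of_le_of_eq h1 ?_
      exact (congrArg Complex.re e).trans (Complex.ofReal_re _)
    exact nonneg_of_mul_nonneg_left h2 (by positivity)
  · intro h x
    obtain ⟨b, l, hb, hl⟩ := exists_eigenvectorBasis hA
    rw [re_inner_eq_sum hH b _ fun i => happ _ _ (hb i)]
    exact Finset.sum_nonneg fun i _ => mul_nonneg (h _ (hl i)) (sq_nonneg _)

/-- A spectral gap bounds the quadratic form on the orthogonal complement of the kernel. -/
theorem mul_norm_sq_le_of_orthogonal_ker {A : Matrix n n ℂ} (hA : A.IsHermitian) {c : ℝ}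
    (hc : ∀ l ∈ spectrum ℝ A, l ≠ 0 → c ≤ l) {x : EuclideanSpace ℂ n}
    (hx : ∀ y, toEuclideanLin A y = 0 → inner ℂ y x = 0) :
    c * ‖x‖ ^ 2 ≤ RCLike.re (inner ℂ (toEuclideanLin A x) x) := by
  obtain ⟨b, l, hb, hl⟩ := exists_eigenvectorBasis hA
  rw [re_inner_eq_sum hA b l hb, norm_sq_eq_sum b, Finset.mul_sum]
  refine Finset.sum_le_sum fun i _ => ?_
  by_cases h0 : l i = 0
  · rw [hx (b i) (by rw [hb, h0, Complex.ofReal_zero, zero_smul])]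
    simp
  · exact mul_le_mul_of_nonneg_right (hc _ (hl i) h0) (sq_nonneg _)

theorem re_inner_self_nonneg_of_proj {P : Matrix n n ℂ} (hP : P.IsHermitian) (h : P * P = P)
    (x : EuclideanSpace ℂ n) :
    RCLike.re (inner ℂ (toEuclideanLin P x) x) = ‖toEuclideanLin P x‖ ^ 2 := by
  rw [← inner_self_eq_norm_sq (𝕜 := ℂ), inner_toEuclideanLin hP, ← inner_toEuclideanLin hP,
    ← inner_toEuclideanLin hP, ← toEuclideanLin_mul, h]

end PosSemidef

/-! ### The Friedrichs angle of two projections. -/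

section TwoProjections

variable {n : Type} [Fintype n] [DecidableEq n]

/-- The vector `x` is orthogonal to the intersection of the ranges of the projections `E`, `F`. -/
def Generic (E F : Matrix n n ℂ) (x : EuclideanSpace ℂ n) : Prop :=
  ∀ z, toEuclideanLin E z = z → toEuclideanLin F z = z → inner ℂ z x = 0

/-- `η` is the cosine of the Friedrichs angle between the ranges of the projections `E`, `F`. -/
structure FriedrichsAngle (E F : Matrix n n ℂ) (η : ℝ) : Prop where
  isHermitian_left : E.IsHermitian
  mul_self_left : E * E = E
  isHermitian_right : F.IsHermitian
  mul_self_right : F * F = F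
  bound : ∀ u w, toEuclideanLin E u = u → toEuclideanLin F w = w → Generic E F u →
    Generic E F w → ‖inner ℂ u w‖ ≤ η * ‖u‖ * ‖w‖
  attained : ∃ u w, toEuclideanLin E u = u ∧ toEuclideanLin F w = w ∧ Generic E F u ∧
    Generic E F w ∧ ‖u‖ = 1 ∧ ‖w‖ = 1 ∧ inner ℂ u w = (η : ℂ)

namespace FriedrichsAngle

variable {E F : Matrix n n ℂ} {η : ℝ}

theorem symm (h : FriedrichsAngle E F η) : FriedrichsAngle F E η where
  isHermitian_left := h.isHermitian_right
  mul_self_left := h.mul_self_right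
  isHermitian_right := h.isHermitian_left
  mul_self_right := h.mul_self_left
  bound u w hu hw hu' hw' := by
    rw [norm_inner_symm, mul_right_comm]
    exact h.bound w u hw hu (fun z h1 h2 => hw' z h2 h1) fun z h1 h2 => hu' z h2 h1
  attained := by
    obtain ⟨u, w, hu, hw, hu', hw', hu1, hw1, huw⟩ := h.attained
    refine ⟨w, u, hw, hu, fun z h1 h2 => hw' z h2 h1, fun z h1 h2 => hu' z h2 h1, hw1, hu1, ?_⟩
    rw [← inner_conj_symm, huw, Complex.conj_ofReal]

theorem generic_apply (h : FriedrichsAngle E F η) {x : EuclideanSpace ℂ n} (hx : Generic E F x) :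
    Generic E F (toEuclideanLin E x) := fun z h1 h2 => by
  rw [← inner_toEuclideanLin h.isHermitian_left, h1, hx z h1 h2]

theorem apply_apply (h : FriedrichsAngle E F η) (x : EuclideanSpace ℂ n) :
    toEuclideanLin E (toEuclideanLin E x) = toEuclideanLin E x := by
  rw [← toEuclideanLin_mul, h.mul_self_left]

/-- The bound for the pair `E w`, `w` gives `‖E w‖ ≤ η`, while `E w` has inner product `η` with the
unit vector `u`: equality in Cauchy-Schwarz. Hence `E` and `F` preserve the span of a maximising
pair. -/
theorem apply_of_attained (h : FriedrichsAngle E F η) {u w : EuclideanSpace ℂ n}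
    (hu : toEuclideanLin E u = u) (hw : toEuclideanLin F w = w)
    (hw' : Generic E F w) (hη : 0 ≤ η) (hu1 : ‖u‖ = 1) (hw1 : ‖w‖ = 1) (huw : inner ℂ u w = (η : ℂ)) :
    toEuclideanLin E w = (η : ℂ) • u := by
  set a := toEuclideanLin E w with ha
  have haE : toEuclideanLin E a = a := h.apply_apply w
  have haw : inner ℂ a w = ((‖a‖ ^ 2 : ℝ) : ℂ) := by
    rw [← haE, inner_toEuclideanLin h.isHermitian_left, ← ha, inner_self_eq_norm_sq_to_K, haE]
    push_cast; rfl
  have h1 : ‖a‖ ^ 2 ≤ η * ‖a‖ := by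
    have := h.bound a w haE hw (h.generic_apply hw') hw'
    rw [haw, hw1, mul_one, Complex.norm_real, Real.norm_of_nonneg (sq_nonneg _)] at this
    exact this
  have hua : inner ℂ u a = (η : ℂ) := by
    rw [ha, ← inner_toEuclideanLin h.isHermitian_left, hu, huw]
  have h2 : ‖a‖ ≤ η := by
    by_cases h0 : ‖a‖ = 0
    · rw [h0]; exact hη
    · have : 0 < ‖a‖ := lt_of_le_of_ne (norm_nonneg _) (Ne.symm h0)
      nlinarith
  have h3 : ‖a - (η : ℂ) • u‖ ^ 2 ≤ 0 := by
    rw [@norm_sub_sq ℂ, inner_smul_right, ← inner_conj_symm, hua, norm_smul, hu1, Complex.conj_ofReal]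
    have : RCLike.re ((η : ℂ) * (η : ℂ)) = η * η := by
      rw [← Complex.ofReal_mul]; exact Complex.ofReal_re _
    rw [this, Complex.norm_real, Real.norm_of_nonneg hη]
    nlinarith [norm_nonneg a]
  have h4 : ‖a - (η : ℂ) • u‖ = 0 := by nlinarith [norm_nonneg (a - (η : ℂ) • u)]
  exact sub_eq_zero.1 (norm_eq_zero.1 h4)

theorem nonneg (h : FriedrichsAngle E F η) : 0 ≤ η := by
  obtain ⟨u, w, hu, hw, hu', hw', hu1, hw1, huw⟩ := h.attained
  have := h.bound u w hu hw hu' hw'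
  rw [huw, hu1, hw1, mul_one, mul_one] at this
  exact (norm_nonneg _).trans this

/-- Both `1 + η` and `1 - η` are eigenvalues of `E + F`. -/
theorem exists_eigenvector (h : FriedrichsAngle E F η) (s : ℝ) (hs : s = 1 ∨ s = -1)
    (hη : η < 1) :
    ∃ x, x ≠ 0 ∧ toEuclideanLin (E + F) x = ((1 + s * η : ℝ) : ℂ) • x := by
  obtain ⟨u, w, hu, hw, hu', hw', hu1, hw1, huw⟩ := h.attained
  have h1 := h.apply_of_attained hu hw hw' h.nonneg hu1 hw1 huw
  have h2 := h.symm.apply_of_attained hw hu (fun z h1 h2 => hu' z h2 h1) h.nonneg hw1 hu1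
    (by rw [← inner_conj_symm, huw, Complex.conj_ofReal])
  have hss : (s : ℂ) * s = 1 := by rcases hs with rfl | rfl <;> norm_num
  -- From `E w = η u` and `F u = η w`, the vectors `u ± w` are eigenvectors of `E + F`.
  refine ⟨u + (s : ℂ) • w, fun h0 => ?_, ?_⟩
  · have h3 : inner ℂ u (u + (s : ℂ) • w) = 0 := by rw [h0, inner_zero_right]
    rw [inner_add_right, inner_smul_right, huw, inner_self_eq_norm_sq_to_K, hu1] at h3
    have h4 : (1 : ℝ) + s * η = 0 := by
      have : (((1 : ℝ) + s * η : ℝ) : ℂ) = 0 := by rw [← h3]; push_cast; norm_num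
      exact_mod_cast this
    have := h.nonneg
    rcases hs with rfl | rfl <;> linarith
  · rw [map_add toEuclideanLin, LinearMap.add_apply, map_add, map_add, map_smul, map_smul, hu, hw,
      h1, h2]
    have : ((1 + s * η : ℝ) : ℂ) = 1 + s * η := by push_cast; rfl
    rw [this]
    simp only [smul_add, add_smul, one_smul, smul_smul]
    rw [show (1 + (s : ℂ) * η) * s = s + η by linear_combination (η : ℂ) * hss, add_smul]
    abel

/-- The possible eigenvalues of `E + F`. -/
theorem eigenvalue_cases (h : FriedrichsAngle E F η) {l : ℝ} {x : EuclideanSpace ℂ n}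
    (hx : x ≠ 0) (hl : toEuclideanLin (E + F) x = (l : ℂ) • x) :
    l = 0 ∨ l = 1 ∨ l = 2 ∨ |l - 1| ≤ η := by
  by_contra! hcon
  obtain ⟨h0, h1, h2, hη⟩ := hcon
  have hl' : toEuclideanLin E x + toEuclideanLin F x = (l : ℂ) • x := by
    rw [← hl, map_add, LinearMap.add_apply]
  -- A common fixed vector `z` satisfies `l ⟨z, x⟩ = 2 ⟨z, x⟩`, and `l ≠ 2`.
  have hgen : Generic E F x := fun z hz hz' => by
    have h3 : inner ℂ z ((l : ℂ) • x) = inner ℂ z x + inner ℂ z x := by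
      rw [← hl', inner_add_right, ← inner_toEuclideanLin h.isHermitian_left, hz,
        ← inner_toEuclideanLin h.isHermitian_right, hz']
    rw [inner_smul_right] at h3
    have h4 : ((l : ℂ) - 2) * inner ℂ z x = 0 := by linear_combination h3
    refine (mul_eq_zero.1 h4).resolve_left ?_
    exact fun h5 => h2 (by exact_mod_cast sub_eq_zero.1 h5)
  set a := toEuclideanLin E x with ha
  set b := toEuclideanLin F x with hb
  have haE : toEuclideanLin E a = a := h.apply_apply x
  have hbF : toEuclideanLin F b = b := h.symm.apply_apply x
  have hEb : toEuclideanLin E b = ((l : ℂ) - 1) • a := by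
    have := congrArg (toEuclideanLin E) hl'
    rw [map_add, haE, map_smul, ← ha] at this
    rw [sub_smul, one_smul, ← this, add_sub_cancel_left]
  have hFa : toEuclideanLin F a = ((l : ℂ) - 1) • b := by
    have := congrArg (toEuclideanLin F) hl'
    rw [map_add, hbF, map_smul, ← hb] at this
    rw [sub_smul, one_smul, ← this, add_sub_cancel_right]
  have hl1 : (l : ℂ) - 1 = ((l - 1 : ℝ) : ℂ) := by push_cast; rfl
  -- Evaluating `⟨E x, F x⟩` from both sides shows that the two components have equal norms, as `l ≠
  -- 1`. If they were nonzero, the angle bound would give `|l - 1| ≤ η`.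
  have hab : inner ℂ a b = ((l - 1 : ℝ) : ℂ) * ((‖a‖ ^ 2 : ℝ) : ℂ) := by
    conv_lhs => rw [← haE]
    rw [inner_toEuclideanLin h.isHermitian_left, hEb, inner_smul_right,
      inner_self_eq_norm_sq_to_K, hl1]
    push_cast; rfl
  have hab' : inner ℂ a b = ((l - 1 : ℝ) : ℂ) * ((‖b‖ ^ 2 : ℝ) : ℂ) := by
    conv_lhs => rw [← hbF]
    rw [← inner_toEuclideanLin h.isHermitian_right, hFa, inner_smul_left,
      inner_self_eq_norm_sq_to_K, hl1, Complex.conj_ofReal]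
    push_cast; rfl
  have hl0 : l - 1 ≠ 0 := sub_ne_zero.2 h1
  have hnorm : ‖a‖ = ‖b‖ := by
    have : (l - 1) * ‖a‖ ^ 2 = (l - 1) * ‖b‖ ^ 2 := by exact_mod_cast hab.symm.trans hab'
    have := mul_left_cancel₀ hl0 this
    nlinarith [norm_nonneg a, norm_nonneg b]
  have hb1 := h.bound a b haE hbF (h.generic_apply hgen)
    (fun z hz hz' => h.symm.generic_apply (fun z h1 h2 => hgen z h2 h1) z hz' hz)
  rw [hab, ← Complex.ofReal_mul, Complex.norm_real, ← hnorm, Real.norm_eq_abs, abs_mul,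
    abs_of_nonneg (sq_nonneg ‖a‖)] at hb1
  have ha0 : ‖a‖ = 0 := by
    by_contra hne
    have : 0 < ‖a‖ := lt_of_le_of_ne (norm_nonneg _) (Ne.symm hne)
    nlinarith [mul_pos this this]
  have hb0 : ‖b‖ = 0 := by rw [← hnorm, ha0]
  rw [norm_eq_zero.1 ha0, norm_eq_zero.1 hb0, add_zero, eq_comm, smul_eq_zero] at hl'
  rcases hl' with h | h
  · exact h0 (by exact_mod_cast h)
  · exact hx h

theorem eigenspace_two (h : FriedrichsAngle E F η) (x : EuclideanSpace ℂ n) :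
    toEuclideanLin (E + F) x = (2 : ℂ) • x ↔ toEuclideanLin E x = x ∧ toEuclideanLin F x = x := by
  constructor
  · intro hx
    have hx' : toEuclideanLin E x + toEuclideanLin F x = (2 : ℂ) • x := by
      rw [← hx, map_add, LinearMap.add_apply]
    have h1 (P : Matrix n n ℂ) (hP : P.IsHermitian) (hPP : P * P = P) :
        ‖x - toEuclideanLin P x‖ ^ 2 =
          ‖x‖ ^ 2 - RCLike.re (inner ℂ (toEuclideanLin P x) x) := by
      have := re_inner_self_nonneg_of_proj hP hPP x
      rw [@norm_sub_sq ℂ, ← this, ← inner_toEuclideanLin hP]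
      ring
    have h2 := h1 E h.isHermitian_left h.mul_self_left
    have h3 := h1 F h.isHermitian_right h.mul_self_right
    have h4 : RCLike.re (inner ℂ (toEuclideanLin E x) x) +
        RCLike.re (inner ℂ (toEuclideanLin F x) x) = 2 * ‖x‖ ^ 2 := by
      rw [← map_add, ← inner_add_left, hx', inner_smul_left, inner_self_eq_norm_sq_to_K]
      have : (starRingEnd ℂ) 2 * ((‖x‖ : ℝ) : ℂ) ^ 2 = ((2 * ‖x‖ ^ 2 : ℝ) : ℂ) := by
        rw [show (2 : ℂ) = ((2 : ℝ) : ℂ) by norm_num, Complex.conj_ofReal]; push_cast; rfl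
      exact (congrArg Complex.re this).trans (Complex.ofReal_re _)
    have h5 : ‖x - toEuclideanLin E x‖ = 0 := by
      nlinarith [sq_nonneg ‖x - toEuclideanLin E x‖, sq_nonneg ‖x - toEuclideanLin F x‖]
    have h6 : ‖x - toEuclideanLin F x‖ = 0 := by
      nlinarith [sq_nonneg ‖x - toEuclideanLin E x‖, sq_nonneg ‖x - toEuclideanLin F x‖]
    exact ⟨(sub_eq_zero.1 (norm_eq_zero.1 h5)).symm, (sub_eq_zero.1 (norm_eq_zero.1 h6)).symm⟩
  · rintro ⟨h1, h2⟩
    rw [map_add, LinearMap.add_apply, h1, h2, two_smul]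

/-- The optimal constant in the anticommutator inequality. -/
theorem isLeast_anticommutatorBounds (h : FriedrichsAngle E F η) (hη : η < 1) :
    IsLeast (anticommutatorBounds (1 - E) (1 - F)) η := by
  set T : Matrix n n ℂ := (1 - E) + (1 - F) with hT
  have hTH : T.IsHermitian := by
    have h1 : (1 : Matrix n n ℂ).IsHermitian := Matrix.isHermitian_one
    exact (h1.sub h.isHermitian_left).add (h1.sub h.isHermitian_right)
  have hset (x : ℝ) : x ∈ anticommutatorBounds (1 - E) (1 - F) ↔
      ∀ l ∈ spectrum ℝ T, 0 ≤ l * l - (1 - x) * l := by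
    rw [← posSemidef_sq_sub_smul_iff hTH, anticommutatorBounds, Set.mem_ofPred_eq]
    -- As `1 - E` and `1 - F` are idempotent, the inequality involves the single operator `T`, and
    -- `T = 2 - (E + F)`. The sharp case is its eigenvalue `1 - η`.
    have : (1 - E) * (1 - F) + (1 - F) * (1 - E) + (x : ℂ) • ((1 - E) + (1 - F)) =
        T * T - ((1 - x : ℝ) : ℂ) • T := by
      have h1 : (1 - E) * (1 - E) = 1 - E := by
        rw [sub_mul, mul_sub, mul_sub, h.mul_self_left]; simp
      have h2 : (1 - F) * (1 - F) = 1 - F := by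
        rw [sub_mul, mul_sub, mul_sub, h.mul_self_right]; simp
      rw [hT, add_mul, mul_add, mul_add, h1, h2]
      push_cast
      module
    rw [this]
  have hspec (l : ℝ) : l ∈ spectrum ℝ T ↔
      ∃ x, x ≠ 0 ∧ toEuclideanLin (E + F) x = ((2 - l : ℝ) : ℂ) • x := by
    rw [mem_spectrum_iff]
    refine exists_congr fun x => and_congr_right fun _ => ?_
    have : toEuclideanLin T x = (2 : ℂ) • x - toEuclideanLin (E + F) x := by
      rw [hT]
      simp only [map_add, map_sub, LinearMap.add_apply, LinearMap.sub_apply, toEuclideanLin_one]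
      module
    rw [this, Complex.ofReal_sub, sub_smul, Complex.ofReal_ofNat]
    constructor <;> intro hx
    · rw [← hx, sub_sub_cancel]
    · rw [hx, sub_sub_cancel]
  constructor
  · rw [hset]
    intro l hl
    obtain ⟨x, hx, hlx⟩ := (hspec l).1 hl
    have hη0 := h.nonneg
    rcases h.eigenvalue_cases hx hlx with h1 | h1 | h1 | h1
    · have : l = 2 := by linarith
      subst this; linarith
    · have : l = 1 := by linarith
      subst this; linarith
    · have : l = 0 := by linarith
      subst this; linarith
    · rw [abs_le] at h1
      nlinarith
  · intro x hx
    rw [hset] at hx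
    obtain ⟨y, hy, hEF⟩ := h.exists_eigenvector 1 (Or.inl rfl) hη
    have := hx (1 - η) ((hspec _).2 ⟨y, hy, by rw [hEF]; congr 2; ring⟩)
    nlinarith

theorem mem_nonintegerEigenvalues_iff (_h : FriedrichsAngle E F η) {l : ℝ} :
    l ∈ nonintegerEigenvalues (toEuclideanLin (E + F)) ↔
      (∃ x, x ≠ 0 ∧ toEuclideanLin (E + F) x = (l : ℂ) • x) ∧ ∀ z : ℤ, (z : ℝ) ≠ l := by
  refine and_congr_left fun _ => ⟨fun h => ?_, ?_⟩
  · obtain ⟨x, hx⟩ := h.exists_hasEigenvector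
    exact ⟨x, hx.2, hx.apply_eq_smul⟩
  · rintro ⟨x, hx, h⟩
    exact Module.End.hasEigenvalue_of_hasEigenvector ⟨Module.End.mem_eigenspace_iff.2 h, hx⟩

theorem abs_sub_one_le_of_mem (h : FriedrichsAngle E F η) {l : ℝ}
    (hl : l ∈ nonintegerEigenvalues (toEuclideanLin (E + F))) : |l - 1| ≤ η := by
  obtain ⟨⟨x, hx, hlx⟩, hint⟩ := h.mem_nonintegerEigenvalues_iff.1 hl
  rcases h.eigenvalue_cases hx hlx with rfl | rfl | rfl | h1
  · exact absurd (by norm_num) (hint 0)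
  · exact absurd (by norm_num) (hint 1)
  · exact absurd (by norm_num) (hint 2)
  · exact h1

theorem mem_nonintegerEigenvalues (h : FriedrichsAngle E F η) (h0 : 0 < η) (h1 : η < 1) (s : ℝ)
    (hs : s = 1 ∨ s = -1) : 1 + s * η ∈ nonintegerEigenvalues (toEuclideanLin (E + F)) := by
  refine h.mem_nonintegerEigenvalues_iff.2 ⟨h.exists_eigenvector s hs h1, fun z hz => ?_⟩
  rcases hs with rfl | rfl
  · have h2 : (1 : ℝ) < z := by linarith
    have h3 : (z : ℝ) < 2 := by linarith
    have h4 : (1 : ℤ) < z := by exact_mod_cast h2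
    have h5 : z < (2 : ℤ) := by exact_mod_cast h3
    omega
  · have h2 : (0 : ℝ) < z := by linarith
    have h3 : (z : ℝ) < 1 := by linarith
    have h4 : (0 : ℤ) < z := by exact_mod_cast h2
    have h5 : z < (1 : ℤ) := by exact_mod_cast h3
    omega

theorem isGreatest_nonintegerEigenvalues (h : FriedrichsAngle E F η) (h0 : 0 < η) (h1 : η < 1) :
    IsGreatest (nonintegerEigenvalues (toEuclideanLin (E + F))) (1 + η) := by
  refine ⟨by simpa using h.mem_nonintegerEigenvalues h0 h1 1 (Or.inl rfl), fun l hl => ?_⟩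
  have := (abs_le.1 (h.abs_sub_one_le_of_mem hl)).2
  linarith

theorem isLeast_nonintegerEigenvalues (h : FriedrichsAngle E F η) (h0 : 0 < η) (h1 : η < 1) :
    IsLeast (nonintegerEigenvalues (toEuclideanLin (E + F))) (1 - η) := by
  refine ⟨?_, fun l hl => ?_⟩
  · have := h.mem_nonintegerEigenvalues h0 h1 (-1) (Or.inr rfl)
    rwa [neg_one_mul, ← sub_eq_add_neg] at this
  · have := (abs_le.1 (h.abs_sub_one_le_of_mem hl)).1
    linarith

/-- The compression to an invariant subspace that contains the products of the two ranges has the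
same non-integer eigenvalues. -/
theorem nonintegerEigenvalues_compression (h : FriedrichsAngle E F η)
    (W : Submodule ℂ (EuclideanSpace ℂ n))
    (hE : ∀ x ∈ W, toEuclideanLin E x ∈ W) (hF : ∀ x ∈ W, toEuclideanLin F x ∈ W)
    (hFE : ∀ x, toEuclideanLin E x = x → toEuclideanLin F x ∈ W)
    (hEF : ∀ x, toEuclideanLin F x = x → toEuclideanLin E x ∈ W) :
    nonintegerEigenvalues (compression W (E + F)) =
      nonintegerEigenvalues (toEuclideanLin (E + F)) := by
  have hinv : ∀ x ∈ W, toEuclideanLin (E + F) x ∈ W := fun x hx => by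
    rw [map_add, LinearMap.add_apply]
    exact W.add_mem (hE x hx) (hF x hx)
  have hcomp (y : W) : ((compression W (E + F) y : W) : EuclideanSpace ℂ n) =
      toEuclideanLin (E + F) y := by
    change W.starProjection (toEuclideanLin (E + F) y) = _
    exact Submodule.starProjection_eq_self_iff.2 (hinv _ y.2)
  ext l
  rw [h.mem_nonintegerEigenvalues_iff]
  refine and_congr_left fun hint => ⟨fun hl => ?_, ?_⟩
  · obtain ⟨y, hy⟩ := hl.exists_hasEigenvector
    refine ⟨y, fun h0 => hy.2 (Subtype.ext h0), ?_⟩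
    rw [← hcomp, hy.apply_eq_smul]; rfl
  · rintro ⟨x, hx, hlx⟩
    have hl0 : (l : ℂ) ≠ 0 := fun h0 => hint 0 (by exact_mod_cast h0.symm)
    have hl1 : (l : ℂ) - 1 ≠ 0 := fun h0 => hint 1 (by
      have := sub_eq_zero.1 h0
      exact_mod_cast this.symm)
    have hl' : toEuclideanLin E x + toEuclideanLin F x = (l : ℂ) • x := by
      rw [← hlx, map_add, LinearMap.add_apply]
    -- Applying `P` to the eigenvalue equation gives `P Q x = (l - 1) P x`; the left side lies in
    -- `W`, and `l ≠ 1`. Both components of `x` are in `W`, and then so is `x` because `l ≠ 0`.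
    have key (P Q : Matrix n n ℂ) (hP : ∀ y, toEuclideanLin P (toEuclideanLin P y) =
        toEuclideanLin P y) (hQ : ∀ y, toEuclideanLin Q (toEuclideanLin Q y) = toEuclideanLin Q y)
        (hPQ : ∀ x, toEuclideanLin Q x = x → toEuclideanLin P x ∈ W)
        (hs : toEuclideanLin P x + toEuclideanLin Q x = (l : ℂ) • x) :
        toEuclideanLin P x ∈ W := by
      have h1 : toEuclideanLin P (toEuclideanLin Q x) = ((l : ℂ) - 1) • toEuclideanLin P x := by
        have := congrArg (toEuclideanLin P) hs
        rw [map_add, hP, map_smul] at this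
        rw [sub_smul, one_smul, ← this, add_sub_cancel_left]
      have h2 := hPQ _ (hQ x)
      rw [h1] at h2
      exact (W.smul_mem_iff hl1).1 h2
    have hxW : x ∈ W := by
      rw [← W.smul_mem_iff hl0, ← hl']
      exact W.add_mem (key E F h.apply_apply h.symm.apply_apply hEF hl')
        (key F E h.symm.apply_apply h.apply_apply hFE (by rw [add_comm, hl']))
    refine Module.End.hasEigenvalue_of_hasEigenvector (x := (⟨x, hxW⟩ : W))
      ⟨Module.End.mem_eigenspace_iff.2 (Subtype.ext ?_), fun h0 => hx (congrArg Subtype.val h0)⟩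
    rw [hcomp, hlx]; rfl

end FriedrichsAngle

/-- Two nontrivial subspaces have a largest cosine. -/
theorem exists_max_inner (A B : Submodule ℂ (EuclideanSpace ℂ n)) (hA : A ≠ ⊥) (hB : B ≠ ⊥) :
    ∃ η : ℝ, (∀ u ∈ A, ∀ w ∈ B, ‖inner ℂ u w‖ ≤ η * ‖u‖ * ‖w‖) ∧
      ∃ u ∈ A, ∃ w ∈ B, ‖u‖ = 1 ∧ ‖w‖ = 1 ∧ inner ℂ u w = (η : ℂ) := by
  have hcpt (K : Submodule ℂ (EuclideanSpace ℂ n)) :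
      IsCompact ((K : Set (EuclideanSpace ℂ n)) ∩ Metric.sphere 0 1) :=
    (isCompact_sphere 0 1).inter_left K.closed_of_finiteDimensional
  have hne (K : Submodule ℂ (EuclideanSpace ℂ n)) (hK : K ≠ ⊥) :
      ((K : Set (EuclideanSpace ℂ n)) ∩ Metric.sphere 0 1).Nonempty := by
    obtain ⟨x, hx, hx0⟩ := K.ne_bot_iff.1 hK
    refine ⟨((‖x‖⁻¹ : ℝ) : ℂ) • x, K.smul_mem _ hx, ?_⟩
    rw [mem_sphere_zero_iff_norm, norm_smul, Complex.norm_real, norm_inv, norm_norm,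
      inv_mul_cancel₀ (norm_ne_zero_iff.2 hx0)]
  obtain ⟨⟨u, w⟩, ⟨⟨huA, hu1⟩, hwB, hw1⟩, hmax⟩ := ((hcpt A).prod (hcpt B)).exists_isMaxOn
    ((hne A hA).prod (hne B hB)) (f := fun p => ‖inner ℂ p.1 p.2‖)
    (Continuous.continuousOn (by fun_prop))
  rw [mem_sphere_zero_iff_norm] at hu1 hw1
  refine ⟨‖inner ℂ u w‖, fun u' hu' w' hw' => ?_, ?_⟩
  · by_cases hu0 : u' = 0
    · simp [hu0]
    by_cases hw0 : w' = 0
    · simp [hw0]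
    have h1 : ‖inner ℂ (((‖u'‖⁻¹ : ℝ) : ℂ) • u') (((‖w'‖⁻¹ : ℝ) : ℂ) • w')‖ ≤ ‖inner ℂ u w‖ := by
      refine hmax (a := (((‖u'‖⁻¹ : ℝ) : ℂ) • u', ((‖w'‖⁻¹ : ℝ) : ℂ) • w'))
        ⟨⟨A.smul_mem _ hu', ?_⟩, B.smul_mem _ hw', ?_⟩
      · rw [mem_sphere_zero_iff_norm, norm_smul, Complex.norm_real, norm_inv, norm_norm,
          inv_mul_cancel₀ (norm_ne_zero_iff.2 hu0)]
      · rw [mem_sphere_zero_iff_norm, norm_smul, Complex.norm_real, norm_inv, norm_norm,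
          inv_mul_cancel₀ (norm_ne_zero_iff.2 hw0)]
    rw [inner_smul_left, inner_smul_right, norm_mul, norm_mul, RCLike.norm_conj,
      Complex.norm_real, Complex.norm_real, norm_inv, norm_inv, norm_norm, norm_norm] at h1
    have hu2 : 0 < ‖u'‖ := norm_pos_iff.2 hu0
    have hw2 : 0 < ‖w'‖ := norm_pos_iff.2 hw0
    calc ‖inner ℂ u' w'‖ = (‖u'‖⁻¹ * (‖w'‖⁻¹ * ‖inner ℂ u' w'‖)) * (‖u'‖ * ‖w'‖) := by
          field_simp
      _ ≤ ‖inner ℂ u w‖ * (‖u'‖ * ‖w'‖) := by gcongr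
      _ = _ := by ring
  · by_cases h0 : inner ℂ u w = 0
    · exact ⟨u, huA, w, hwB, hu1, hw1, by rw [h0]; simp⟩
    · have hpos : (((‖inner ℂ u w‖ : ℝ)) : ℂ) ≠ 0 := by
        rw [Complex.ofReal_ne_zero]; exact norm_ne_zero_iff.2 h0
      -- A phase on `w` makes the maximal inner product real and positive.
      refine ⟨u, huA, (starRingEnd ℂ (inner ℂ u w) / ((‖inner ℂ u w‖ : ℝ) : ℂ)) • w,
        B.smul_mem _ hwB, hu1, ?_, ?_⟩
      · rw [norm_smul, norm_div, RCLike.norm_conj, Complex.norm_real, norm_norm, hw1,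
          div_self (norm_ne_zero_iff.2 h0), one_mul]
      · rw [inner_smul_right, div_mul_eq_mul_div, RCLike.conj_mul, pow_two]
        exact mul_div_cancel_right₀ _ hpos

end TwoProjections

end AKLT

namespace AKLT

/-! ### Integer Gram matrices of three triangles in a row. -/

section GramMatrices

/-- Exponents 0 or 1 of the three variables of a triangle. -/
abbrev Tri := Bool × Bool × Bool

/-- The free legs of a term and the three legs of an adjacent triangle. -/
abbrev Legs := Bool × Bool × Bool × Bool × Bool × Bool × Bool

/-- The five free legs of three triangles in a row. -/
abbrev Free := Bool × Bool × Bool × Bool × Bool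

/-- Equality of Booleans. -/
def eqb (a b : Bool) : Bool := cond a b (!b)

/-- The indicator function of a conjunction. -/
def ind (a b c : Bool) : ℤ := cond a (cond b (cond c 1 0) 0) 0

/-- The Gram matrix of the states of a triangle, up to a factor: `15 - 2 Σ (swaps)`. -/
def triGram : Tri → Tri → ℤ
  | (p, q, r), (s, t, u) => 15 * ind (eqb p s) (eqb q t) (eqb r u) -
    2 * (ind (eqb p t) (eqb q s) (eqb r u) + ind (eqb p u) (eqb q t) (eqb r s) +
      ind (eqb p s) (eqb q u) (eqb r t))

/-- The Gram matrix of the states of three triangles, up to a factor. -/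
def prodGram (x y : Tri × Tri × Tri) : ℤ :=
  triGram x.1 y.1 * (triGram x.2.1 y.2.1 * triGram x.2.2 y.2.2)

/-- A term of the singlet between the first and the second triangle. -/
def leftIdx (p : Bool) : Legs → Tri × Tri × Tri
  | (a, b, c, d, e, f, g) => ((p, a, b), (!p, c, d), (e, f, g))

/-- A term of the singlet between the second and the third triangle. -/
def rightIdx (p : Bool) : Legs → Tri × Tri × Tri
  -- The mirror image of `leftIdx`: the outer triangles are exchanged, and so are the corners 0 and
  -- 1 of the middle one. With these labels both families have the same Gram matrix and `crossGram`
  -- is symmetric.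
  | (a, b, c, d, e, f, g) => ((e, f, g), (c, !p, d), (p, a, b))

/-- A term of the product of the two singlets. -/
def bothIdx (p q : Bool) : Free → Tri × Tri × Tri
  | (a, b, c, d, e) => ((p, a, b), (!p, !q, c), (q, d, e))

/-- The Gram matrix of the states with a singlet between the first two triangles. -/
def sameGram (a b : Legs) : ℤ :=
  prodGram (leftIdx true a) (leftIdx true b) - prodGram (leftIdx true a) (leftIdx false b) -
    (prodGram (leftIdx false a) (leftIdx true b) - prodGram (leftIdx false a) (leftIdx false b))

/-- The inner products of the states with a singlet on the left and those with one on the right. -/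
def crossGram (a b : Legs) : ℤ :=
  prodGram (leftIdx true a) (rightIdx true b) - prodGram (leftIdx true a) (rightIdx false b) -
    (prodGram (leftIdx false a) (rightIdx true b) - prodGram (leftIdx false a) (rightIdx false b))

/-- The inner products of a product state and a state with two singlets. -/
def freeGram (x : Tri × Tri × Tri) (k : Free) : ℤ :=
  prodGram x (bothIdx true true k) - prodGram x (bothIdx true false k) -
    (prodGram x (bothIdx false true k) - prodGram x (bothIdx false false k))

/-- The inner products of the states with a singlet on the left and those with two singlets. -/
def bothGram (a : Legs) (k : Free) : ℤ :=
  freeGram (leftIdx true a) k - freeGram (leftIdx false a) k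

/-- The number of ones. -/
def legsWeight : Legs → ℕ
  | (a, b, c, d, e, f, g) =>
    a.toNat + b.toNat + c.toNat + d.toNat + e.toNat + f.toNat + g.toNat

/-- The number of ones. -/
def freeWeight : Free → ℕ
  | (a, b, c, d, e) => a.toNat + b.toNat + c.toNat + d.toNat + e.toNat

/-- The list of the Booleans. -/
def bools : List Bool := [false, true]

/-- All leg configurations. -/
def allLegs : List Legs := bools.product (bools.product (bools.product (bools.product
  (bools.product (bools.product bools)))))

/-- All configurations of the free legs. -/
def allFree : List Free :=
  bools.product (bools.product (bools.product (bools.product bools)))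

/-- The leg configurations with `w` ones, with their inner products with the states with two
singlets. -/
def legsBlock (w : ℕ) : List (Legs × List ℤ) :=
  (allLegs.filter fun a => legsWeight a == w).map fun a =>
    -- Each link adds one to the total exponent, and the two-singlet states have one link more;
    -- hence the shift by one.
    (a, (allFree.filter fun k => freeWeight k + 1 == w).map (bothGram a))

/-- The inner product of two lists. -/
def listDot : List ℤ → List ℤ → ℤ
  | x :: xs, y :: ys => x * y + listDot xs ys
  | _, _ => 0

/-- The matrix whose positivity is the angle bound. -/
def angleMatrix (s : ℤ) (a b : Legs × List ℤ) : ℚ :=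
  -- The claimed cosine is `111043022 / 10^9`, and `s` will be `± 10^9`. The last term vanishes on
  -- vectors orthogonal to the two-singlet states; it restores positivity in the remaining
  -- directions, where the first two terms alone can be negative.
  ((111043022 * sameGram a.1 b.1 + s * crossGram a.1 b.1 + 1000000 * listDot a.2 b.2 : ℤ) : ℚ)

end GramMatrices

/-! ### Positivity of rational matrices by pivots. -/

section Elimination

/-- The rows of the upper triangle of a matrix. -/
def upperRows {α : Type} (q : α → α → ℚ) : List α → List (List ℚ)
  | [] => []
  | a :: l => (a :: l).map (q a) :: upperRows q l

/-- Subtraction of a multiple of a row. -/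
def subRow (f : ℚ) : List ℚ → List ℚ → List ℚ
  | x :: xs, y :: ys => (x - f * y) :: subRow f xs ys
  | _, _ => []

/-- The Schur complement of a pivot. -/
def schurRows (a : ℚ) : List ℚ → List (List ℚ) → List (List ℚ)
  | y :: ys, r :: rs => (if y = 0 then r else subRow (y / a) r (y :: ys)) :: schurRows a ys rs
  | _, _ => []

/-- The pivots of the elimination are positive. -/
def pivotsPos : ℕ → List (List ℚ) → Bool
  | n + 1, (a :: b) :: rs => decide (0 < a) && pivotsPos n (schurRows a b rs)
  | _, [] => true
  | _, _ => false

end Elimination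

-- Exact elimination in the eight weight blocks, evaluated by the kernel. The fuel is the size of
-- the largest block, `C(7,3) = 35`.
set_option maxRecDepth 100000 in
theorem pivotsPos_neg : ((List.range 8).all fun w =>
    pivotsPos 35 (upperRows (angleMatrix (-1000000000)) (legsBlock w))) = true := by
  decide +kernel

set_option maxRecDepth 100000 in
theorem pivotsPos_pos : ((List.range 8).all fun w =>
    pivotsPos 35 (upperRows (angleMatrix 1000000000) (legsBlock w))) = true := by
  decide +kernel

end AKLT

namespace AKLT

/-! ### Soundness of the elimination. -/

section Elimination

/-- The pairing of a list of coefficients and a list of numbers. -/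
noncomputable def rowDot : List ℚ → List ℝ → ℝ
  | a :: b, x :: xs => a * x + rowDot b xs
  | _, _ => 0

/-- The quadratic form of the rows of an upper triangle. -/
noncomputable def rowForm : List (List ℚ) → List ℝ → ℝ
  | (a :: b) :: rs, x :: xs => a * x * x + 2 * x * rowDot b xs + rowForm rs xs
  | _, _ => 0

/-- The lengths of the rows are those of an upper triangle. -/
def IsTriangle : List (List ℚ) → Prop
  | [] => True
  | r :: rs => r.length = rs.length + 1 ∧ IsTriangle rs

theorem length_subRow (f : ℚ) : ∀ (r s : List ℚ), r.length = s.length →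
    (subRow f r s).length = r.length
  | [], [], _ => rfl
  | x :: xs, y :: ys, h => by
    simp only [subRow, List.length_cons, length_subRow f xs ys (by simpa using h)]

theorem rowDot_subRow (f : ℚ) : ∀ (r s : List ℚ) (x : List ℝ), r.length = s.length →
    rowDot (subRow f r s) x = rowDot r x - f * rowDot s x
  | [], [], x, _ => by simp [subRow, rowDot]
  | a :: r, b :: s, [], _ => by simp [subRow, rowDot]
  | a :: r, b :: s, x :: xs, h => by
    simp only [subRow, rowDot, rowDot_subRow f r s xs (by simpa using h)]
    push_cast
    ring

theorem schurRows_shape (a : ℚ) : ∀ (b : List ℚ) (rs : List (List ℚ)), b.length = rs.length →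
    IsTriangle rs → (schurRows a b rs).length = rs.length ∧ IsTriangle (schurRows a b rs)
  | [], [], _, _ => ⟨rfl, trivial⟩
  | y :: ys, r :: rs, h, ht => by
    have h' : ys.length = rs.length := by simpa using h
    obtain ⟨h1, h2⟩ := schurRows_shape a ys rs h' ht.2
    refine ⟨by simp only [schurRows, List.length_cons, h1], ?_, h2⟩
    rw [h1]
    split_ifs
    · exact ht.1
    · rw [length_subRow _ _ _ (by rw [ht.1]; exact h.symm), ht.1]

/-- Elimination of a pivot subtracts a rank-one form. The shortcut in `schurRows` for a zero
multiplier leaves the row as the general formula would. -/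
theorem rowForm_schurRows (a : ℚ) : ∀ (b : List ℚ) (rs : List (List ℚ)) (x : List ℝ),
    b.length = rs.length → x.length = rs.length → IsTriangle rs →
    rowForm (schurRows a b rs) x = rowForm rs x - rowDot b x * rowDot b x / a
  | [], [], x, _, _, _ => by simp [schurRows, rowForm, rowDot]
  | y :: ys, [] :: rs, x, h, hx, ht => by simp [IsTriangle] at ht
  | y :: ys, (c :: r) :: rs, x :: xs, h, hx, ht => by
    have h' : ys.length = rs.length := by simpa using h
    have hr : r.length = ys.length := by
      have := ht.1
      simp only [List.length_cons] at this
      omega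
    have ih := rowForm_schurRows a ys rs xs h' (by simpa using hx) ht.2
    simp only [schurRows]
    split_ifs with hy
    · subst hy
      simp only [rowForm, rowDot, ih]
      push_cast
      ring
    · simp only [subRow, rowForm, rowDot, ih, rowDot_subRow _ _ _ _ hr]
      push_cast
      ring

/-- A positive pivot splits off a square, and the rest is the form of the Schur complement. -/
theorem rowForm_nonneg : ∀ (n : ℕ) (rs : List (List ℚ)) (x : List ℝ), x.length = rs.length →
    IsTriangle rs → pivotsPos n rs = true → 0 ≤ rowForm rs x
  | _, [], x, _, _, _ => by simp [rowForm]
  | 0, _ :: _, _, _, _, h => by simp [pivotsPos] at h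
  | n + 1, [] :: rs, _, _, ht, _ => by simp [IsTriangle] at ht
  | n + 1, (a :: b) :: rs, x :: xs, hx, ht, h => by
    simp only [pivotsPos, Bool.and_eq_true, decide_eq_true_eq] at h
    have hb : b.length = rs.length := by simpa using ht.1
    have hx' : xs.length = rs.length := by simpa using hx
    obtain ⟨h1, h2⟩ := schurRows_shape a b rs hb ht.2
    have ih := rowForm_nonneg n (schurRows a b rs) xs (by rw [h1, hx']) h2 h.2
    rw [rowForm_schurRows a b rs xs hb hx' ht.2] at ih
    have ha : (0 : ℝ) < a := by exact_mod_cast h.1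
    have e : rowForm ((a :: b) :: rs) (x :: xs) = a * (x + rowDot b xs / a) ^ 2 +
        (rowForm rs xs - rowDot b xs * rowDot b xs / a) := by
      simp only [rowForm]
      field_simp
      ring
    rw [e]
    positivity

theorem upperRows_shape {α : Type} (q : α → α → ℚ) : ∀ l : List α,
    (upperRows q l).length = l.length ∧ IsTriangle (upperRows q l)
  | [] => ⟨rfl, trivial⟩
  | a :: l => by
    obtain ⟨h1, h2⟩ := upperRows_shape q l
    exact ⟨by simp [upperRows, h1], by simp [h1], h2⟩

theorem rowDot_map {α : Type} (q : α → ℚ) (f : α → ℝ) : ∀ l : List α,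
    rowDot (l.map q) (l.map f) = (l.map fun b => q b * f b).sum
  | [] => by simp [rowDot]
  | a :: l => by simp [rowDot, rowDot_map q f l]

theorem rowForm_upperRows {α : Type} (q : α → α → ℚ) (hq : ∀ a b, q a b = q b a) (f : α → ℝ) :
    ∀ l : List α, rowForm (upperRows q l) (l.map f) =
      (l.map fun a => (l.map fun b => q a b * f a * f b).sum).sum
  | [] => by simp [rowForm, upperRows]
  | a :: l => by
    simp only [upperRows, List.map_cons, rowForm, rowForm_upperRows q hq f l, List.sum_cons,
      List.sum_map_add, rowDot_map]
    have h1 : (l.map fun b => (q a b : ℝ) * f a * f b).sum =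
        f a * (l.map fun b => (q a b : ℝ) * f b).sum := by
      rw [← List.sum_map_mul_left]
      congr 2
      funext b
      ring
    have h2 : (l.map fun b => (q b a : ℝ) * f b * f a).sum =
        f a * (l.map fun b => (q a b : ℝ) * f b).sum := by
      rw [← List.sum_map_mul_left]
      congr 2
      funext b
      rw [hq b a]
      ring
    rw [h1, h2]
    ring

theorem sum_nonneg_of_pivotsPos {α : Type} (q : α → α → ℚ) (hq : ∀ a b, q a b = q b a)
    (l : List α) (n : ℕ) (h : pivotsPos n (upperRows q l) = true) (f : α → ℝ) :
    0 ≤ (l.map fun a => (l.map fun b => q a b * f a * f b).sum).sum := by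
  obtain ⟨h1, h2⟩ := upperRows_shape q l
  rw [← rowForm_upperRows q hq]
  exact rowForm_nonneg n _ _ (by simp [h1]) h2 h

end Elimination

/-! ### From positive pivots to the bound on the cosine. -/

section GramMatrices

theorem triGram_comm (x y : Tri) : triGram x y = triGram y x := by
  revert x y; decide +kernel

/-- The triangle polynomial is alternating, and the two signs of a simultaneous swap cancel. -/
theorem triGram_swap (a b c d e f : Bool) :
    triGram (a, b, c) (d, e, f) = triGram (b, a, c) (e, d, f) := by
  revert a b c d e f; decide +kernel

/-- The number of ones. -/
def triWeight (x : Tri) : ℕ := x.1.toNat + x.2.1.toNat + x.2.2.toNat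

/-- Conservation of magnetisation, the source of the block structure of all Gram matrices. -/
theorem triWeight_eq_of_triGram_ne_zero {x y : Tri} (h : triGram x y ≠ 0) :
    triWeight x = triWeight y := by
  revert x y; decide +kernel

/-- The number of ones. -/
def totalWeight (x : Tri × Tri × Tri) : ℕ := triWeight x.1 + triWeight x.2.1 + triWeight x.2.2

theorem prodGram_comm (x y : Tri × Tri × Tri) : prodGram x y = prodGram y x := by
  simp only [prodGram, triGram_comm x.1, triGram_comm x.2.1, triGram_comm x.2.2]

theorem prodGram_eq_zero {x y : Tri × Tri × Tri} (h : totalWeight x ≠ totalWeight y) :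
    prodGram x y = 0 := by
  by_contra h0
  simp only [prodGram, mul_eq_zero, not_or] at h0
  refine h ?_
  rw [totalWeight, totalWeight, triWeight_eq_of_triGram_ne_zero h0.1,
    triWeight_eq_of_triGram_ne_zero h0.2.1, triWeight_eq_of_triGram_ne_zero h0.2.2]

theorem totalWeight_leftIdx (p : Bool) (a : Legs) :
    totalWeight (leftIdx p a) = legsWeight a + 1 := by
  obtain ⟨a, b, c, d, e, f, g⟩ := a
  cases p <;> simp only [totalWeight, triWeight, leftIdx, legsWeight, Bool.toNat_false,
    Bool.toNat_true, Bool.not_false, Bool.not_true] <;> omega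

theorem totalWeight_rightIdx (p : Bool) (a : Legs) :
    totalWeight (rightIdx p a) = legsWeight a + 1 := by
  obtain ⟨a, b, c, d, e, f, g⟩ := a
  cases p <;> simp only [totalWeight, triWeight, rightIdx, legsWeight, Bool.toNat_false,
    Bool.toNat_true, Bool.not_false, Bool.not_true] <;> omega

theorem totalWeight_bothIdx (p q : Bool) (a : Free) :
    totalWeight (bothIdx p q a) = freeWeight a + 2 := by
  obtain ⟨a, b, c, d, e⟩ := a
  cases p <;> cases q <;> simp only [totalWeight, triWeight, bothIdx, freeWeight,
    Bool.toNat_false, Bool.toNat_true, Bool.not_false, Bool.not_true] <;> omega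

theorem sameGram_comm (a b : Legs) : sameGram a b = sameGram b a := by
  simp only [sameGram, prodGram_comm (leftIdx _ a)]
  ring

/-- The reflection of the row exchanges the left and the right family. -/
theorem prodGram_left_right (p q : Bool) (a b : Legs) :
    prodGram (leftIdx p a) (rightIdx q b) = prodGram (leftIdx q b) (rightIdx p a) := by
  obtain ⟨a1, a2, a3, a4, a5, a6, a7⟩ := a
  obtain ⟨b1, b2, b3, b4, b5, b6, b7⟩ := b
  simp only [prodGram, leftIdx, rightIdx]
  rw [triGram_comm (p, a1, a2), triGram_comm (!p, a3, a4), triGram_comm (a5, a6, a7),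
    triGram_swap b3 (!q)]
  ring

theorem crossGram_comm (a b : Legs) : crossGram a b = crossGram b a := by
  simp only [crossGram, prodGram_left_right _ _ a b]
  ring

theorem sameGram_eq_zero {a b : Legs} (h : legsWeight a ≠ legsWeight b) : sameGram a b = 0 := by
  have (p q : Bool) : prodGram (leftIdx p a) (leftIdx q b) = 0 := prodGram_eq_zero (by
    rw [totalWeight_leftIdx, totalWeight_leftIdx]; omega)
  simp only [sameGram, this, sub_zero]

theorem crossGram_eq_zero {a b : Legs} (h : legsWeight a ≠ legsWeight b) : crossGram a b = 0 := by
  have (p q : Bool) : prodGram (leftIdx p a) (rightIdx q b) = 0 := prodGram_eq_zero (by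
    rw [totalWeight_leftIdx, totalWeight_rightIdx]; omega)
  simp only [crossGram, this, sub_zero]

theorem bothGram_eq_zero {a : Legs} {k : Free} (h : legsWeight a ≠ freeWeight k + 1) :
    bothGram a k = 0 := by
  have (p q r : Bool) : prodGram (leftIdx p a) (bothIdx q r k) = 0 := prodGram_eq_zero (by
    rw [totalWeight_leftIdx, totalWeight_bothIdx]; omega)
  simp only [bothGram, freeGram, this, sub_zero]

theorem listDot_comm : ∀ l l' : List ℤ, listDot l l' = listDot l' l
  | [], [] => rfl
  | [], _ :: _ => rfl
  | _ :: _, [] => rfl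
  | x :: xs, y :: ys => by simp only [listDot, listDot_comm xs ys, mul_comm]

theorem angleMatrix_comm (s : ℤ) (a b : Legs × List ℤ) :
    angleMatrix s a b = angleMatrix s b a := by
  simp only [angleMatrix, sameGram_comm a.1, crossGram_comm a.1, listDot_comm a.2]

theorem listDot_map {α : Type} (f g : α → ℤ) : ∀ l : List α,
    listDot (l.map f) (l.map g) = (l.map fun k => f k * g k).sum
  | [] => rfl
  | a :: l => by simp [listDot, listDot_map f g l]

instance : DecidableEq Legs := fun a b => decidable_of_iff (a.1 = b.1 ∧ a.2 = b.2) Prod.ext_iff.symm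

theorem nodup_allLegs : allLegs.Nodup := by decide +kernel

theorem mem_allLegs (a : Legs) : a ∈ allLegs := by
  revert a; decide +kernel

theorem legsWeight_lt (a : Legs) : legsWeight a < 8 := by
  revert a; decide +kernel

/-- The weight spaces. -/
def legsOfWeight (w : ℕ) : List Legs := allLegs.filter fun a => legsWeight a == w

theorem sum_legsOfWeight {M : Type*} [AddCommMonoid M] (w : ℕ) (g : Legs → M) :
    ((legsOfWeight w).map g).sum = ∑ a with legsWeight a = w, g a := by
  rw [legsOfWeight, ← List.sum_toFinset g (nodup_allLegs.filter _)]
  refine Finset.sum_congr ?_ fun _ _ => rfl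
  ext a
  simp [mem_allLegs]

/-- The constraints `hf` split by weight. On a vector that satisfies them the last term of
`angleMatrix` contributes nothing, so positivity of the full matrix is positivity of the angle form.
-/
theorem angle_nonneg_block (s : ℤ) (w : ℕ)
    (h : pivotsPos 35 (upperRows (angleMatrix s) (legsBlock w)) = true)
    (f : Legs → ℝ) (hf : ∀ k, ∑ a, (bothGram a k : ℝ) * f a = 0) :
    0 ≤ ∑ a with legsWeight a = w, ∑ b with legsWeight b = w,
      ((111043022 * sameGram a b + s * crossGram a b : ℤ) : ℝ) * f a * f b := by
  have h1 := sum_nonneg_of_pivotsPos (angleMatrix s) (angleMatrix_comm s) _ 35 h (fun a => f a.1)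
  set F : List Free := allFree.filter fun k => freeWeight k + 1 == w with hF
  have hblock : legsBlock w = (legsOfWeight w).map fun a => (a, F.map (bothGram a)) := rfl
  simp only [hblock, List.map_map, Function.comp_def] at h1
  rw [sum_legsOfWeight] at h1
  simp only [sum_legsOfWeight] at h1
  have hk (k : Free) (hk : k ∈ F) : ∑ a with legsWeight a = w, (bothGram a k : ℝ) * f a = 0 := by
    rw [← hf k]
    refine Finset.sum_subset (Finset.filter_subset _ _) fun a _ ha => ?_
    rw [bothGram_eq_zero, Int.cast_zero, zero_mul]
    intro h2
    refine ha (Finset.mem_filter.2 ⟨Finset.mem_univ _, ?_⟩)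
    have := (List.mem_filter.1 hk).2
    simp only [beq_iff_eq] at this
    omega
  have hterm (a b : Legs) : ((angleMatrix s (a, F.map (bothGram a)) (b, F.map (bothGram b)) : ℚ) : ℝ) *
      f a * f b = ((111043022 * sameGram a b + s * crossGram a b : ℤ) : ℝ) * f a * f b +
        1000000 * (F.map fun k => ((bothGram a k : ℝ) * f a) * ((bothGram b k : ℝ) * f b)).sum := by
    simp only [angleMatrix, listDot_map]
    have : (F.map fun k => ((bothGram a k : ℝ) * f a) * ((bothGram b k : ℝ) * f b)).sum =
        (((F.map fun k => bothGram a k * bothGram b k).sum : ℤ) : ℝ) * (f a * f b) := by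
      rw [Int.cast_list_sum, List.map_map, ← List.sum_map_mul_right]
      congr 2
      funext k
      simp only [Function.comp_apply, Int.cast_mul]
      ring
    rw [this]
    generalize (F.map fun k => bothGram a k * bothGram b k).sum = z
    push_cast
    ring
  simp only [hterm, Finset.sum_add_distrib, ← Finset.mul_sum] at h1
  have hzero : ∑ a with legsWeight a = w, ∑ b with legsWeight b = w,
      (F.map fun k => ((bothGram a k : ℝ) * f a) * ((bothGram b k : ℝ) * f b)).sum = 0 := by
    refine Finset.sum_eq_zero fun a _ => ?_
    have hswap : ∀ l : List Free, (∀ k ∈ l, k ∈ F) → ∑ b with legsWeight b = w,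
        (l.map fun k => ((bothGram a k : ℝ) * f a) * ((bothGram b k : ℝ) * f b)).sum = 0 := by
      intro l
      induction l with
      | nil => simp
      | cons k l ih =>
        intro hl
        simp only [List.map_cons, List.sum_cons, Finset.sum_add_distrib, ← Finset.mul_sum]
        rw [hk k (hl k (by simp)), ih fun k' hk' => hl k' (by simp [hk'])]
        ring
    exact hswap F fun _ h => h
  rwa [hzero, mul_zero, add_zero] at h1

/-- Entries between different weights vanish, so the form is the sum of its diagonal blocks. -/
theorem angle_nonneg (s : ℤ)
    (h : ((List.range 8).all fun w => pivotsPos 35 (upperRows (angleMatrix s) (legsBlock w))) = true)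
    (f : Legs → ℝ) (hf : ∀ k, ∑ a, (bothGram a k : ℝ) * f a = 0) :
    0 ≤ ∑ a, ∑ b, ((111043022 * sameGram a b + s * crossGram a b : ℤ) : ℝ) * f a * f b := by
  rw [List.all_eq_true] at h
  have h1 : ∀ a : Legs, a ∈ Finset.univ → legsWeight a ∈ Finset.range 8 := fun a _ =>
    Finset.mem_range.2 (legsWeight_lt a)
  rw [← Finset.sum_fiberwise_of_maps_to h1]
  refine Finset.sum_nonneg fun w hw => ?_
  refine le_of_le_of_eq (angle_nonneg_block s w (h w (by simpa using hw)) f hf) ?_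
  refine Finset.sum_congr rfl fun a ha => ?_
  refine Finset.sum_subset (Finset.filter_subset _ _) fun b _ hb => ?_
  have hne : legsWeight a ≠ legsWeight b := by
    intro h2
    rw [(Finset.mem_filter.1 ha).2] at h2
    exact hb (Finset.mem_filter.2 ⟨Finset.mem_univ _, h2.symm⟩)
  rw [sameGram_eq_zero hne, crossGram_eq_zero hne]
  simp

/-- The angle bound in real coordinates. -/
theorem cross_le (f g : Legs → ℝ) (hf : ∀ k, ∑ a, (bothGram a k : ℝ) * f a = 0)
    (hg : ∀ k, ∑ a, (bothGram a k : ℝ) * g a = 0) :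
    2 * ∑ a, ∑ b, (crossGram a b : ℝ) * f a * g b ≤ 0.1110430220 *
      (∑ a, ∑ b, (sameGram a b : ℝ) * f a * f b + ∑ a, ∑ b, (sameGram a b : ℝ) * g a * g b) := by
  -- Polarisation: the form with the minus sign at `f + g` and that with the plus sign at `f - g`
  -- add up to `2 η` times both squared norms minus four times the cross term, up to scale.
  have h1 := angle_nonneg _ pivotsPos_neg (fun a => f a + g a) fun k => by
    simp only [mul_add, Finset.sum_add_distrib, hf, hg, add_zero]
  have h2 := angle_nonneg _ pivotsPos_pos (fun a => f a - g a) fun k => by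
    simp only [mul_sub, Finset.sum_sub_distrib, hf, hg, sub_zero]
  have hsym (q : Legs → Legs → ℤ) (hq : ∀ a b, q a b = q b a) :
      ∑ a, ∑ b, (q a b : ℝ) * g a * f b = ∑ a, ∑ b, (q a b : ℝ) * f a * g b := by
    rw [Finset.sum_comm]
    refine Finset.sum_congr rfl fun a _ => Finset.sum_congr rfl fun b _ => ?_
    rw [hq b a]
    ring
  have e1 : ∑ a, ∑ b, ((111043022 * sameGram a b + (-1000000000) * crossGram a b : ℤ) : ℝ) *
      (f a + g a) * (f b + g b) = 111043022 * (∑ a, ∑ b, (sameGram a b : ℝ) * f a * f b +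
        2 * (∑ a, ∑ b, (sameGram a b : ℝ) * f a * g b) +
        ∑ a, ∑ b, (sameGram a b : ℝ) * g a * g b) -
      1000000000 * (∑ a, ∑ b, (crossGram a b : ℝ) * f a * f b +
        2 * (∑ a, ∑ b, (crossGram a b : ℝ) * f a * g b) +
        ∑ a, ∑ b, (crossGram a b : ℝ) * g a * g b) := by
    rw [two_mul, two_mul]
    nth_rw 1 [← hsym sameGram sameGram_comm]
    nth_rw 1 [← hsym crossGram crossGram_comm]
    simp only [mul_add, Finset.mul_sum, ← Finset.sum_add_distrib, ← Finset.sum_sub_distrib]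
    refine Finset.sum_congr rfl fun a _ => Finset.sum_congr rfl fun b _ => ?_
    push_cast
    ring
  have e2 : ∑ a, ∑ b, ((111043022 * sameGram a b + 1000000000 * crossGram a b : ℤ) : ℝ) *
      (f a - g a) * (f b - g b) = 111043022 * (∑ a, ∑ b, (sameGram a b : ℝ) * f a * f b -
        2 * (∑ a, ∑ b, (sameGram a b : ℝ) * f a * g b) +
        ∑ a, ∑ b, (sameGram a b : ℝ) * g a * g b) +
      1000000000 * (∑ a, ∑ b, (crossGram a b : ℝ) * f a * f b -
        2 * (∑ a, ∑ b, (crossGram a b : ℝ) * f a * g b) +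
        ∑ a, ∑ b, (crossGram a b : ℝ) * g a * g b) := by
    rw [two_mul, two_mul]
    nth_rw 1 [← hsym sameGram sameGram_comm]
    nth_rw 1 [← hsym crossGram crossGram_comm]
    simp only [mul_add, mul_sub, Finset.mul_sum, ← Finset.sum_add_distrib,
      ← Finset.sum_sub_distrib]
    refine Finset.sum_congr rfl fun a _ => Finset.sum_congr rfl fun b _ => ?_
    push_cast
    ring
  rw [e1] at h1
  rw [e2] at h2
  linarith

end GramMatrices

end AKLT

namespace AKLT

open MvPolynomial Function

/-! ### Explicit states of triangles and their inner products. -/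

section TriangleStates

/-- The signs of the terms of `(x₀ - x₁)(x₁ - x₂)(x₂ - x₀)`. -/
def triSign : Fin 6 → ℤ := ![-1, 1, 1, -1, -1, 1]

/-- The exponents of the terms of `(x₀ - x₁)(x₁ - x₂)(x₂ - x₀)`. -/
def triExp : Fin 6 → Fin 3 → ℕ :=
  ![![2, 1, 0], ![2, 0, 1], ![1, 2, 0], ![1, 0, 2], ![0, 2, 1], ![0, 1, 2]]

/-- The exponents of the free legs of a triangle. -/
def triBit (b : Tri) : Fin 3 → ℕ := ![b.1.toNat, b.2.1.toNat, b.2.2.toNat]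

/-- The coefficients of `(x₀ - x₁)(x₁ - x₂)(x₂ - x₀)` times a monomial. -/
def triCoeff (b : Tri) (τ : Fin 3 → Fin 4) : ℤ :=
  ∑ k, triSign k * ∏ i, if (τ i : ℕ) = triExp k i + triBit b i then 1 else 0

/-- Three times the inverse of the binomial coefficient `C(3,k)`. -/
def invChoose : Fin 4 → ℤ := ![3, 1, 1, 3]

-- The monomial `x^k` has squared norm `1 / C(3,k)`, which `invChoose` clears of denominators. The
-- sum is thus 27 times the inner product of two triangle states.
set_option maxRecDepth 100000 in
theorem sum_triCoeff_mul (x y : Tri) :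
    ∑ a, ∑ b, ∑ c, triCoeff x ![a, b, c] * triCoeff y ![a, b, c] *
      (invChoose a * (invChoose b * invChoose c)) = 2 * triGram x y := by
  revert x y
  decide +kernel

theorem triExp_add_lt (k : Fin 6) (b : Tri) (i : Fin 3) : triExp k i + triBit b i < 4 := by
  revert k b i
  decide +kernel

/-- The factors of a triple. -/
def tripleOf (x : Tri × Tri × Tri) : Fin 3 → Tri := ![x.1, x.2.1, x.2.2]

/-- The exponents of a triple. -/
def bitOf (x : Tri × Tri × Tri) (v : Fin 3 × Fin 3) : ℕ := triBit (tripleOf x v.1) v.2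

/-- The polynomial of the singlets of three triangles. -/
noncomputable def triPoly : MvPolynomial (Fin 3 × Fin 3) ℂ :=
  ∏ v : Fin 3 × Fin 3, (X (v.1, v.2) - X (v.1, v.2 + 1))

/-- The product of the states of three triangles for given free legs. -/
noncomputable def prodVec (x : Tri × Tri × Tri) : EuclideanSpace ℂ (Fin 3 × Fin 3 → Fin 4) :=
  WithLp.toLp 2 fun σ => ((∏ t, triCoeff (tripleOf x t) fun i => σ (t, i) : ℤ) : ℂ) /
    ∏ v, weight (σ v)

theorem sum_triSign {R : Type*} [CommRing R] (x : Fin 3 → R) :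
    ∑ k, (triSign k : R) * ∏ i, x i ^ triExp k i = ∏ i, (x i - x (i + 1)) := by
  rw [Fin.prod_univ_three]
  simp only [Fin.sum_univ_six, Fin.prod_univ_three, triSign, triExp, Matrix.cons_val]
  simp
  ring

/-- Each alternating product has the six monomials listed in `triSign` and `triExp`; the division by
weights in `prodVec` undoes the weights of `toPoly`. -/
theorem toPoly_prodVec (x : Tri × Tri × Tri) :
    toPoly (prodVec x) = triPoly * ∏ v, X v ^ bitOf x v := by
  have h1 (σ : Fin 3 × Fin 3 → Fin 4) : (prodVec x) σ * ∏ v, weight (σ v) =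
      ∑ k : Fin 3 → Fin 6, (∏ t, (triSign (k t) : ℂ)) * ∏ v : Fin 3 × Fin 3,
        if (σ v : ℕ) = triExp (k v.1) v.2 + bitOf x v then 1 else 0 := by
    rw [prodVec, div_mul_cancel₀ _ (prod_weight_ne_zero σ)]
    simp only [triCoeff]
    rw [Fintype.prod_sum]
    push_cast
    refine Finset.sum_congr rfl fun k _ => ?_
    rw [Finset.prod_mul_distrib, Fintype.prod_prod_type]
    rfl
  simp only [toPoly_apply, h1, map_sum]
  rw [Finset.sum_comm]
  simp only [← C_mul_monomial]
  simp only [← Finset.mul_sum]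
  have h2 (k : Fin 3 → Fin 6) := sum_monomial_prod_ite
    (fun v : Fin 3 × Fin 3 => triExp (k v.1) v.2 + bitOf x v) fun v => triExp_add_lt _ _ _
  simp only [h2, pow_add, Finset.prod_mul_distrib]
  simp only [← mul_assoc, ← Finset.sum_mul]
  congr 1
  rw [triPoly, Fintype.prod_prod_type]
  simp only [← sum_triSign (fun i => (X (_, i) : MvPolynomial (Fin 3 × Fin 3) ℂ))]
  rw [Fintype.prod_sum]
  refine Finset.sum_congr rfl fun k _ => ?_
  rw [Finset.prod_mul_distrib, Fintype.prod_prod_type, map_prod]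
  simp

theorem weight_mul_self (k : Fin 4) : weight k * weight k * invChoose k = 3 := by
  rw [weight, ← Complex.ofReal_mul, Real.mul_self_sqrt (Nat.cast_nonneg _)]
  fin_cases k <;> simp [invChoose, Nat.choose]

theorem conj_prodVec (x : Tri × Tri × Tri) (σ : Fin 3 × Fin 3 → Fin 4) :
    starRingEnd ℂ (prodVec x σ) = prodVec x σ := by
  simp only [prodVec, map_div₀, map_prod, map_intCast]
  simp only [starRingEnd_apply, star_weight]

/-- The sum over the configurations of a triangle. -/
theorem sum_fin_three {M : Type*} [AddCommMonoid M] (f : (Fin 3 → Fin 4) → M) :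
    ∑ τ, f τ = ∑ a, ∑ b, ∑ c, f ![a, b, c] := by
  rw [← (Fin.consEquiv fun _ : Fin 3 => Fin 4).sum_comp, Fintype.sum_prod_type]
  refine Finset.sum_congr rfl fun a _ => ?_
  rw [← (Fin.consEquiv fun _ : Fin 2 => Fin 4).sum_comp, Fintype.sum_prod_type]
  refine Finset.sum_congr rfl fun b _ => ?_
  rw [← (Fin.consEquiv fun _ : Fin 1 => Fin 4).sum_comp, Fintype.sum_prod_type]
  refine Finset.sum_congr rfl fun c _ => ?_
  rw [Fintype.sum_unique]
  congr 1

/-- The sum over the nine sites factors over the triangles, and each of them contributes `2/27`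
times its `triGram`. -/
theorem inner_prodVec (x y : Tri × Tri × Tri) :
    inner ℂ (prodVec x) (prodVec y) = (((2 / 27 : ℝ) ^ 3 * prodGram x y : ℝ) : ℂ) := by
  have h1 (σ : Fin 3 × Fin 3 → Fin 4) : inner ℂ (prodVec x σ) (prodVec y σ) =
      ∏ t, ((triCoeff (tripleOf x t) (fun i => σ (t, i)) : ℂ) *
        triCoeff (tripleOf y t) (fun i => σ (t, i)) *
        ∏ i, ((invChoose (σ (t, i)) : ℂ) / 3)) := by
    rw [RCLike.inner_apply, conj_prodVec]
    simp only [prodVec]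
    rw [Finset.prod_mul_distrib, Finset.prod_mul_distrib,
      ← Fintype.prod_prod_type (f := fun v : Fin 3 × Fin 3 => (invChoose (σ v) : ℂ) / 3)]
    have h2 : (∏ v, weight (σ v)) * (∏ v, weight (σ v)) * ∏ v, ((invChoose (σ v) : ℂ) / 3) = 1 := by
      rw [← Finset.prod_mul_distrib, ← Finset.prod_mul_distrib]
      refine Finset.prod_eq_one fun v _ => ?_
      rw [mul_div_assoc', weight_mul_self, div_self (by norm_num)]
    have h3 := prod_weight_ne_zero (s := Finset.univ) σ
    rw [div_mul_div_comm, div_eq_iff (mul_ne_zero h3 h3)]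
    push_cast
    linear_combination (-(∏ t, (triCoeff (tripleOf x t) fun i => σ (t, i) : ℂ)) *
      ∏ t, (triCoeff (tripleOf y t) fun i => σ (t, i) : ℂ)) * h2
  have h4 (t : Fin 3) : ∑ τ : Fin 3 → Fin 4, ((triCoeff (tripleOf x t) τ : ℂ) *
      triCoeff (tripleOf y t) τ * ∏ i, ((invChoose (τ i) : ℂ) / 3)) =
      (2 / 27) * triGram (tripleOf x t) (tripleOf y t) := by
    have := congrArg (fun z : ℤ => (z : ℂ) / 27) (sum_triCoeff_mul (tripleOf x t) (tripleOf y t))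
    rw [sum_fin_three]
    push_cast at this
    rw [mul_div_right_comm] at this
    rw [← this]
    simp only [Finset.sum_div]
    refine Finset.sum_congr rfl fun a _ => Finset.sum_congr rfl fun b _ =>
      Finset.sum_congr rfl fun c _ => ?_
    rw [Fin.prod_univ_three]
    simp only [Matrix.cons_val]
    ring
  rw [PiLp.inner_apply]
  simp only [h1]
  rw [← (Equiv.curry (Fin 3) (Fin 3) (Fin 4)).symm.sum_comp]
  change ∑ τ : Fin 3 → Fin 3 → Fin 4, ∏ t, ((triCoeff (tripleOf x t) (τ t) : ℂ) *
      triCoeff (tripleOf y t) (τ t) * ∏ i, ((invChoose (τ t i) : ℂ) / 3)) = _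
  rw [← Fintype.prod_sum (fun t (τ : Fin 3 → Fin 4) => (triCoeff (tripleOf x t) τ : ℂ) *
      triCoeff (tripleOf y t) τ * ∏ i, ((invChoose (τ i) : ℂ) / 3))]
  simp only [h4]
  rw [Fin.prod_univ_three]
  simp only [tripleOf, prodGram, Matrix.cons_val]
  push_cast
  ring

end TriangleStates

end AKLT

namespace AKLT

open MvPolynomial Function

/-! ### Bases of the states with singlets on one or both links. -/

section ChainVectors

/-- A state of three triangles with a singlet between the first two. -/
noncomputable def leftVec (a : Legs) : EuclideanSpace ℂ (Fin 3 × Fin 3 → Fin 4) :=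
  prodVec (leftIdx true a) - prodVec (leftIdx false a)

/-- A state of three triangles with a singlet between the last two. -/
noncomputable def rightVec (a : Legs) : EuclideanSpace ℂ (Fin 3 × Fin 3 → Fin 4) :=
  prodVec (rightIdx true a) - prodVec (rightIdx false a)

/-- A state of three triangles with both singlets. -/
noncomputable def bothVec (k : Free) : EuclideanSpace ℂ (Fin 3 × Fin 3 → Fin 4) :=
  prodVec (bothIdx true true k) - prodVec (bothIdx true false k) -
    (prodVec (bothIdx false true k) - prodVec (bothIdx false false k))

/-- The reflection of the three triangles. -/
def freeSwap : Free → Free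
  | (a, b, c, d, e) => (d, e, c, a, b)

theorem freeSwap_freeSwap (k : Free) : freeSwap (freeSwap k) = k := rfl

theorem prodGram_right_right (p q : Bool) (a b : Legs) :
    prodGram (rightIdx p a) (rightIdx q b) = prodGram (leftIdx p a) (leftIdx q b) := by
  obtain ⟨a1, a2, a3, a4, a5, a6, a7⟩ := a
  obtain ⟨b1, b2, b3, b4, b5, b6, b7⟩ := b
  simp only [prodGram, leftIdx, rightIdx]
  rw [triGram_swap a3]
  ring

/-- The reflection exchanges the links as well. Orthogonality of the right family to the two-singlet
states can therefore be expressed by `bothGram` too. -/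
theorem prodGram_right_both (p q r : Bool) (a : Legs) (k : Free) :
    prodGram (rightIdx p a) (bothIdx q r k) = prodGram (leftIdx p a) (bothIdx r q (freeSwap k)) := by
  obtain ⟨a1, a2, a3, a4, a5, a6, a7⟩ := a
  obtain ⟨b1, b2, b3, b4, b5⟩ := k
  simp only [prodGram, leftIdx, rightIdx, bothIdx, freeSwap]
  rw [triGram_swap a3]
  ring

theorem inner_leftVec_leftVec (a b : Legs) :
    inner ℂ (leftVec a) (leftVec b) = (((2 / 27 : ℝ) ^ 3 * sameGram a b : ℝ) : ℂ) := by
  simp only [leftVec, inner_sub_left, inner_sub_right, inner_prodVec, sameGram]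
  push_cast
  ring

theorem inner_rightVec_rightVec (a b : Legs) :
    inner ℂ (rightVec a) (rightVec b) = (((2 / 27 : ℝ) ^ 3 * sameGram a b : ℝ) : ℂ) := by
  simp only [rightVec, inner_sub_left, inner_sub_right, inner_prodVec, sameGram,
    prodGram_right_right]
  push_cast
  ring

theorem inner_leftVec_rightVec (a b : Legs) :
    inner ℂ (leftVec a) (rightVec b) = (((2 / 27 : ℝ) ^ 3 * crossGram a b : ℝ) : ℂ) := by
  simp only [leftVec, rightVec, inner_sub_left, inner_sub_right, inner_prodVec, crossGram]
  push_cast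
  ring

theorem inner_bothVec_leftVec (k : Free) (a : Legs) :
    inner ℂ (bothVec k) (leftVec a) = (((2 / 27 : ℝ) ^ 3 * bothGram a k : ℝ) : ℂ) := by
  simp only [leftVec, bothVec, inner_sub_left, inner_sub_right, inner_prodVec, bothGram, freeGram,
    prodGram_comm (bothIdx _ _ _)]
  push_cast
  ring

theorem inner_bothVec_rightVec (k : Free) (a : Legs) :
    inner ℂ (bothVec k) (rightVec a) =
      (((2 / 27 : ℝ) ^ 3 * bothGram a (freeSwap k) : ℝ) : ℂ) := by
  simp only [rightVec, bothVec, inner_sub_left, inner_sub_right, inner_prodVec, bothGram, freeGram,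
    prodGram_comm (bothIdx _ _ _), prodGram_right_both]
  push_cast
  ring

/-- A site of a link or a triangle. -/
def chainSrc : Bool ⊕ (Fin 3 × Fin 3) → Fin 3 × Fin 3
  | Sum.inl true => (0, 0)
  | Sum.inl false => (2, 0)
  | Sum.inr v => v

/-- The other site of a link or a triangle. -/
def chainTgt : Bool ⊕ (Fin 3 × Fin 3) → Fin 3 × Fin 3
  | Sum.inl true => (1, 0)
  | Sum.inl false => (1, 1)
  | Sum.inr v => (v.1, v.2 + 1)

theorem chainSrc_ne_chainTgt : ∀ e, chainSrc e ≠ chainTgt e := by decide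

theorem chain_injective : ∀ e e', s(chainSrc e, chainTgt e) = s(chainSrc e', chainTgt e') →
    e = e' := by decide +kernel

/-- The edges of the triangles, and one of the links or both. -/
def chainEdges (L : Finset Bool) : Finset (Bool ⊕ (Fin 3 × Fin 3)) := L.disjSum Finset.univ

/-- The states of three triangles with a singlet on each of the links in `L`. -/
noncomputable def chainSpace (L : Finset Bool) :
    Submodule ℂ (EuclideanSpace ℂ (Fin 3 × Fin 3 → Fin 4)) :=
  ⨅ e ∈ chainEdges L, diagKernel (chainSrc e) (chainTgt e)

theorem mem_chainSpace {L : Finset Bool} {ψ : EuclideanSpace ℂ (Fin 3 × Fin 3 → Fin 4)} :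
    ψ ∈ chainSpace L ↔ ∀ e ∈ chainEdges L, ψ ∈ diagKernel (chainSrc e) (chainTgt e) := by
  simp only [chainSpace, Submodule.mem_iInf]

/-- The polynomial of the singlets. -/
noncomputable def chainPoly (L : Finset Bool) : MvPolynomial (Fin 3 × Fin 3) ℂ :=
  ∏ e ∈ chainEdges L, (X (chainSrc e) - X (chainTgt e))

theorem chainPoly_eq (L : Finset Bool) : chainPoly L =
    (∏ l ∈ L, (X (chainSrc (Sum.inl l)) - X (chainTgt (Sum.inl l)))) * triPoly := by
  rw [chainPoly, chainEdges, Finset.prod_disjSum]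
  rfl

theorem mem_chainSpace_of_toPoly {L : Finset Bool} {ψ : EuclideanSpace ℂ (Fin 3 × Fin 3 → Fin 4)}
    {p : MvPolynomial (Fin 3 × Fin 3) ℂ} (h : toPoly ψ = chainPoly L * p) : ψ ∈ chainSpace L := by
  rw [mem_chainSpace]
  intro e he
  rw [mem_diagKernel_iff_dvd (chainSrc_ne_chainTgt e), h]
  exact (Finset.dvd_prod_of_mem _ he).mul_right _

/-- The argument of `vbs_eq_iInf` for an explicit family: it spans as soon as it realises all
exponents that the degree bound allows. -/
theorem mem_span_of_toPoly {β : Type*} [Nonempty β] {L : Finset Bool}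
    {v : β → EuclideanSpace ℂ (Fin 3 × Fin 3 → Fin 4)} {m : β → Fin 3 × Fin 3 → ℕ}
    (hv : ∀ b, toPoly (v b) = chainPoly L * ∏ i, X i ^ m b i)
    (hm : ∀ k : Fin 3 × Fin 3 → ℕ, (∀ i, k i + ((chainEdges L).filter fun e =>
      i = chainSrc e ∨ i = chainTgt e).card ≤ 3) → ∃ b, m b = k)
    {ψ : EuclideanSpace ℂ (Fin 3 × Fin 3 → Fin 4)} (hψ : ψ ∈ chainSpace L) :
    ψ ∈ Submodule.span ℂ (Set.range v) := by
  obtain ⟨f, hf, hdeg⟩ := exists_factor chainSrc_ne_chainTgt (chainEdges L)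
    (fun e _ e' _ => chain_injective e e') ψ (mem_chainSpace.1 hψ)
  have h1 (k : Fin 3 × Fin 3 →₀ ℕ) (hk : k ∈ f.support) :
      ∃ b, toPoly (v b) = chainPoly L * monomial k 1 := by
    obtain ⟨b, hb⟩ := hm k (hdeg k hk)
    refine ⟨b, ?_⟩
    rw [hv, hb, monomial_eq, map_one, one_mul, Finsupp.prod_fintype _ _ (by simp)]
  choose! b hb using h1
  have : ψ = ∑ k ∈ f.support, coeff k f • v (b k) := by
    apply toPoly_injective
    rw [hf, map_sum]
    conv_lhs => rw [f.as_sum, Finset.mul_sum]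
    refine Finset.sum_congr rfl fun k hk => ?_
    rw [map_smul, hb k hk, smul_eq_C_mul, chainPoly, mul_left_comm, C_mul_monomial, mul_one]
  rw [this]
  exact Submodule.sum_mem _ fun m _ => Submodule.smul_mem _ _ (Submodule.subset_span ⟨_, rfl⟩)

/-- The exponents of the free legs. -/
def leftBits : Legs → Fin 3 × Fin 3 → ℕ
  | (a, b, c, d, e, f, g) => bitOf ((false, a, b), (false, c, d), (e, f, g))

/-- The exponents of the free legs. -/
def rightBits : Legs → Fin 3 × Fin 3 → ℕ
  | (a, b, c, d, e, f, g) => bitOf ((e, f, g), (c, false, d), (false, a, b))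

/-- The exponents of the free legs. -/
def bothBits : Free → Fin 3 × Fin 3 → ℕ
  | (a, b, c, d, e) => bitOf ((false, a, b), (false, false, c), (false, d, e))

/-- The two values of `p` give the two terms of the linear factor of the link. -/
theorem toPoly_leftVec (a : Legs) :
    toPoly (leftVec a) = chainPoly {true} * ∏ i, X i ^ leftBits a i := by
  obtain ⟨a1, a2, a3, a4, a5, a6, a7⟩ := a
  rw [leftVec, map_sub, toPoly_prodVec, toPoly_prodVec, chainPoly_eq, Finset.prod_singleton]
  simp only [chainSrc, chainTgt, leftBits, leftIdx, bitOf, tripleOf, triBit,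
    Fintype.prod_prod_type, Fin.prod_univ_three, Matrix.cons_val, Bool.not_true, Bool.not_false,
    Bool.toNat_true, Bool.toNat_false, pow_zero, pow_one]
  ring

theorem toPoly_rightVec (a : Legs) :
    toPoly (rightVec a) = chainPoly {false} * ∏ i, X i ^ rightBits a i := by
  obtain ⟨a1, a2, a3, a4, a5, a6, a7⟩ := a
  rw [rightVec, map_sub, toPoly_prodVec, toPoly_prodVec, chainPoly_eq, Finset.prod_singleton]
  simp only [chainSrc, chainTgt, rightBits, rightIdx, bitOf, tripleOf, triBit,
    Fintype.prod_prod_type, Fin.prod_univ_three, Matrix.cons_val, Bool.not_true, Bool.not_false,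
    Bool.toNat_true, Bool.toNat_false, pow_zero, pow_one]
  ring

theorem toPoly_bothVec (k : Free) :
    toPoly (bothVec k) = chainPoly Finset.univ * ∏ i, X i ^ bothBits k i := by
  obtain ⟨a1, a2, a3, a4, a5⟩ := k
  simp only [bothVec, map_sub, toPoly_prodVec, chainPoly_eq, Fintype.prod_bool]
  simp only [chainSrc, chainTgt, bothBits, bothIdx, bitOf, tripleOf, triBit,
    Fintype.prod_prod_type, Fin.prod_univ_three, Matrix.cons_val, Bool.not_true, Bool.not_false,
    Bool.toNat_true, Bool.toNat_false, pow_zero, pow_one]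
  ring

theorem toNat_decide_eq_one {n : ℕ} (h : n ≤ 1) : (decide (n = 1)).toNat = n := by
  interval_cases n <;> rfl

theorem chainSpace_left_le : chainSpace {true} ≤ Submodule.span ℂ (Set.range leftVec) := by
  refine fun ψ => mem_span_of_toPoly toPoly_leftVec fun k hk => ?_
  -- A linked corner has no free leg, hence exponent 0; every other corner has exactly one.
  have hdeg : ∀ i, ((chainEdges {true}).filter fun e => i = chainSrc e ∨ i = chainTgt e).card =
      if i = (0, 0) ∨ i = (1, 0) then 3 else 2 := by decide +kernel
  simp only [hdeg, Prod.forall, Fin.forall_fin_succ] at hk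
  simp at hk
  obtain ⟨⟨h1, h2, h3⟩, ⟨h4, h5, h6⟩, h7, h8, h9⟩ := hk
  refine ⟨(decide (k (0, 1) = 1), decide (k (0, 2) = 1), decide (k (1, 1) = 1),
    decide (k (1, 2) = 1), decide (k (2, 0) = 1), decide (k (2, 1) = 1), decide (k (2, 2) = 1)), ?_⟩
  funext ⟨t, i⟩
  simp only [leftBits, bitOf, tripleOf, triBit]
  fin_cases t <;> fin_cases i <;> simp [toNat_decide_eq_one, *]

theorem chainSpace_right_le : chainSpace {false} ≤ Submodule.span ℂ (Set.range rightVec) := by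
  refine fun ψ => mem_span_of_toPoly toPoly_rightVec fun k hk => ?_
  have hdeg : ∀ i, ((chainEdges {false}).filter fun e => i = chainSrc e ∨ i = chainTgt e).card =
      if i = (1, 1) ∨ i = (2, 0) then 3 else 2 := by decide +kernel
  simp only [hdeg, Prod.forall, Fin.forall_fin_succ] at hk
  simp at hk
  obtain ⟨⟨h1, h2, h3⟩, ⟨h4, h5, h6⟩, h7, h8, h9⟩ := hk
  refine ⟨(decide (k (2, 1) = 1), decide (k (2, 2) = 1), decide (k (1, 0) = 1),
    decide (k (1, 2) = 1), decide (k (0, 0) = 1), decide (k (0, 1) = 1), decide (k (0, 2) = 1)), ?_⟩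
  funext ⟨t, i⟩
  simp only [rightBits, bitOf, tripleOf, triBit]
  fin_cases t <;> fin_cases i <;> simp [toNat_decide_eq_one, *]

theorem chainSpace_both_le : chainSpace Finset.univ ≤ Submodule.span ℂ (Set.range bothVec) := by
  refine fun ψ => mem_span_of_toPoly toPoly_bothVec fun k hk => ?_
  have hdeg : ∀ i, ((chainEdges Finset.univ).filter fun e =>
      i = chainSrc e ∨ i = chainTgt e).card =
      if i = (0, 0) ∨ i = (1, 0) ∨ i = (1, 1) ∨ i = (2, 0) then 3 else 2 := by decide +kernel
  simp only [hdeg, Prod.forall, Fin.forall_fin_succ] at hk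
  simp at hk
  obtain ⟨⟨h1, h2, h3⟩, ⟨h4, h5, h6⟩, h7, h8, h9⟩ := hk
  refine ⟨(decide (k (0, 1) = 1), decide (k (0, 2) = 1), decide (k (1, 2) = 1),
    decide (k (2, 1) = 1), decide (k (2, 2) = 1)), ?_⟩
  funext ⟨t, i⟩
  simp only [bothBits, bitOf, tripleOf, triBit]
  fin_cases t <;> fin_cases i <;> simp [toNat_decide_eq_one, *]

theorem leftVec_mem (a : Legs) : leftVec a ∈ chainSpace {true} :=
  mem_chainSpace_of_toPoly (toPoly_leftVec a)

theorem rightVec_mem (a : Legs) : rightVec a ∈ chainSpace {false} :=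
  mem_chainSpace_of_toPoly (toPoly_rightVec a)

theorem bothVec_mem (k : Free) : bothVec k ∈ chainSpace Finset.univ :=
  mem_chainSpace_of_toPoly (toPoly_bothVec k)

end ChainVectors

/-! ### Two-sided bounds for the cosine. -/

section ChainAngle

theorem chainSpace_univ : chainSpace Finset.univ = chainSpace {true} ⊓ chainSpace {false} := by
  ext ψ
  rw [Submodule.mem_inf, mem_chainSpace, mem_chainSpace, mem_chainSpace]
  simp only [chainEdges, Finset.mem_disjSum, Finset.mem_univ, true_and, Finset.mem_singleton]
  constructor
  · exact fun h => ⟨fun e _ => h e (by cases e <;> simp), fun e _ => h e (by cases e <;> simp)⟩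
  · rintro ⟨h1, h2⟩ ((_ | _) | v) _
    · exact h2 _ (by simp)
    · exact h1 _ (by simp)
    · exact h1 _ (by simp)

theorem inner_sum_sum {α β ι : Type*} [Fintype α] [Fintype β] [Fintype ι]
    {v : α → EuclideanSpace ℂ ι} {w : β → EuclideanSpace ℂ ι} {c : ℝ} {q : α → β → ℤ}
    (h : ∀ a b, inner ℂ (v a) (w b) = ((c * q a b : ℝ) : ℂ)) (f : α → ℂ) (g : β → ℂ) :
    inner ℂ (∑ a, f a • v a : EuclideanSpace ℂ ι) (∑ b, g b • w b) =
      (c : ℂ) * ∑ a, ∑ b, (q a b : ℂ) * starRingEnd ℂ (f a) * g b := by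
  rw [sum_inner, Finset.mul_sum]
  simp only [inner_sum, inner_smul_left, inner_smul_right, h, Finset.mul_sum]
  refine Finset.sum_congr rfl fun a _ => Finset.sum_congr rfl fun b _ => ?_
  push_cast
  ring

/-- A real Gram matrix does not mix real and imaginary parts, so the complex bound is two copies of
the real one. -/
theorem re_inner_sum_sum {α β ι : Type*} [Fintype α] [Fintype β] [Fintype ι]
    {v : α → EuclideanSpace ℂ ι} {w : β → EuclideanSpace ℂ ι} {c : ℝ} {q : α → β → ℤ}
    (h : ∀ a b, inner ℂ (v a) (w b) = ((c * q a b : ℝ) : ℂ)) (f : α → ℂ) (g : β → ℂ) :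
    (inner ℂ (∑ a, f a • v a : EuclideanSpace ℂ ι) (∑ b, g b • w b)).re =
      c * (∑ a, ∑ b, (q a b : ℝ) * (f a).re * (g b).re +
        ∑ a, ∑ b, (q a b : ℝ) * (f a).im * (g b).im) := by
  rw [inner_sum_sum h, Complex.re_ofReal_mul]
  simp only [Complex.re_sum, ← Finset.sum_add_distrib]
  congr 1
  refine Finset.sum_congr rfl fun a _ => Finset.sum_congr rfl fun b _ => ?_
  simp

theorem exists_sum_eq_of_mem_span {α ι : Type*} [Fintype α] [Fintype ι]
    {v : α → EuclideanSpace ℂ ι} {x : EuclideanSpace ℂ ι}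
    (hx : x ∈ Submodule.span ℂ (Set.range v)) : ∃ f : α → ℂ, x = ∑ a, f a • v a := by
  obtain ⟨f, hf⟩ := (Submodule.mem_span_range_iff_exists_fun ℂ).1 hx
  exact ⟨f, hf.symm⟩

theorem sum_eq_zero_of_orthogonal {α ι : Type*} [Fintype α] [Fintype ι]
    {v : α → EuclideanSpace ℂ ι}
    {z : EuclideanSpace ℂ ι} {c : ℝ} (hc : c ≠ 0) {q : α → ℤ}
    (h : ∀ a, inner ℂ z (v a) = ((c * q a : ℝ) : ℂ)) {f : α → ℂ}
    (h0 : inner ℂ z (∑ a, f a • v a) = 0) :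
    ∑ a, (q a : ℝ) * (f a).re = 0 ∧ ∑ a, (q a : ℝ) * (f a).im = 0 := by
  have h1 : ∑ a, (q a : ℂ) * f a = 0 := by
    have : (c : ℂ) * ∑ a, (q a : ℂ) * f a = 0 := by
      rw [← h0, inner_sum, Finset.mul_sum]
      refine Finset.sum_congr rfl fun a _ => ?_
      rw [inner_smul_right, h]
      push_cast
      ring
    exact (mul_eq_zero.1 this).resolve_left (by exact_mod_cast hc)
  constructor
  · simpa using congrArg Complex.re h1
  · simpa using congrArg Complex.im h1

theorem norm_sq_eq_re_inner {ι : Type*} [Fintype ι] (u : EuclideanSpace ℂ ι) :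
    ‖u‖ ^ 2 = (inner ℂ u u).re := (inner_self_eq_norm_sq (𝕜 := ℂ) u).symm

/-- The angle bound. -/
theorem two_mul_re_inner_le {u w : EuclideanSpace ℂ (Fin 3 × Fin 3 → Fin 4)}
    (hu : u ∈ chainSpace {true}) (hw : w ∈ chainSpace {false})
    (hu' : ∀ z ∈ chainSpace Finset.univ, inner ℂ z u = 0)
    (hw' : ∀ z ∈ chainSpace Finset.univ, inner ℂ z w = 0) :
    2 * (inner ℂ u w).re ≤ 0.1110430220 * (‖u‖ ^ 2 + ‖w‖ ^ 2) := by
  obtain ⟨f, rfl⟩ := exists_sum_eq_of_mem_span (chainSpace_left_le hu)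
  obtain ⟨g, rfl⟩ := exists_sum_eq_of_mem_span (chainSpace_right_le hw)
  have hc : ((2 / 27 : ℝ) ^ 3) ≠ 0 := by norm_num
  have hu2 k := hu' (bothVec k) (bothVec_mem k)
  have hw2 k := hw' (bothVec k) (bothVec_mem k)
  have hf k := sum_eq_zero_of_orthogonal (f := f) hc
    (q := fun a => bothGram a k) (inner_bothVec_leftVec k) (hu2 k)
  have hg k := sum_eq_zero_of_orthogonal (f := g) hc
    (q := fun a => bothGram a (freeSwap k)) (inner_bothVec_rightVec k) (hw2 k)
  -- Reindexing by the reflection brings the constraints of the right family into the form that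
  -- `cross_le` expects.
  have hg' k := hg (freeSwap k)
  simp only [freeSwap_freeSwap] at hg'
  have h1 := cross_le (fun a => (f a).re) (fun a => (g a).re) (fun k => (hf k).1) fun k => (hg' k).1
  have h2 := cross_le (fun a => (f a).im) (fun a => (g a).im) (fun k => (hf k).2) fun k => (hg' k).2
  rw [norm_sq_eq_re_inner, norm_sq_eq_re_inner, re_inner_sum_sum inner_leftVec_rightVec,
    re_inner_sum_sum inner_leftVec_leftVec, re_inner_sum_sum inner_rightVec_rightVec]
  linarith

/-- The leg configurations of an approximate maximizer. -/
def testLegs : Fin 21 → Legs :=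
  ![(false, false, false, false, false, true, true),
    (false, false, false, false, true, false, true),
    (false, false, false, false, true, true, false),
    (false, false, false, true, false, false, true),
    (false, false, false, true, false, true, false),
    (false, false, false, true, true, false, false),
    (false, false, true, false, false, false, true),
    (false, false, true, false, false, true, false),
    (false, false, true, false, true, false, false),
    (false, false, true, true, false, false, false),
    (false, true, false, false, false, false, true),
    (false, true, false, false, false, true, false),
    (false, true, false, false, true, false, false),
    (false, true, false, true, false, false, false),
    (false, true, true, false, false, false, false),
    (true, false, false, false, false, false, true),
    (true, false, false, false, false, true, false),
    (true, false, false, false, true, false, false),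
    (true, false, false, true, false, false, false),
    (true, false, true, false, false, false, false),
    (true, true, false, false, false, false, false)]

/-- The coefficients of an approximate maximizer. -/
def testCoeff : Fin 21 → ℤ :=
  ![-1717986710, 3414442405, 3414442405, 103954758, 103954758, -1198694916, 1282766347,
    1282766347, -9693776894, 528244200, -1541588400, -1541588400, 2031793500, 231270600,
    3300000000, -1541588400, -1541588400, 2031793500, 231270600, 3300000000, -2479887300]

/-- The vector is supported on the `C(7,2) = 21` configurations with two ones. It maximises only
approximately, but its integer coefficients satisfy the constraints exactly, as a rigorous lower
bound requires. -/
theorem test_orthogonal : ∀ k, ∑ i, bothGram (testLegs i) k * testCoeff i = 0 := by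
  decide +kernel

theorem test_pos : 0 < ∑ i, ∑ j, sameGram (testLegs i) (testLegs j) * testCoeff i * testCoeff j := by
  decide +kernel

/-- The cross term is negative for these labels; only its absolute value matters. -/
theorem test_cross : 111043021955 *
      ∑ i, ∑ j, sameGram (testLegs i) (testLegs j) * testCoeff i * testCoeff j ≤
    -(1000000000000 *
      ∑ i, ∑ j, crossGram (testLegs i) (testLegs j) * testCoeff i * testCoeff j) := by
  decide +kernel

/-- A lower bound for the largest cosine. -/
theorem exists_test_vectors : ∃ u ∈ chainSpace {true}, ∃ w ∈ chainSpace {false},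
    (∀ z ∈ chainSpace Finset.univ, inner ℂ z u = 0) ∧
    (∀ z ∈ chainSpace Finset.univ, inner ℂ z w = 0) ∧ u ≠ 0 ∧ w ≠ 0 ∧
    0.111043021955 * (‖u‖ * ‖w‖) ≤ ‖inner ℂ u w‖ := by
  set u := ∑ i, (testCoeff i : ℂ) • leftVec (testLegs i) with hu
  set w := ∑ i, (testCoeff i : ℂ) • rightVec (testLegs i) with hw
  obtain ⟨N, hN⟩ : ∃ N : ℤ, N = ∑ i, ∑ j,
    sameGram (testLegs i) (testLegs j) * testCoeff i * testCoeff j := ⟨_, rfl⟩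
  obtain ⟨M, hM⟩ : ∃ M : ℤ, M = ∑ i, ∑ j,
    crossGram (testLegs i) (testLegs j) * testCoeff i * testCoeff j := ⟨_, rfl⟩
  have hNpos := test_pos
  have hMN := test_cross
  rw [← hN] at hNpos hMN
  rw [← hM] at hMN
  replace hNpos : (0 : ℝ) < N := by exact_mod_cast hNpos
  replace hMN : (111043021955 : ℝ) * N ≤ -(1000000000000 * M) := by exact_mod_cast hMN
  have huu : ‖u‖ ^ 2 = (2 / 27) ^ 3 * N := by
    rw [norm_sq_eq_re_inner, hu, re_inner_sum_sum
      (q := fun i j => sameGram (testLegs i) (testLegs j)) fun a b => inner_leftVec_leftVec _ _, hN]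
    push_cast
    simp only [Complex.intCast_re, Complex.intCast_im, mul_zero, Finset.sum_const_zero, add_zero]
  have hww : ‖w‖ ^ 2 = (2 / 27) ^ 3 * N := by
    rw [norm_sq_eq_re_inner, hw, re_inner_sum_sum
      (q := fun i j => sameGram (testLegs i) (testLegs j)) fun a b => inner_rightVec_rightVec _ _,
      hN]
    push_cast
    simp only [Complex.intCast_re, Complex.intCast_im, mul_zero, Finset.sum_const_zero, add_zero]
  have huw : (inner ℂ u w).re = (2 / 27) ^ 3 * M := by
    rw [hu, hw, re_inner_sum_sum
      (q := fun i j => crossGram (testLegs i) (testLegs j)) fun a b => inner_leftVec_rightVec _ _,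
      hM]
    push_cast
    simp only [Complex.intCast_re, Complex.intCast_im, mul_zero, Finset.sum_const_zero, add_zero]
  have hne : ∀ v : EuclideanSpace ℂ (Fin 3 × Fin 3 → Fin 4), ‖v‖ ^ 2 = (2 / 27) ^ 3 * (N : ℝ) →
      v ≠ 0 := by
    rintro v hv rfl
    rw [norm_zero] at hv
    have : (0 : ℝ) < (2 / 27) ^ 3 * N := by positivity
    rw [← hv] at this
    norm_num at this
  have horth (v : EuclideanSpace ℂ (Fin 3 × Fin 3 → Fin 4))
      (hv : ∀ k, inner ℂ (bothVec k) v = 0) : ∀ z ∈ chainSpace Finset.univ, inner ℂ z v = 0 := by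
    intro z hz
    obtain ⟨f, rfl⟩ := exists_sum_eq_of_mem_span (chainSpace_both_le hz)
    rw [sum_inner]
    exact Finset.sum_eq_zero fun k _ => by rw [inner_smul_left, hv, mul_zero]
  refine ⟨u, Submodule.sum_mem _ fun i _ => Submodule.smul_mem _ _ (leftVec_mem _), w,
    Submodule.sum_mem _ fun i _ => Submodule.smul_mem _ _ (rightVec_mem _),
    horth u fun k => ?_, horth w fun k => ?_, hne u huu, hne w hww, ?_⟩
  · have := congrArg (fun z : ℤ => (((2 / 27 : ℝ) ^ 3 * z : ℝ) : ℂ)) (test_orthogonal k)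
    rw [Int.cast_zero, mul_zero, Complex.ofReal_zero] at this
    rw [← this, hu, inner_sum]
    simp only [inner_smul_right, inner_bothVec_leftVec]
    push_cast
    rw [Finset.mul_sum]
    exact Finset.sum_congr rfl fun i _ => by ring
  · have := congrArg (fun z : ℤ => (((2 / 27 : ℝ) ^ 3 * z : ℝ) : ℂ)) (test_orthogonal (freeSwap k))
    rw [Int.cast_zero, mul_zero, Complex.ofReal_zero] at this
    rw [← this, hw, inner_sum]
    simp only [inner_smul_right, inner_bothVec_rightVec]
    push_cast
    rw [Finset.mul_sum]
    exact Finset.sum_congr rfl fun i _ => by ring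
  · have h1 : ‖u‖ = ‖w‖ := by
      have := huu.trans hww.symm
      nlinarith [norm_nonneg u, norm_nonneg w]
    have h2 := (abs_le.1 (Complex.abs_re_le_norm (inner ℂ u w))).1
    rw [huw] at h2
    rw [← h1, ← pow_two, huu]
    linarith

/-- The largest cosine for three triangles in a row. -/
theorem exists_chain_angle : ∃ η : ℝ, 0.111043021955 ≤ η ∧ η ≤ 0.1110430220 ∧
    (∀ u ∈ chainSpace {true}, ∀ w ∈ chainSpace {false},
      (∀ z ∈ chainSpace Finset.univ, inner ℂ z u = 0) →
      (∀ z ∈ chainSpace Finset.univ, inner ℂ z w = 0) → ‖inner ℂ u w‖ ≤ η * ‖u‖ * ‖w‖) ∧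
    ∃ u ∈ chainSpace {true}, ∃ w ∈ chainSpace {false},
      (∀ z ∈ chainSpace Finset.univ, inner ℂ z u = 0) ∧
      (∀ z ∈ chainSpace Finset.univ, inner ℂ z w = 0) ∧ ‖u‖ = 1 ∧ ‖w‖ = 1 ∧
      inner ℂ u w = (η : ℂ) := by
  obtain ⟨u, hu, w, hw, hu', hw', hu0, hw0, huw⟩ := exists_test_vectors
  have hu2 : u ∈ chainSpace {true} ⊓ (chainSpace Finset.univ)ᗮ :=
    ⟨hu, (Submodule.mem_orthogonal _ _).2 hu'⟩
  have hw2 : w ∈ chainSpace {false} ⊓ (chainSpace Finset.univ)ᗮ :=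
    ⟨hw, (Submodule.mem_orthogonal _ _).2 hw'⟩
  -- The exact cosine is a maximum over the parts orthogonal to the common states. The test vectors
  -- bound it from below, and `two_mul_re_inner_le` at the maximising unit vectors from above.
  obtain ⟨η, hη, a, ha, b, hb, ha1, hb1, hab⟩ := exists_max_inner _ _
    ((Submodule.ne_bot_iff _).2 ⟨u, hu2, hu0⟩) ((Submodule.ne_bot_iff _).2 ⟨w, hw2, hw0⟩)
  have ha' := (Submodule.mem_orthogonal _ _).1 ha.2
  have hb' := (Submodule.mem_orthogonal _ _).1 hb.2
  refine ⟨η, ?_, ?_, fun u hu w hw hu' hw' => hη u ⟨hu, (Submodule.mem_orthogonal _ _).2 hu'⟩ w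
    ⟨hw, (Submodule.mem_orthogonal _ _).2 hw'⟩, a, ha.1, b, hb.1, ha', hb', ha1, hb1, hab⟩
  · have h1 := huw.trans (hη u hu2 w hw2)
    rw [mul_assoc η] at h1
    exact le_of_mul_le_mul_right h1 (mul_pos (norm_pos_iff.2 hu0) (norm_pos_iff.2 hw0))
  · have h1 := two_mul_re_inner_le ha.1 hb.1 ha' hb'
    rw [hab, Complex.ofReal_re, ha1, hb1] at h1
    linarith

end ChainAngle

end AKLT

namespace AKLT

open Matrix Function

/-! ### Transport of the angle along relabellings of sites. -/

section Transport

/-- `η` is the largest cosine of the angle between vectors of `U` and `U'` that are orthogonal to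
the intersection of the two subspaces. -/
def IsAngle {n : Type} [Fintype n] (U U' : Submodule ℂ (EuclideanSpace ℂ n)) (η : ℝ) : Prop :=
  (∀ u ∈ U, ∀ w ∈ U', (∀ z ∈ U ⊓ U', inner ℂ z u = 0) → (∀ z ∈ U ⊓ U', inner ℂ z w = 0) →
    ‖inner ℂ u w‖ ≤ η * ‖u‖ * ‖w‖) ∧
  ∃ u ∈ U, ∃ w ∈ U', (∀ z ∈ U ⊓ U', inner ℂ z u = 0) ∧ (∀ z ∈ U ⊓ U', inner ℂ z w = 0) ∧
    ‖u‖ = 1 ∧ ‖w‖ = 1 ∧ inner ℂ u w = (η : ℂ)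

theorem IsAngle.map {n n' : Type} [Fintype n] [Fintype n']
    {U U' : Submodule ℂ (EuclideanSpace ℂ n)} {η : ℝ} (h : IsAngle U U' η)
    (T : EuclideanSpace ℂ n ≃ₗᵢ[ℂ] EuclideanSpace ℂ n')
    {V V' : Submodule ℂ (EuclideanSpace ℂ n')} (hV : ∀ x, T x ∈ V ↔ x ∈ U)
    (hV' : ∀ x, T x ∈ V' ↔ x ∈ U') : IsAngle V V' η := by
  have key (x : EuclideanSpace ℂ n) : (∀ z ∈ V ⊓ V', inner ℂ z (T x) = 0) ↔
      ∀ z ∈ U ⊓ U', inner ℂ z x = 0 := by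
    rw [T.surjective.forall]
    simp only [Submodule.mem_inf, hV, hV', LinearIsometryEquiv.inner_map_map]
  obtain ⟨h1, u, hu, w, hw, hu', hw', hu1, hw1, huw⟩ := h
  refine ⟨?_, T u, (hV u).2 hu, T w, (hV' w).2 hw, (key u).2 hu', (key w).2 hw', ?_, ?_, ?_⟩
  · rw [T.surjective.forall]
    intro x hx
    rw [T.surjective.forall]
    intro y hy hx' hy'
    rw [LinearIsometryEquiv.inner_map_map, LinearIsometryEquiv.norm_map,
      LinearIsometryEquiv.norm_map]
    exact h1 x ((hV x).1 hx) y ((hV' y).1 hy) ((key x).1 hx') ((key y).1 hy')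
  · rw [LinearIsometryEquiv.norm_map, hu1]
  · rw [LinearIsometryEquiv.norm_map, hw1]
  · rw [LinearIsometryEquiv.inner_map_map, huw]

variable {κ ι : Type} [Fintype κ] [DecidableEq κ] [Fintype ι] [DecidableEq ι]

/-- The relabelling of the sites. -/
noncomputable def relabel (f : κ ≃ ι) :
    EuclideanSpace ℂ (κ → Fin 4) ≃ₗᵢ[ℂ] EuclideanSpace ℂ (ι → Fin 4) :=
  LinearIsometryEquiv.piLpCongrLeft 2 ℂ ℂ (Equiv.arrowCongr f (Equiv.refl _))

theorem relabel_apply (f : κ ≃ ι) (ψ : EuclideanSpace ℂ (κ → Fin 4)) (σ : ι → Fin 4) :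
    relabel f ψ σ = ψ (σ ∘ f) := rfl

theorem relabel_mem_diagKernel (f : κ ≃ ι) (u v : κ) (ψ : EuclideanSpace ℂ (κ → Fin 4)) :
    relabel f ψ ∈ diagKernel (f u) (f v) ↔ ψ ∈ diagKernel u v := by
  have key (σ : ι → Fin 4) (M : ℕ) :
      diagSum (f u) (f v) (relabel f ψ) σ M = diagSum u v ψ (σ ∘ f) M := by
    unfold diagSum
    refine Finset.sum_congr rfl fun p _ => ?_
    rw [relabel_apply, update_comp_eq_of_injective _ f.injective,
      update_comp_eq_of_injective _ f.injective]
  rw [mem_diagKernel, mem_diagKernel]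
  simp only [key]
  constructor
  · intro h σ M
    have := h (σ ∘ f.symm) M
    rwa [comp_assoc, f.symm_comp_self, comp_id] at this
  · exact fun h σ M => h _ _

/-- The angle for three triangles in a row, in terms of the labels of the sites. -/
theorem IsAngle.relabel {η : ℝ} (h : IsAngle (chainSpace {true}) (chainSpace {false}) η)
    (f : Fin 3 × Fin 3 ≃ ι) {V V' : Submodule ℂ (EuclideanSpace ℂ (ι → Fin 4))}
    (hV : ∀ x, x ∈ V ↔ ∀ e ∈ chainEdges {true}, x ∈ diagKernel (f (chainSrc e)) (f (chainTgt e)))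
    (hV' : ∀ x, x ∈ V' ↔
      ∀ e ∈ chainEdges {false}, x ∈ diagKernel (f (chainSrc e)) (f (chainTgt e))) :
    IsAngle V V' η := by
  refine h.map (AKLT.relabel f) (fun x => ?_) fun x => ?_
  · rw [hV, mem_chainSpace]
    simp only [relabel_mem_diagKernel]
  · rw [hV', mem_chainSpace]
    simp only [relabel_mem_diagKernel]

end Transport

/-! ### Reduction of the angle to smaller subspaces. -/

section Reducing

variable {n : Type} [Fintype n] [DecidableEq n]

/-- The angle may be computed in a subspace that reduces both projections. -/
theorem FriedrichsAngle.of_reducing {E F P Q : Matrix n n ℂ} {η : ℝ}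
    (hE : E.IsHermitian) (hEE : E * E = E) (hF : F.IsHermitian) (hFF : F * F = F)
    (hP : P.IsHermitian) (hPP : P * P = P) (hQ : Q.IsHermitian) (hQQ : Q * Q = Q)
    (hEP : ∀ x, toEuclideanLin E x = x → toEuclideanLin P x = x)
    (hFQ : ∀ x, toEuclideanLin F x = x → toEuclideanLin Q x = x)
    (hEQ : E * Q = Q * E) (hFP : F * P = P * F) {U U' : Submodule ℂ (EuclideanSpace ℂ n)}
    (hU : ∀ x, x ∈ U ↔ toEuclideanLin E x = x ∧ toEuclideanLin Q x = x)
    (hU' : ∀ x, x ∈ U' ↔ toEuclideanLin F x = x ∧ toEuclideanLin P x = x)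
    (h : IsAngle U U' η) : FriedrichsAngle E F η := by
  have hinf (z : EuclideanSpace ℂ n) :
      z ∈ U ⊓ U' ↔ toEuclideanLin E z = z ∧ toEuclideanLin F z = z := by
    rw [Submodule.mem_inf, hU, hU']
    exact ⟨fun h => ⟨h.1.1, h.2.1⟩, fun h => ⟨⟨h.1, hFQ z h.2⟩, h.2, hEP z h.1⟩⟩
  have hgen (x : EuclideanSpace ℂ n) :
      Generic E F x ↔ ∀ z ∈ U ⊓ U', inner ℂ z x = 0 := by
    simp only [hinf, and_imp, Generic]
  have hnorm {P : Matrix n n ℂ} (hP : P.IsHermitian) (hPP : P * P = P)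
      (x : EuclideanSpace ℂ n) : ‖toEuclideanLin P x‖ ≤ ‖x‖ := by
    have h1 : ‖toEuclideanLin P x‖ ^ 2 ≤ ‖toEuclideanLin P x‖ * ‖x‖ := by
      rw [← re_inner_self_nonneg_of_proj hP hPP]
      exact re_inner_le_norm _ _
    by_contra! hlt
    nlinarith [norm_nonneg x]
  obtain ⟨h1, u, hu, w, hw, hu', hw', hu1, hw1, huw⟩ := h
  have hη : 0 ≤ η := by
    have := h1 u hu w hw hu' hw'
    rw [huw, hu1, hw1, mul_one, mul_one] at this
    exact (norm_nonneg _).trans this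
  refine ⟨hE, hEE, hF, hFF, fun u w hu hw hu' hw' => ?_, u, w, ((hU u).1 hu).1, ((hU' w).1 hw).1,
    (hgen u).2 hu', (hgen w).2 hw', hu1, hw1, huw⟩
  have hQu : toEuclideanLin Q u ∈ U := (hU _).2
    ⟨by rw [← toEuclideanLin_mul, hEQ, toEuclideanLin_mul, hu], by rw [← toEuclideanLin_mul, hQQ]⟩
  have hPw : toEuclideanLin P w ∈ U' := (hU' _).2
    ⟨by rw [← toEuclideanLin_mul, hFP, toEuclideanLin_mul, hw], by rw [← toEuclideanLin_mul, hPP]⟩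
  -- `Q u` stays in the range of `E`, hence is fixed by `P`; and `w` is fixed by `Q`. So `P` and `Q`
  -- can be inserted without changing the inner product, and they do not increase norms.
  have e : inner ℂ u w = inner ℂ (toEuclideanLin Q u) (toEuclideanLin P w) := by
    rw [← inner_toEuclideanLin hP, hEP _ ((hU _).1 hQu).1, inner_toEuclideanLin hQ, hFQ w hw]
  rw [e]
  refine (h1 _ hQu _ hPw (fun z hz => ?_) fun z hz => ?_).trans ?_
  · obtain ⟨hz1, hz2⟩ := (hinf z).1 hz
    rw [← inner_toEuclideanLin hQ, hFQ z hz2, hu' z hz1 hz2]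
  · obtain ⟨hz1, hz2⟩ := (hinf z).1 hz
    rw [← inner_toEuclideanLin hP, hEP z hz1, hw' z hz1 hz2]
  · have := hnorm hQ hQQ u
    have := hnorm hP hPP w
    gcongr

end Reducing

/-! ### Local operators on product states. -/

section ProductStates

variable {κ ι : Type} [Fintype κ] [DecidableEq κ] [Fintype ι] [DecidableEq ι]

theorem locOp_apply_mul {j : κ → ι} (hj : Injective j) (M : Matrix (κ → Fin 4) (κ → Fin 4) ℂ)
    {ψ : EuclideanSpace ℂ (ι → Fin 4)} {x : EuclideanSpace ℂ (κ → Fin 4)} {r : (ι → Fin 4) → ℂ}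
    (hψ : ∀ σ, ψ σ = x (σ ∘ j) * r σ) (hr : ∀ τ σ, r (extend j τ σ) = r σ) (σ : ι → Fin 4) :
    toEuclideanLin (locOp j M) ψ σ = toEuclideanLin M x (σ ∘ j) * r σ := by
  have : slice j ψ σ = r σ • x := by
    ext τ
    simp only [slice, hψ, hr, extend_comp_self hj, PiLp.smul_apply, smul_eq_mul, mul_comm]
  rw [locOp_apply hj, this, map_smul, PiLp.smul_apply, smul_eq_mul, mul_comm]

end ProductStates

/-! ### Conditions on vertices of the graph, leg counts and tensor products. -/

section Regions

variable {V E : Type} [DecidableEq V] [DecidableEq E] {G : CubicGraph V E}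

/-- `diagKernel` for vertices of the graph. -/
noncomputable def siteKernel (B : Region G) (p q : V) : Submodule ℂ B.Phys :=
  -- If `p` or `q` is outside the region, this is the whole space.
  ⨅ (hp : p ∈ B.verts) (hq : q ∈ B.verts), diagKernel (⟨p, hp⟩ : B.verts) (⟨q, hq⟩ : B.verts)

theorem siteKernel_coe {B : Region G} (u v : B.verts) : siteKernel B u.1 v.1 = diagKernel u v := by
  rw [siteKernel, iInf_pos u.2, iInf_pos v.2]

theorem siteKernel_comm {B : Region G} {p q : V} (h : p ≠ q) :
    siteKernel B p q = siteKernel B q p := by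
  rw [siteKernel, iInf_comm, siteKernel]
  refine iInf_congr fun hq => iInf_congr fun hp => diagKernel_comm ?_
  exact fun h' => h (congrArg Subtype.val h')

theorem vbsProj_eq_self_iff_siteKernel (hG : IsSimple G) {A B : Region G}
    (h : A.verts ⊆ B.verts) (ψ : B.Phys) : toEuclideanLin (Region.vbsProj h) ψ = ψ ↔
      ∀ e ∈ A.edges, ψ ∈ siteKernel B (G.src e) (G.tgt e) := by
  rw [vbsProj_eq_self_iff hG]
  simp only [← siteKernel_coe, Subtype.forall]
  rfl

theorem mem_vbs_iff (hG : IsSimple G) (A : Region G) (ψ : A.Phys) :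
    ψ ∈ A.vbs ↔ ∀ e ∈ A.edges, ψ ∈ siteKernel A (G.src e) (G.tgt e) := by
  rw [vbs_eq_iInf hG, Submodule.mem_iInf]
  simp only [← siteKernel_coe, Subtype.forall]
  rfl

theorem vbsProj_commute {A A' B : Region G} (h : A.verts ⊆ B.verts) (h' : A'.verts ⊆ B.verts)
    (hd : Disjoint A.verts A'.verts) :
    Region.vbsProj h * Region.vbsProj h' = Region.vbsProj h' * Region.vbsProj h := by
  simp only [Region.vbsProj, extend_eq_locOp]
  refine locOp_commute (incl_injective h) (incl_injective h') (fun v w hvw => ?_) _ _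
  have : v.1 = w.1 := congrArg (fun x : B.verts => x.1) hvw
  exact Finset.disjoint_left.1 hd v.2 (this ▸ w.2)

/-- The numbers of free legs, edges and vertices. -/
theorem card_freeLegs (A : Region G) : A.freeLegs.card + 2 * A.edges.card = 3 * A.verts.card := by
  have h1 : ∑ v : A.verts, ((Finset.univ.filter fun e => v = src A e ∨ v = tgt A e).card +
      (G.inc v.1 \ A.edges).card) = 3 * A.verts.card := by
    rw [Finset.sum_congr rfl fun v _ => card_edges_at A v]
    simp [mul_comm]
  have h2 : ∑ v : A.verts, (G.inc v.1 \ A.edges).card = A.freeLegs.card := by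
    rw [Region.freeLegs, Finset.card_sigma, ← Finset.sum_coe_sort A.verts]
  have h3 : ∑ v : A.verts, (Finset.univ.filter fun e => v = src A e ∨ v = tgt A e).card =
      2 * A.edges.card := by
    simp only [Finset.card_filter]
    rw [Finset.sum_comm]
    have (e : A.edges) : (∑ v, if v = src A e ∨ v = tgt A e then 1 else 0) = 2 := by
      rw [← Finset.card_filter]
      have : (Finset.univ.filter fun v => v = src A e ∨ v = tgt A e) = {src A e, tgt A e} := by
        ext v; simp
      rw [this, Finset.card_pair (src_ne_tgt A e)]
    rw [Finset.sum_congr rfl fun e _ => this e]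
    simp [mul_comm]
  rw [Finset.sum_add_distrib, h2, h3] at h1
  omega

theorem legVert_injective (A : Region G) (h : ∀ v ∈ A.verts, (G.inc v \ A.edges).card ≤ 1) :
    Injective (legVert A) := by
  rintro ⟨⟨v, e⟩, hl⟩ ⟨⟨v', e'⟩, hl'⟩ hv
  obtain rfl : v = v' := congrArg Subtype.val hv
  have h1 := Finset.mem_sigma.1 hl
  have h2 := Finset.mem_sigma.1 hl'
  obtain rfl : e = e' := Finset.card_le_one.1 (h v h1.1) e h1.2 e' h2.2
  rfl

/-- The tensor product of three spaces of valence bond states is cut out by the edges. -/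
theorem mem_vbsTensor_iff {A₁ A₂ A₃ B : Region G} (h₁ : A₁.verts ⊆ B.verts)
    (h₂ : A₂.verts ⊆ B.verts) (h₃ : A₃.verts ⊆ B.verts) (h12 : Disjoint A₁.verts A₂.verts)
    (h13 : Disjoint A₁.verts A₃.verts) (h23 : Disjoint A₂.verts A₃.verts)
    (hcover : B.verts ⊆ A₁.verts ∪ A₂.verts ∪ A₃.verts) (ψ : B.Phys) :
    ψ ∈ Region.vbsTensor h₁ h₂ h₃ ↔ toEuclideanLin (Region.vbsProj h₁) ψ = ψ ∧
      toEuclideanLin (Region.vbsProj h₂) ψ = ψ ∧ toEuclideanLin (Region.vbsProj h₃) ψ = ψ := by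
  have hres {A A' : Region G} (h : A.verts ⊆ B.verts) (h' : A'.verts ⊆ B.verts)
      (hd : Disjoint A.verts A'.verts) (τ : A.Config) (σ : B.Config) :
      extend (incl h) τ σ ∘ incl h' = σ ∘ incl h' := by
    funext v
    refine extend_of_notMem _ _ ((notMem_range_incl h _).2 fun hv => ?_)
    exact Finset.disjoint_left.1 hd hv v.2
  have hprod (M₁ : Matrix A₁.Config A₁.Config ℂ) (M₂ : Matrix A₂.Config A₂.Config ℂ)
      (M₃ : Matrix A₃.Config A₃.Config ℂ) (a : A₁.Phys) (b : A₂.Phys) (c : A₃.Phys) (φ : B.Phys)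
      (hφ : ∀ σ : B.Config, φ σ = a (σ ∘ incl h₁) * b (σ ∘ incl h₂) * c (σ ∘ incl h₃)) :
      (∀ σ, toEuclideanLin (locOp (incl h₁) M₁) φ σ =
        toEuclideanLin M₁ a (σ ∘ incl h₁) * b (σ ∘ incl h₂) * c (σ ∘ incl h₃)) ∧
      (∀ σ, toEuclideanLin (locOp (incl h₂) M₂) φ σ =
        a (σ ∘ incl h₁) * toEuclideanLin M₂ b (σ ∘ incl h₂) * c (σ ∘ incl h₃)) ∧
      (∀ σ, toEuclideanLin (locOp (incl h₃) M₃) φ σ =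
        a (σ ∘ incl h₁) * b (σ ∘ incl h₂) * toEuclideanLin M₃ c (σ ∘ incl h₃)) := by
    refine ⟨fun σ => ?_, fun σ => ?_, fun σ => ?_⟩
    · rw [locOp_apply_mul (incl_injective h₁) M₁ (x := a)
        (r := fun σ => b (σ ∘ incl h₂) * c (σ ∘ incl h₃)) (fun σ => by rw [hφ]; ring)
        (fun τ σ => by rw [hres h₁ h₂ h12, hres h₁ h₃ h13])]
      ring
    · rw [locOp_apply_mul (incl_injective h₂) M₂ (x := b)
        (r := fun σ => a (σ ∘ incl h₁) * c (σ ∘ incl h₃)) (fun σ => by rw [hφ]; ring)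
        (fun τ σ => by rw [hres h₂ h₁ h12.symm, hres h₂ h₃ h23])]
      ring
    · rw [locOp_apply_mul (incl_injective h₃) M₃ (x := c)
        (r := fun σ => a (σ ∘ incl h₁) * b (σ ∘ incl h₂)) (fun σ => by rw [hφ]; ring)
        (fun τ σ => by rw [hres h₃ h₁ h13.symm, hres h₃ h₂ h23.symm])]
      ring
  simp only [Region.vbsProj, extend_eq_locOp]
  constructor
  · intro h
    refine Submodule.span_induction ?_ ?_ ?_ ?_ h
    · rintro φ ⟨a, ha, b, hb, c, hc, hφ⟩
      obtain ⟨h1, h2, h3⟩ := hprod (orthProj A₁.vbs) (orthProj A₂.vbs) (orthProj A₃.vbs) a b c φ hφ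
      rw [(orthProj_eq_self_iff _ _).2 ha] at h1
      rw [(orthProj_eq_self_iff _ _).2 hb] at h2
      rw [(orthProj_eq_self_iff _ _).2 hc] at h3
      exact ⟨by ext σ; rw [h1, hφ]; rfl, by ext σ; rw [h2, hφ]; rfl, by ext σ; rw [h3, hφ]; rfl⟩
    · simp
    · rintro x y _ _ ⟨h1, h2, h3⟩ ⟨h1', h2', h3'⟩
      simp only [map_add, h1, h2, h3, h1', h2', h3', and_self]
    · rintro c x _ ⟨h1, h2, h3⟩
      simp only [map_smul, h1, h2, h3, and_self]
  · rintro ⟨h1, h2, h3⟩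
    rw [← h1, ← h2, ← h3]
    -- A vector fixed by the three projections is its own image under them. On a basis state, which
    -- is a product, they act factor by factor and give a product of valence bond states.
    have hsum : ψ = ∑ ρ : B.Config, ψ ρ • EuclideanSpace.single ρ (1 : ℂ) := by
      ext σ
      simp [Pi.single_apply]
    rw [hsum]
    simp only [map_sum, map_smul]
    refine Submodule.sum_mem _ fun ρ _ => Submodule.smul_mem _ _ (Submodule.subset_span ?_)
    have hδ : ∀ σ : B.Config, (EuclideanSpace.single ρ (1 : ℂ) : B.Phys) σ =
        (EuclideanSpace.single (ρ ∘ incl h₁) (1 : ℂ) : A₁.Phys) (σ ∘ incl h₁) *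
        (EuclideanSpace.single (ρ ∘ incl h₂) (1 : ℂ) : A₂.Phys) (σ ∘ incl h₂) *
        (EuclideanSpace.single (ρ ∘ incl h₃) (1 : ℂ) : A₃.Phys) (σ ∘ incl h₃) := by
      intro σ
      simp only [PiLp.single_apply]
      by_cases hσ : σ = ρ
      · subst hσ; simp
      · rw [if_neg hσ]
        obtain ⟨v, hv⟩ := Function.ne_iff.1 hσ
        have hv' := hcover v.2
        rw [Finset.mem_union, Finset.mem_union] at hv'
        rcases hv' with (hv' | hv') | hv'
        · have : σ ∘ incl h₁ ≠ ρ ∘ incl h₁ := fun h => hv (congrFun h ⟨v.1, hv'⟩)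
          simp only [if_neg this, zero_mul]
        · have : σ ∘ incl h₂ ≠ ρ ∘ incl h₂ := fun h => hv (congrFun h ⟨v.1, hv'⟩)
          simp only [if_neg this, zero_mul, mul_zero]
        · have : σ ∘ incl h₃ ≠ ρ ∘ incl h₃ := fun h => hv (congrFun h ⟨v.1, hv'⟩)
          simp only [if_neg this, mul_zero]
    have s3 := (hprod (orthProj A₁.vbs) (orthProj A₂.vbs) (orthProj A₃.vbs) _ _ _ _ hδ).2.2
    have s2 := (hprod (orthProj A₁.vbs) (orthProj A₂.vbs) (orthProj A₃.vbs) _ _ _ _ s3).2.1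
    have s1 := (hprod (orthProj A₁.vbs) (orthProj A₂.vbs) (orthProj A₃.vbs) _ _ _ _ s2).1
    have hmem {A : Region G} (x : A.Phys) : toEuclideanLin (orthProj A.vbs) x ∈ A.vbs := by
      rw [← orthProj_eq_self_iff, ← toEuclideanLin_mul, orthProj_mul_self]
    exact ⟨_, hmem _, _, hmem _, _, hmem _, s1⟩

end Regions

end AKLT

namespace AKLT

open Matrix Function Star

/-! ### Geometry of the star lattice. -/

section Lattice

variable {m n : ℕ}

/-- A bond ends at the corners that carry its own label, so even two bonds between the same
triangles have different ends. No condition on the periods is needed. -/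
theorem lattice_isSimple (m n : ℕ) : IsSimple (lattice m n) := by
  have hk : ∀ k l : Fin 3, k = l + 1 → k + 1 = l → False := by decide
  rintro (⟨c, s, k⟩ | ⟨c, k⟩) (⟨c', s', k'⟩ | ⟨c', k'⟩) h <;>
    rw [Sym2.eq_iff] at h <;> simp only [lattice, Prod.mk.injEq] at h
  · rcases h with ⟨⟨rfl, rfl, rfl⟩, -⟩ | ⟨⟨-, -, h1⟩, -, -, h2⟩
    · rfl
    · exact (hk _ _ h1 h2).elim
  · rcases h with ⟨⟨-, rfl, -⟩, -, h, -⟩ | ⟨⟨-, rfl, -⟩, -, h, -⟩ <;> exact absurd h (by simp)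
  · rcases h with ⟨⟨-, rfl, -⟩, -, h, -⟩ | ⟨⟨-, h, -⟩, -, rfl, -⟩ <;> exact absurd h (by simp)
  · rcases h with ⟨⟨rfl, -, rfl⟩, -⟩ | ⟨⟨-, h, -⟩, -⟩
    · rfl
    · exact absurd h (by simp)

/-- The cells of the two triangles that a bond joins. -/
def cellEnd (b : Bond m n) (s : Bool) : Cell m n := if s then b.1 + shift m n b.2 else b.1

theorem mem_triVerts {c : Cell m n} {s : Bool} {v : Site m n} :
    v ∈ triVerts c s ↔ v.1 = c ∧ v.2.1 = s := by
  obtain ⟨c', s', k⟩ := v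
  simp only [triVerts, Finset.mem_image, Finset.mem_univ, true_and, Prod.mk.injEq]
  exact ⟨fun ⟨_, h⟩ => ⟨h.1.symm, h.2.1.symm⟩, fun h => ⟨k, h.1.symm, h.2.symm, rfl⟩⟩

theorem inl_mem_triEdges {c : Cell m n} {s : Bool} {v : Site m n} :
    Sum.inl v ∈ triEdges c s ↔ v.1 = c ∧ v.2.1 = s := by
  obtain ⟨c', s', k⟩ := v
  simp only [triEdges, Finset.mem_image, Finset.mem_univ, true_and, Sum.inl.injEq, Prod.mk.injEq]
  exact ⟨fun ⟨_, h⟩ => ⟨h.1.symm, h.2.1.symm⟩, fun h => ⟨k, h.1.symm, h.2.symm, rfl⟩⟩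

theorem inr_notMem_triEdges {c : Cell m n} {s : Bool} {b : Bond m n} :
    Sum.inr b ∉ triEdges c s := by
  simp [triEdges]

theorem card_triVerts (c : Cell m n) (s : Bool) : (triVerts c s).card = 3 := by
  rw [triVerts, Finset.card_image_of_injective _ fun k l h => by simpa using h]
  rfl

theorem card_triEdges (c : Cell m n) (s : Bool) : (triEdges c s).card = 3 := by
  rw [triEdges, Finset.card_image_of_injective _ fun k l h => by simpa using h]
  rfl

theorem mem_term_verts {b : Bond m n} {v : Site m n} :
    v ∈ (term b).verts ↔ v.1 = cellEnd b v.2.1 := by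
  obtain ⟨c, s, k⟩ := v
  rw [term, Finset.mem_union, mem_triVerts, mem_triVerts]
  cases s <;> simp [cellEnd]

theorem inl_mem_term_edges {b : Bond m n} {v : Site m n} :
    Sum.inl v ∈ (term b).edges ↔ v.1 = cellEnd b v.2.1 := by
  obtain ⟨c, s, k⟩ := v
  rw [term, Finset.mem_insert, Finset.mem_union, inl_mem_triEdges, inl_mem_triEdges]
  cases s <;> simp [cellEnd]

theorem inr_mem_term_edges {b b' : Bond m n} : Sum.inr b' ∈ (term b).edges ↔ b' = b := by
  rw [term, Finset.mem_insert, Finset.mem_union]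
  simp [inr_notMem_triEdges]

theorem card_term_verts (b : Bond m n) : (term b).verts.card = 6 := by
  rw [term, Finset.card_union_of_disjoint, card_triVerts, card_triVerts]
  rw [Finset.disjoint_left]
  intro v hv hv'
  rw [mem_triVerts] at hv hv'
  exact absurd (hv.2.symm.trans hv'.2) (by simp)

theorem card_term_edges (b : Bond m n) : (term b).edges.card = 7 := by
  rw [term, Finset.card_insert_of_notMem (by simp [inr_notMem_triEdges]),
    Finset.card_union_of_disjoint, card_triEdges, card_triEdges]
  rw [Finset.disjoint_left]
  rintro (v | b) hv hv'
  · rw [inl_mem_triEdges] at hv hv'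
    exact absurd (hv.2.symm.trans hv'.2) (by simp)
  · exact inr_notMem_triEdges hv

/-- A triangular plaquette. -/
def triRegion (c : Cell m n) (s : Bool) : Region (lattice m n) where
  verts := triVerts c s
  edges := triEdges c s
  src_mem := by
    rintro (⟨c', s', k⟩ | b) h
    · rw [inl_mem_triEdges] at h
      exact mem_triVerts.2 h
    · exact (inr_notMem_triEdges h).elim
  tgt_mem := by
    rintro (⟨c', s', k⟩ | b) h
    · rw [inl_mem_triEdges] at h
      exact mem_triVerts.2 h
    · exact (inr_notMem_triEdges h).elim

/-- The hypotheses say that `1 ≠ 0` in both factors, the infinite case `ZMod 0 = ℤ` included. -/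
theorem shift_injective (hm : m ≠ 1) (hn : n ≠ 1) : Injective (shift m n) := by
  have h1 : (1 : ZMod m) ≠ 0 := by
    intro h
    have := (ZMod.natCast_eq_zero_iff 1 m).1 (by exact_mod_cast h)
    exact hm (Nat.dvd_one.1 this)
  have h2 : (1 : ZMod n) ≠ 0 := by
    intro h
    have := (ZMod.natCast_eq_zero_iff 1 n).1 (by exact_mod_cast h)
    exact hn (Nat.dvd_one.1 this)
  intro k l h
  fin_cases k <;> fin_cases l <;> simp_all [shift, eq_comm]

theorem eq_of_cellEnd_eq {i j : Bond m n} {s : Bool} (hs : cellEnd i s = cellEnd j s)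
    (hk : i.2 = j.2) : i = j := by
  obtain ⟨c, k⟩ := i
  obtain ⟨c', k'⟩ := j
  obtain rfl : k = k' := hk
  cases s <;> simp_all [cellEnd]

/-- Terms with a common vertex share a whole triangle, and a bond is determined by a triangle and
its label there. -/
theorem overlap_iff {i j : Bond m n} :
    Overlap i j ↔ i.2 ≠ j.2 ∧ ∃ s, cellEnd i s = cellEnd j s := by
  rw [Overlap, Finset.not_disjoint_iff]
  simp only [mem_term_verts]
  constructor
  · rintro ⟨hne, v, h1, h2⟩
    have hs := h1.symm.trans h2
    exact ⟨fun hk => hne (eq_of_cellEnd_eq hs hk).symm, _, hs⟩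
  · rintro ⟨hk, s, hs⟩
    exact ⟨fun h => hk (by rw [h]), (cellEnd i s, s, 0), rfl, hs⟩

/-- Two bonds between the same pair of triangles would have equal shifts. The exclusion of period 1
thus makes overlapping terms share exactly one triangle. -/
theorem cellEnd_not_ne (hm : m ≠ 1) (hn : n ≠ 1) {i j : Bond m n} {s : Bool} (hk : i.2 ≠ j.2)
    (hs : cellEnd i s = cellEnd j s) : cellEnd i (!s) ≠ cellEnd j (!s) := by
  intro h
  refine hk (shift_injective hm hn ?_)
  cases s <;> simp only [cellEnd, Bool.not_true, Bool.not_false, if_true, if_false,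
    Bool.false_eq_true] at hs h
  · rwa [hs, add_right_inj] at h
  · rwa [h, add_right_inj] at hs

/-- The bond at a corner of a triangle. -/
def bondAt (s : Bool) (c : Cell m n) (k : Fin 3) : Bond m n :=
  (if s then c - shift m n k else c, k)

theorem cellEnd_bondAt (s : Bool) (c : Cell m n) (k : Fin 3) : cellEnd (bondAt s c k) s = c := by
  cases s <;> simp [cellEnd, bondAt]

theorem bondAt_cellEnd (b : Bond m n) (s : Bool) : bondAt s (cellEnd b s) b.2 = b :=
  eq_of_cellEnd_eq (s := s) (by rw [cellEnd_bondAt]) rfl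

/-- Both triangles of a bond have two further corners, and the four bonds there are different
because none of them meets both triangles. -/
theorem ncard_overlap (hm : m ≠ 1) (hn : n ≠ 1) (i : Bond m n) :
    {j | Overlap i j}.ncard = 4 := by
  have hset : {j | Overlap i j} = ((Finset.univ ×ˢ (Finset.univ.erase i.2) :
      Finset (Bool × Fin 3)).image fun p => bondAt p.1 (cellEnd i p.1) p.2 : Finset _) := by
    ext j
    simp only [Set.mem_ofPred_eq, overlap_iff, Finset.coe_image, Set.mem_image, Finset.mem_coe,
      Finset.mem_product, Finset.mem_univ, Finset.mem_erase, true_and, and_true, Prod.exists]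
    constructor
    · rintro ⟨hk, s, hs⟩
      exact ⟨s, j.2, hk.symm, by rw [hs, bondAt_cellEnd]⟩
    · rintro ⟨s, l, hl, rfl⟩
      exact ⟨hl.symm, s, (cellEnd_bondAt _ _ _).symm⟩
  rw [hset, Set.ncard_coe_finset, Finset.card_image_of_injOn]
  · rw [Finset.card_product, Finset.card_erase_of_mem (Finset.mem_univ _)]
    rfl
  · rintro ⟨s, l⟩ hl ⟨s', l'⟩ hl' h
    simp only [Finset.coe_product, Finset.coe_univ, Set.mem_prod, Set.mem_univ, true_and,
      Finset.mem_coe, Finset.mem_erase, Finset.mem_univ, and_true] at hl hl'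
    simp only at h
    obtain rfl : l = l' := congrArg Prod.snd h
    by_cases hss : s = s'
    · rw [hss]
    · exfalso
      obtain rfl : s' = !s := by cases s <;> cases s' <;> simp_all
      have h1 : cellEnd i s = cellEnd (bondAt s (cellEnd i s) l) s := (cellEnd_bondAt _ _ _).symm
      refine cellEnd_not_ne hm hn (j := bondAt s (cellEnd i s) l) (Ne.symm hl) h1 ?_
      rw [h, cellEnd_bondAt]

theorem inter_eq {i j : Bond m n} {s : Bool} (hk : i.2 ≠ j.2) (hs : cellEnd i s = cellEnd j s)
    (hne : cellEnd i (!s) ≠ cellEnd j (!s)) :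
    (term i).inter (term j) = triRegion (cellEnd i s) s := by
  have key (c : Cell m n) (s' : Bool) :
      c = cellEnd i s' ∧ c = cellEnd j s' ↔ c = cellEnd i s ∧ s' = s := by
    constructor
    · rintro ⟨rfl, h⟩
      have : s' = s := by
        by_contra hss
        obtain rfl : s' = !s := by cases s <;> cases s' <;> simp_all
        exact hne h
      subst this
      exact ⟨rfl, rfl⟩
    · rintro ⟨rfl, rfl⟩
      exact ⟨rfl, hs⟩
  ext e
  · simp only [Region.inter, Finset.mem_inter, mem_term_verts, triRegion, mem_triVerts, key]
  · rcases e with v | b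
    · simp only [Region.inter, Finset.mem_inter, inl_mem_term_edges, triRegion, inl_mem_triEdges,
        key]
    · simp only [Region.inter, Finset.mem_inter, inr_mem_term_edges, triRegion,
        inr_notMem_triEdges, iff_false]
      rintro ⟨rfl, rfl⟩
      exact hk rfl

theorem diff_eq {i j : Bond m n} {s : Bool} (hs : cellEnd i s = cellEnd j s)
    (hne : cellEnd i (!s) ≠ cellEnd j (!s)) :
    (term i).diff (term j) = triRegion (cellEnd i (!s)) (!s) := by
  have key (c : Cell m n) (s' : Bool) :
      c = cellEnd i s' ∧ c ≠ cellEnd j s' ↔ c = cellEnd i (!s) ∧ s' = !s := by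
    constructor
    · rintro ⟨rfl, h⟩
      have : s' = !s := by
        by_contra hss
        obtain rfl : s' = s := by cases s <;> cases s' <;> simp_all
        exact h hs
      subst this
      exact ⟨rfl, rfl⟩
    · rintro ⟨rfl, rfl⟩
      exact ⟨rfl, hne⟩
  ext e
  · simp only [Region.diff, Finset.mem_sdiff, mem_term_verts, triRegion, mem_triVerts, key]
  · rcases e with ⟨c, s', k⟩ | b
    · simp only [Region.diff, Finset.mem_filter, inl_mem_term_edges, triRegion, inl_mem_triEdges,
        ← key, lattice, mem_term_verts, and_self]
    · simp only [Region.diff, Finset.mem_filter, inr_mem_term_edges, triRegion,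
        inr_notMem_triEdges, iff_false, mem_term_verts, lattice]
      rintro ⟨rfl, h⟩
      cases s
      · exact h.1 hs
      · exact h.2 hs

/-- The space of valence bond states of a union of triangles. -/
theorem finrank_vbs_of_triangles (A : Region (lattice m n))
    (h₁ : ∀ v ∈ A.verts, Sum.inl v ∈ A.edges)
    (h₂ : ∀ v ∈ A.verts, ∀ k, (v.1, v.2.1, k) ∈ A.verts) {d : ℕ}
    (hd : d + 2 * A.edges.card = 3 * A.verts.card) : Module.finrank ℂ A.vbs = 2 ^ d := by
  have hcard := card_freeLegs A
  rw [finrank_vbs A, show A.freeLegs.card = d by omega]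
  refine legVert_injective A fun v hv => ?_
  obtain ⟨c, s, k⟩ := v
  refine Finset.card_le_one.2 fun e he e' he' => ?_
  -- Both triangle edges at a corner belong to the region, so only the bond there can be free.
  have key (e : Edge m n) (he : e ∈ (lattice m n).inc (c, s, k) \ A.edges) :
      e = Sum.inr (if s then c - shift m n k else c, k) := by
    obtain ⟨he1, he2⟩ := Finset.mem_sdiff.1 he
    simp only [lattice, Finset.mem_insert, Finset.mem_singleton] at he1
    rcases he1 with rfl | rfl | rfl
    · exact (he2 (h₁ _ hv)).elim
    · exact (he2 (h₁ _ (h₂ _ hv _))).elim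
    · rfl
  rw [key e he, key e' he']

theorem finrank_vbs_term (i : Bond m n) : Module.finrank ℂ (term i).vbs = 2 ^ 4 := by
  refine finrank_vbs_of_triangles _ (fun v hv => ?_) (fun v hv k => ?_) ?_
  · rwa [inl_mem_term_edges, ← mem_term_verts]
  · rw [mem_term_verts] at hv ⊢; exact hv
  · rw [card_term_verts, card_term_edges]

theorem finrank_vbs_triRegion (c : Cell m n) (s : Bool) :
    Module.finrank ℂ (triRegion c s).vbs = 2 ^ 3 := by
  refine finrank_vbs_of_triangles _ (fun v hv => ?_) (fun v hv k => ?_) ?_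
  · exact inl_mem_triEdges.2 (mem_triVerts.1 hv)
  · have := mem_triVerts.1 hv
    exact mem_triVerts.2 this
  · simp only [triRegion, card_triEdges, card_triVerts]

theorem mem_union_verts {i j : Bond m n} {v : Site m n} : v ∈ ((term i).union (term j)).verts ↔
    v.1 = cellEnd i v.2.1 ∨ v.1 = cellEnd j v.2.1 := by
  rw [Region.union, Finset.mem_union, mem_term_verts, mem_term_verts]

theorem card_union_verts {i j : Bond m n} {s : Bool} (hk : i.2 ≠ j.2)
    (hs : cellEnd i s = cellEnd j s) (hne : cellEnd i (!s) ≠ cellEnd j (!s)) :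
    ((term i).union (term j)).verts.card = 9 := by
  have h1 := Finset.card_union_add_card_inter (term i).verts (term j).verts
  have h2 : (term i).verts ∩ (term j).verts = triVerts (cellEnd i s) s :=
    congrArg Region.verts (inter_eq hk hs hne)
  rw [h2, card_triVerts, card_term_verts, card_term_verts] at h1
  change ((term i).verts ∪ (term j).verts).card = 9
  omega

theorem finrank_vbs_union {i j : Bond m n} {s : Bool} (hk : i.2 ≠ j.2)
    (hs : cellEnd i s = cellEnd j s) (hne : cellEnd i (!s) ≠ cellEnd j (!s)) :
    Module.finrank ℂ ((term i).union (term j)).vbs = 2 ^ 5 := by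
  refine finrank_vbs_of_triangles _ (fun v hv => ?_) (fun v hv k => ?_) ?_
  · rw [Region.union, Finset.mem_union, inl_mem_term_edges, inl_mem_term_edges]
    exact mem_union_verts.1 hv
  · have := mem_union_verts.1 hv
    exact mem_union_verts.2 this
  · rw [card_union_verts hk hs hne]
    have h1 := Finset.card_union_add_card_inter (term i).edges (term j).edges
    have h2 : (term i).edges ∩ (term j).edges = triEdges (cellEnd i s) s :=
      congrArg Region.edges (inter_eq hk hs hne)
    rw [h2, card_triEdges, card_term_edges, card_term_edges] at h1
    change 5 + 2 * ((term i).edges ∪ (term j).edges).card = _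
    omega

end Lattice

/-! ### Three triangles without links. -/

section ReducedSpace

variable {m n : ℕ}

/-- The three triangles of two overlapping terms, without the bonds. -/
def triangles (i j : Bond m n) (s : Bool) (hs : cellEnd i s = cellEnd j s) :
    Region (lattice m n) where
  verts := ((term i).union (term j)).verts
  edges := triEdges (cellEnd i (!s)) (!s) ∪ triEdges (cellEnd i s) s ∪
    triEdges (cellEnd j (!s)) (!s)
  src_mem := by
    rintro (⟨c, s', k⟩ | b) he
    · simp only [Finset.mem_union, inl_mem_triEdges] at he
      rw [mem_union_verts]
      rcases he with (⟨rfl, rfl⟩ | ⟨rfl, rfl⟩) | ⟨rfl, rfl⟩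
      · exact Or.inl rfl
      · exact Or.inl rfl
      · exact Or.inr rfl
    · simp [inr_notMem_triEdges] at he
  tgt_mem := by
    rintro (⟨c, s', k⟩ | b) he
    · simp only [Finset.mem_union, inl_mem_triEdges] at he
      rw [mem_union_verts]
      rcases he with (⟨rfl, rfl⟩ | ⟨rfl, rfl⟩) | ⟨rfl, rfl⟩
      · exact Or.inl rfl
      · exact Or.inl rfl
      · exact Or.inr rfl
    · simp [inr_notMem_triEdges] at he

theorem finrank_vbs_triangles {i j : Bond m n} {s : Bool} (hk : i.2 ≠ j.2)
    (hs : cellEnd i s = cellEnd j s) (hne : cellEnd i (!s) ≠ cellEnd j (!s)) :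
    Module.finrank ℂ (triangles i j s hs).vbs = 2 ^ 9 := by
  refine finrank_vbs_of_triangles _ (fun v hv => ?_) (fun v hv k => ?_) ?_
  · obtain ⟨c, s', k⟩ := v
    have hv' := mem_union_verts.1 hv
    simp only [triangles, Finset.mem_union, inl_mem_triEdges]
    simp only at hv'
    by_cases hss : s' = s
    · subst hss
      rw [← hs, or_self] at hv'
      exact Or.inl (Or.inr ⟨hv', rfl⟩)
    · obtain rfl : s' = !s := by cases s <;> cases s' <;> simp_all
      rcases hv' with h | h
      · exact Or.inl (Or.inl ⟨h, rfl⟩)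
      · exact Or.inr ⟨h, rfl⟩
  · have := mem_union_verts.1 hv
    exact mem_union_verts.2 this
  · have h1 : (triangles i j s hs).verts.card = 9 := card_union_verts hk hs hne
    rw [h1]
    simp only [triangles]
    rw [Finset.card_union_of_disjoint, Finset.card_union_of_disjoint, card_triEdges,
      card_triEdges, card_triEdges]
    · rw [Finset.disjoint_left]
      rintro (v | b) hv hv'
      · rw [inl_mem_triEdges] at hv hv'
        exact absurd (hv.2.symm.trans hv'.2) (by cases s <;> simp)
      · exact inr_notMem_triEdges hv
    · rw [Finset.disjoint_left]
      rintro (v | b) hv hv'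
      · rw [Finset.mem_union, inl_mem_triEdges, inl_mem_triEdges] at hv
        rw [inl_mem_triEdges] at hv'
        rcases hv with hv | hv
        · exact hne (hv.1.symm.trans hv'.1)
        · exact absurd (hv.2.symm.trans hv'.2) (by cases s <;> simp)
      · simp [inr_notMem_triEdges] at hv

end ReducedSpace

end AKLT

namespace AKLT

open Matrix Function Star

/-! ### Singlet conditions on triangles and bonds. -/

section Triangles

theorem forall_succ_iff {R : Fin 3 → Fin 3 → Prop} (hR : ∀ x y, R x y → R y x) :
    (∀ k, R k (k + 1)) ↔ ∀ x y, x ≠ y → R x y := by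
  constructor
  · intro h x y hxy
    have : ∀ x y : Fin 3, x ≠ y → y = x + 1 ∨ x = y + 1 := by decide
    rcases this x y hxy with rfl | rfl
    · exact h x
    · exact hR _ _ (h y)
  · exact fun h k => h _ _ (by revert k; decide)

/-- The cyclic pairs of three corners are all pairs, so the labelling of a triangle is immaterial.
This allows arbitrary overlapping bonds to be brought into the standard position of `chainSrc` and
`chainTgt`. -/
theorem forall_succ_perm_iff {R : Fin 3 → Fin 3 → Prop} (hR : ∀ x y, R x y → R y x)
    {p : Fin 3 → Fin 3} (hp : Injective p) :
    (∀ k, R (p k) (p (k + 1))) ↔ ∀ k, R k (k + 1) := by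
  have hs : Surjective p := Finite.surjective_of_injective hp
  rw [forall_succ_iff (R := fun x y => R (p x) (p y)) fun x y => hR _ _, forall_succ_iff hR]
  constructor
  · intro h x y hxy
    obtain ⟨x, rfl⟩ := hs x
    obtain ⟨y, rfl⟩ := hs y
    exact h x y fun h => hxy (by rw [h])
  · exact fun h x y hxy => h _ _ fun h => hxy (hp h)

variable {m n : ℕ}

theorem siteKernel_symm {B : Region (lattice m n)} {ψ : B.Phys} (p q : Site m n)
    (h : ψ ∈ siteKernel B p q) : ψ ∈ siteKernel B q p := by
  by_cases hpq : p = q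
  · rwa [hpq] at h ⊢
  · rwa [siteKernel_comm (Ne.symm hpq)]

/-- The states with singlets on the edges of a triangle. -/
def OnTriangle (B : Region (lattice m n)) (ψ : B.Phys) (c : Cell m n) (s : Bool) : Prop :=
  ∀ k, ψ ∈ siteKernel B (c, s, k) (c, s, k + 1)

/-- The states with a singlet on a bond. -/
def OnBond (B : Region (lattice m n)) (ψ : B.Phys) (b : Bond m n) : Prop :=
  ψ ∈ siteKernel B (cellEnd b false, false, b.2) (cellEnd b true, true, b.2)

theorem onTriangle_iff {B : Region (lattice m n)} {ψ : B.Phys} {c : Cell m n} {s : Bool}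
    {p : Fin 3 → Fin 3} (hp : Injective p) :
    (∀ k, ψ ∈ siteKernel B (c, s, p k) (c, s, p (k + 1))) ↔ OnTriangle B ψ c s :=
  forall_succ_perm_iff (R := fun x y => ψ ∈ siteKernel B (c, s, x) (c, s, y))
    (fun _ _ => siteKernel_symm _ _) hp

theorem onBond_iff {B : Region (lattice m n)} {ψ : B.Phys} (b : Bond m n) (s : Bool) :
    OnBond B ψ b ↔
      ψ ∈ siteKernel B (cellEnd b (!s), !s, b.2) (cellEnd b s, s, b.2) := by
  cases s
  · exact ⟨siteKernel_symm _ _, siteKernel_symm _ _⟩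
  · exact Iff.rfl

theorem forall_triEdges_iff {B : Region (lattice m n)} {ψ : B.Phys} {c : Cell m n} {s : Bool} :
    (∀ e ∈ triEdges c s, ψ ∈ siteKernel B ((lattice m n).src e) ((lattice m n).tgt e)) ↔
      OnTriangle B ψ c s := by
  simp only [triEdges, Finset.mem_image, Finset.mem_univ, true_and, forall_exists_index,
    forall_apply_eq_imp_iff]
  rfl

theorem forall_term_edges_iff {B : Region (lattice m n)} {ψ : B.Phys} {b : Bond m n} :
    (∀ e ∈ (term b).edges, ψ ∈ siteKernel B ((lattice m n).src e) ((lattice m n).tgt e)) ↔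
      (∀ s, OnTriangle B ψ (cellEnd b s) s) ∧ OnBond B ψ b := by
  have : (term b).edges = insert (Sum.inr b) (triEdges (cellEnd b false) false ∪
    triEdges (cellEnd b true) true) := rfl
  rw [this]
  simp only [Finset.forall_mem_insert, Finset.forall_mem_union, forall_triEdges_iff, Bool.forall_bool]
  rw [and_comm]
  rfl

theorem vbsProj_term_iff {b : Bond m n} {B : Region (lattice m n)} (h : (term b).verts ⊆ B.verts)
    (ψ : B.Phys) : toEuclideanLin (Region.vbsProj h) ψ = ψ ↔
      (∀ s, OnTriangle B ψ (cellEnd b s) s) ∧ OnBond B ψ b := by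
  rw [vbsProj_eq_self_iff_siteKernel (lattice_isSimple m n), forall_term_edges_iff]

theorem vbsProj_triRegion_iff {A B : Region (lattice m n)} (h : A.verts ⊆ B.verts)
    {c : Cell m n} {s : Bool} (hA : A = triRegion c s) (ψ : B.Phys) :
    toEuclideanLin (Region.vbsProj h) ψ = ψ ↔ OnTriangle B ψ c s := by
  subst hA
  rw [vbsProj_eq_self_iff_siteKernel (lattice_isSimple m n)]
  exact forall_triEdges_iff

end Triangles

/-! ### Two overlapping terms as the standard row of triangles. -/

section Chain

variable {m n : ℕ}

/-- The corners of the middle triangle, those of the two bonds first. -/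
def middlePerm (k l : Fin 3) : Fin 3 → Fin 3 := ![k, l, -(k + l)]

/-- The elements of `Fin 3` sum to zero, so `-(k + l)` is the third corner. -/
theorem middlePerm_injective {k l : Fin 3} (h : k ≠ l) : Injective (middlePerm k l) := by
  revert k l
  decide

/-- The vertices of two overlapping terms as three triangles in a row. -/
def chainSite (i j : Bond m n) (s : Bool) (v : Fin 3 × Fin 3) : Site m n :=
  (![cellEnd i (!s), cellEnd i s, cellEnd j (!s)] v.1, ![!s, s, !s] v.1,
    -- The outer triangles are rotated so that their corner 0 carries the bond.
    ![fun x => x + i.2, middlePerm i.2 j.2, fun x => x + j.2] v.1 v.2)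

theorem chainSite_mem {i j : Bond m n} {s : Bool} (v : Fin 3 × Fin 3) :
    chainSite i j s v ∈ ((term i).union (term j)).verts := by
  obtain ⟨t, x⟩ := v
  rw [mem_union_verts]
  fin_cases t
  · exact Or.inl rfl
  · exact Or.inl rfl
  · exact Or.inr rfl

theorem chainSite_injective {i j : Bond m n} {s : Bool} (hk : i.2 ≠ j.2)
    (hne : cellEnd i (!s) ≠ cellEnd j (!s)) : Injective (chainSite i j s) := by
  rintro ⟨t, x⟩ ⟨t', x'⟩ h
  simp only [chainSite, Prod.mk.injEq] at h
  obtain ⟨h1, h2, h3⟩ := h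
  fin_cases t <;> fin_cases t' <;> simp at h1 h2 h3 ⊢
  · exact h3
  · exact absurd h1 hne
  · exact middlePerm_injective hk h3
  · exact absurd h1.symm hne
  · exact h3

/-- The sites of two overlapping terms. -/
noncomputable def chainEquiv {i j : Bond m n} {s : Bool} (hk : i.2 ≠ j.2)
    (hs : cellEnd i s = cellEnd j s) (hne : cellEnd i (!s) ≠ cellEnd j (!s)) :
    Fin 3 × Fin 3 ≃ ((term i).union (term j)).verts :=
  Equiv.ofBijective (fun v => ⟨chainSite i j s v, chainSite_mem v⟩) <| by
    rw [Fintype.bijective_iff_injective_and_card]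
    refine ⟨fun v w h => chainSite_injective hk hne (congrArg Subtype.val h), ?_⟩
    rw [Fintype.card_coe, card_union_verts hk hs hne]
    rfl

theorem diagKernel_chainEquiv {i j : Bond m n} {s : Bool} (hk : i.2 ≠ j.2)
    (hs : cellEnd i s = cellEnd j s) (hne : cellEnd i (!s) ≠ cellEnd j (!s))
    (v w : Fin 3 × Fin 3) : diagKernel (chainEquiv hk hs hne v) (chainEquiv hk hs hne w) =
      siteKernel ((term i).union (term j)) (chainSite i j s v) (chainSite i j s w) :=
  (siteKernel_coe (chainEquiv hk hs hne v) (chainEquiv hk hs hne w)).symm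

theorem forall_inr_iff {i j : Bond m n} {s : Bool} (hk : i.2 ≠ j.2)
    (ψ : ((term i).union (term j)).Phys) :
    (∀ v : Fin 3 × Fin 3, ψ ∈ siteKernel ((term i).union (term j))
      (chainSite i j s v) (chainSite i j s (v.1, v.2 + 1))) ↔
      OnTriangle _ ψ (cellEnd i (!s)) (!s) ∧ OnTriangle _ ψ (cellEnd i s) s ∧
        OnTriangle _ ψ (cellEnd j (!s)) (!s) := by
  rw [← onTriangle_iff (add_left_injective i.2), ← onTriangle_iff (middlePerm_injective hk),
    ← onTriangle_iff (s := !s) (c := cellEnd j (!s)) (add_left_injective j.2)]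
  constructor
  · exact fun h => ⟨fun k => h (0, k), fun k => h (1, k), fun k => h (2, k)⟩
  · rintro ⟨h0, h1, h2⟩ ⟨t, x⟩
    fin_cases t
    · exact h0 x
    · exact h1 x
    · exact h2 x

/-- An outer triangle is disjoint from the other term, so its projection commutes with that of the
other term, and it is part of its own term, so it fixes the range there.
`FriedrichsAngle.of_reducing` then leaves the states of the standard row. -/
theorem friedrichsAngle_of_chain {η : ℝ} (h : IsAngle (chainSpace {true}) (chainSpace {false}) η)
    {i j : Bond m n} {s : Bool} (hk : i.2 ≠ j.2) (hs : cellEnd i s = cellEnd j s)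
    (hne : cellEnd i (!s) ≠ cellEnd j (!s)) :
    FriedrichsAngle (projLeft i j) (projRight i j) η := by
  have hL := vbsProj_triRegion_iff (Region.diff_subset_left (term i) (term j)) (diff_eq hs hne)
  have hR := vbsProj_triRegion_iff (Region.diff_subset_right (term i) (term j))
    (diff_eq hs.symm hne.symm)
  have hE := vbsProj_term_iff (Region.subset_union_left (term i) (term j))
  have hF := vbsProj_term_iff (Region.subset_union_right (term i) (term j))
  let K (P : Matrix ((term i).union (term j)).Config ((term i).union (term j)).Config ℂ) :
    Submodule ℂ ((term i).union (term j)).Phys := LinearMap.ker (toEuclideanLin P - LinearMap.id)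
  have hK (P) (x) : x ∈ K P ↔ toEuclideanLin P x = x := by
    simp only [K, LinearMap.mem_ker, LinearMap.sub_apply, LinearMap.id_apply, sub_eq_zero]
  refine FriedrichsAngle.of_reducing (vbsProj_isHermitian _) (vbsProj_mul_self _)
    (vbsProj_isHermitian _) (vbsProj_mul_self _)
    (P := Region.vbsProj (Region.diff_subset_left (term i) (term j)))
    (vbsProj_isHermitian _) (vbsProj_mul_self _)
    (Q := Region.vbsProj (Region.diff_subset_right (term i) (term j)))
    (vbsProj_isHermitian _) (vbsProj_mul_self _)
    (fun x hx => (hL x).2 (((hE x).1 hx).1 _)) (fun x hx => (hR x).2 (((hF x).1 hx).1 _))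
    (vbsProj_commute _ _ Finset.disjoint_sdiff) (vbsProj_commute _ _ Finset.disjoint_sdiff)
    (U := K (projLeft i j) ⊓ K (Region.vbsProj (Region.diff_subset_right (term i) (term j))))
    (U' := K (projRight i j) ⊓ K (Region.vbsProj (Region.diff_subset_left (term i) (term j))))
    (fun x => by rw [Submodule.mem_inf, hK, hK]) (fun x => by rw [Submodule.mem_inf, hK, hK]) ?_
  have hchain (l : Bool) (x : ((term i).union (term j)).Phys) :
      (∀ e ∈ chainEdges {l}, x ∈ diagKernel (chainEquiv hk hs hne (chainSrc e))
        (chainEquiv hk hs hne (chainTgt e))) ↔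
      x ∈ siteKernel ((term i).union (term j)) (chainSite i j s (chainSrc (Sum.inl l)))
        (chainSite i j s (chainTgt (Sum.inl l))) ∧
      OnTriangle _ x (cellEnd i (!s)) (!s) ∧ OnTriangle _ x (cellEnd i s) s ∧
        OnTriangle _ x (cellEnd j (!s)) (!s) := by
    rw [← forall_inr_iff hk]
    simp only [chainEdges, diagKernel_chainEquiv, Sum.forall, Finset.inl_mem_disjSum,
      Finset.inr_mem_disjSum, Finset.mem_singleton, forall_eq, Finset.mem_univ, forall_const]
    rfl
  have hbool {p : Bool → Prop} : (∀ b, p b) ↔ p (!s) ∧ p s := by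
    cases s
    · rw [Bool.forall_bool, and_comm]; rfl
    · rw [Bool.forall_bool]; rfl
  refine h.relabel (chainEquiv hk hs hne) (fun x => ?_) fun x => ?_
  · rw [Submodule.mem_inf, hK, hK, hchain, projLeft, hE, hR, hbool, onBond_iff i s]
    simp only [chainSite, chainSrc, chainTgt, cons_val, zero_add, middlePerm]
    tauto
  · rw [Submodule.mem_inf, hK, hK, hchain, projRight, hF, hL, hbool, onBond_iff j s, hs]
    simp only [chainSite, chainSrc, chainTgt, cons_val, zero_add, middlePerm, hs]
    tauto

theorem mem_reducedSpace_iff {i j : Bond m n} {s : Bool} (hk : i.2 ≠ j.2)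
    (hs : cellEnd i s = cellEnd j s) (hne : cellEnd i (!s) ≠ cellEnd j (!s))
    (ψ : ((term i).union (term j)).Phys) : ψ ∈ reducedSpace i j ↔
      OnTriangle _ ψ (cellEnd i (!s)) (!s) ∧ OnTriangle _ ψ (cellEnd i s) s ∧
        OnTriangle _ ψ (cellEnd j (!s)) (!s) := by
  rw [reducedSpace, mem_vbsTensor_iff, vbsProj_triRegion_iff _ (diff_eq hs hne),
    vbsProj_triRegion_iff _ (inter_eq hk hs hne), vbsProj_triRegion_iff _ (diff_eq hs.symm hne.symm)]
  · exact Finset.disjoint_sdiff_inter _ _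
  · exact Finset.disjoint_of_subset_right Finset.sdiff_subset Finset.sdiff_disjoint
  · exact Finset.disjoint_left.2 fun v hv hv' =>
      (Finset.mem_sdiff.1 hv').2 (Finset.mem_inter.1 hv).1
  · intro v
    simp only [Region.union, Region.diff, Region.inter, Finset.mem_union, Finset.mem_sdiff,
      Finset.mem_inter]
    tauto

/-- The reduced space is the space of valence bond states after deletion of both bonds, where each
of the nine corners has one free leg. -/
theorem finrank_reducedSpace {i j : Bond m n} {s : Bool} (hk : i.2 ≠ j.2)
    (hs : cellEnd i s = cellEnd j s) (hne : cellEnd i (!s) ≠ cellEnd j (!s)) :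
    Module.finrank ℂ (reducedSpace i j) = 2 ^ 9 := by
  have key (φ : (triangles i j s hs).Phys) : φ ∈ (triangles i j s hs).vbs ↔
      OnTriangle _ φ (cellEnd i (!s)) (!s) ∧ OnTriangle _ φ (cellEnd i s) s ∧
        OnTriangle _ φ (cellEnd j (!s)) (!s) := by
    have hedges : (triangles i j s hs).edges = triEdges (cellEnd i (!s)) (!s) ∪
      triEdges (cellEnd i s) s ∪ triEdges (cellEnd j (!s)) (!s) := rfl
    rw [mem_vbs_iff (lattice_isSimple m n), hedges]
    simp only [Finset.forall_mem_union, forall_triEdges_iff, and_assoc]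
  have : reducedSpace i j = (triangles i j s hs).vbs := by
    ext ψ
    rw [mem_reducedSpace_iff hk hs hne]
    exact (key ψ).symm
  exact (congrArg (fun K : Submodule ℂ ((term i).union (term j)).Phys => Module.finrank ℂ K)
    this).trans (finrank_vbs_triangles hk hs hne)

/-- `Π_i` preserves the condition on the outer triangle of `j`, with which it commutes, and creates
those on its own triangles; likewise for `Π_j`. This gives the invariance and the inclusions
required for the compression. -/
theorem nonintegerEigenvalues_reducedOperator {η : ℝ} {i j : Bond m n} {s : Bool}
    (h : FriedrichsAngle (projLeft i j) (projRight i j) η) (hk : i.2 ≠ j.2)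
    (hs : cellEnd i s = cellEnd j s) (hne : cellEnd i (!s) ≠ cellEnd j (!s)) :
    nonintegerEigenvalues (reducedOperator i j) =
      nonintegerEigenvalues (toEuclideanLin (projLeft i j + projRight i j)) := by
  have hL := vbsProj_triRegion_iff (Region.diff_subset_left (term i) (term j)) (diff_eq hs hne)
  have hR := vbsProj_triRegion_iff (Region.diff_subset_right (term i) (term j))
    (diff_eq hs.symm hne.symm)
  have hE := vbsProj_term_iff (Region.subset_union_left (term i) (term j))
  have hF := vbsProj_term_iff (Region.subset_union_right (term i) (term j))
  have hFP := vbsProj_commute (Region.subset_union_right (term i) (term j))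
    (Region.diff_subset_left (term i) (term j)) Finset.disjoint_sdiff
  have hEQ := vbsProj_commute (Region.subset_union_left (term i) (term j))
    (Region.diff_subset_right (term i) (term j)) Finset.disjoint_sdiff
  have key1 (x) (hx : toEuclideanLin
      (Region.vbsProj (Region.diff_subset_right (term i) (term j))) x = x) :
      toEuclideanLin (projLeft i j) x ∈ reducedSpace i j := by
    rw [mem_reducedSpace_iff hk hs hne, ← hR, projLeft, ← toEuclideanLin_mul, ← hEQ,
      toEuclideanLin_mul, hx]
    have h1 := ((hE (toEuclideanLin (projLeft i j) x)).1 (h.apply_apply x)).1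
    exact ⟨h1 _, h1 _, rfl⟩
  have key2 (x) (hx : toEuclideanLin
      (Region.vbsProj (Region.diff_subset_left (term i) (term j))) x = x) :
      toEuclideanLin (projRight i j) x ∈ reducedSpace i j := by
    rw [mem_reducedSpace_iff hk hs hne, ← hL, projRight, ← toEuclideanLin_mul, ← hFP,
      toEuclideanLin_mul, hx]
    have h1 := ((hF (toEuclideanLin (projRight i j) x)).1 (h.symm.apply_apply x)).1
    exact ⟨rfl, hs ▸ h1 s, h1 _⟩
  refine h.nonintegerEigenvalues_compression _ (fun x hx => key1 x ?_) (fun x hx => key2 x ?_)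
    (fun x hx => key2 x ?_) (fun x hx => key1 x ?_)
  · exact (hR x).2 ((mem_reducedSpace_iff hk hs hne x).1 hx).2.2
  · exact (hL x).2 ((mem_reducedSpace_iff hk hs hne x).1 hx).1
  · exact (hL x).2 (((hE x).1 hx).1 _)
  · exact (hR x).2 (((hF x).1 hx).1 _)

theorem eigenspace_two_eq_vbs {η : ℝ} {i j : Bond m n}
    (h : FriedrichsAngle (projLeft i j) (projRight i j) η) :
    Module.End.eigenspace (toEuclideanLin (projLeft i j + projRight i j)) 2 =
      ((term i).union (term j)).vbs := by
  ext ψ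
  rw [Module.End.mem_eigenspace_iff, h.eigenspace_two, projLeft, projRight,
    vbsProj_eq_self_iff_siteKernel (lattice_isSimple m n),
    vbsProj_eq_self_iff_siteKernel (lattice_isSimple m n), mem_vbs_iff (lattice_isSimple m n)]
  exact Finset.forall_mem_union.symm

end Chain

end AKLT

namespace AKLT

open Matrix Function Star

/-! ### The square of a sum of projections. -/

section SumsOfProjections

variable {n : Type} [Fintype n] [DecidableEq n]

theorem posSemidef_of_proj {P : Matrix n n ℂ} (hP : P.IsHermitian) (h : P * P = P) :
    P.PosSemidef := by
  have := Matrix.posSemidef_conjTranspose_mul_self P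
  rwa [hP, h] at this

theorem posSemidef_mul_of_commute {P Q : Matrix n n ℂ} (hP : P.IsHermitian) (hPP : P * P = P)
    (hQ : Q.IsHermitian) (hQQ : Q * Q = Q) (h : P * Q = Q * P) : (P * Q).PosSemidef := by
  refine posSemidef_of_proj ?_ ?_
  · rw [Matrix.IsHermitian, conjTranspose_mul, hP, hQ, h]
  · rw [mul_assoc, ← mul_assoc Q, ← h, mul_assoc P Q Q, hQQ, ← mul_assoc, hPP]

/-- A sum of projections, where each projection fails to commute with at most `d` others, and
the anticommutators of these are bounded below. -/
theorem posSemidef_sum_sq_sub {I : Type} [Fintype I] [DecidableEq I] {P : I → Matrix n n ℂ}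
    {R : I → I → Prop} [DecidableRel R] (hR : ∀ i j, R i j → R j i) (hne : ∀ i, ¬ R i i)
    {d : ℕ} (hd : ∀ i, (Finset.univ.filter (R i)).card ≤ d) {η : ℝ} (hη : 0 ≤ η)
    (hP : ∀ i, (P i).IsHermitian) (hPP : ∀ i, P i * P i = P i)
    (h1 : ∀ i j, R i j → (P i * P j + P j * P i + (η : ℂ) • (P i + P j)).PosSemidef)
    (h2 : ∀ i j, i ≠ j → ¬ R i j → P i * P j = P j * P i) :
    ((∑ i, P i) * (∑ i, P i) - ((1 - d * η : ℝ) : ℂ) • ∑ i, P i).PosSemidef := by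
  -- The symmetrised square, pair by pair: related pairs are compensated by `η (P i + P j)`, other
  -- distinct pairs commute and are nonnegative, and the diagonal is cancelled by `2 P i`.
  let T : I → I → Matrix n n ℂ := fun i j => P i * P j + P j * P i +
    (if R i j then (η : ℂ) • (P i + P j) else 0) - if i = j then (2 : ℂ) • P i else 0
  have hT (i j : I) : (T i j).PosSemidef := by
    by_cases hij : i = j
    · subst hij
      have : T i i = 0 := by
        simp only [T, hPP, if_neg (hne i), if_true, two_smul]
        abel
      rw [this]
      exact Matrix.PosSemidef.zero
    · by_cases hr : R i j
      · simp only [T, if_pos hr, if_neg hij, sub_zero]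
        exact h1 i j hr
      · simp only [T, if_neg hr, if_neg hij, sub_zero, add_zero]
        exact (posSemidef_mul_of_commute (hP i) (hPP i) (hP j) (hPP j) (h2 i j hij hr)).add
          (posSemidef_mul_of_commute (hP j) (hPP j) (hP i) (hPP i) (h2 i j hij hr).symm)
  have e1 : ∑ i, ∑ j, (P i * P j + P j * P i) = (2 : ℂ) • ((∑ i, P i) * ∑ i, P i) := by
    simp only [Finset.sum_add_distrib, two_smul, Finset.sum_mul_sum]
    congr 1
    exact Finset.sum_comm
  have e2 : ∑ i, ∑ j, (if R i j then (η : ℂ) • (P i + P j) else 0) =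
      ∑ i, ((2 * η * (Finset.univ.filter (R i)).card : ℝ) : ℂ) • P i := by
    have h3 : ∑ i, ∑ j, (if R i j then (η : ℂ) • P i else 0) =
        ∑ i, ((η * (Finset.univ.filter (R i)).card : ℝ) : ℂ) • P i := by
      refine Finset.sum_congr rfl fun i _ => ?_
      rw [← Finset.sum_filter, Finset.sum_const, ← Nat.cast_smul_eq_nsmul ℂ, smul_smul]
      congr 1
      push_cast
      ring
    have h4 : ∑ i, ∑ j, (if R i j then (η : ℂ) • P j else 0) =
        ∑ i, ∑ j, (if R i j then (η : ℂ) • P i else 0) := by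
      rw [Finset.sum_comm]
      refine Finset.sum_congr rfl fun i _ => Finset.sum_congr rfl fun j _ => ?_
      exact if_congr ⟨hR _ _, hR _ _⟩ rfl rfl
    have h5 : ∑ i, ∑ j, (if R i j then (η : ℂ) • (P i + P j) else 0) =
        ∑ i, ∑ j, (if R i j then (η : ℂ) • P i else 0) +
          ∑ i, ∑ j, (if R i j then (η : ℂ) • P j else 0) := by
      simp only [← Finset.sum_add_distrib]
      refine Finset.sum_congr rfl fun i _ => Finset.sum_congr rfl fun j _ => ?_
      split_ifs
      · rw [smul_add]
      · rw [add_zero]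
    rw [h5, h4, h3, ← Finset.sum_add_distrib]
    refine Finset.sum_congr rfl fun i _ => ?_
    rw [← add_smul]
    congr 1
    push_cast
    ring
  have e3 : ∑ i, ∑ j, T i j = (2 : ℂ) • ((∑ i, P i) * ∑ i, P i) +
      ∑ i, ((2 * η * (Finset.univ.filter (R i)).card : ℝ) : ℂ) • P i - (2 : ℂ) • ∑ i, P i := by
    rw [← e1, ← e2, Finset.smul_sum, ← Finset.sum_add_distrib, ← Finset.sum_sub_distrib]
    refine Finset.sum_congr rfl fun i _ => ?_
    have h6 : (2 : ℂ) • P i = ∑ j, if i = j then (2 : ℂ) • P i else 0 := by simp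
    rw [h6, ← Finset.sum_add_distrib, ← Finset.sum_sub_distrib]
  -- The second sum is the slack of the projections with fewer than `d` neighbours.
  have e4 : (∑ i, P i) * (∑ i, P i) - ((1 - d * η : ℝ) : ℂ) • ∑ i, P i =
      ((1 / 2 : ℝ) : ℂ) • (∑ i, ∑ j, T i j +
        ∑ i, ((2 * η * (d - (Finset.univ.filter (R i)).card) : ℝ) : ℂ) • P i) := by
    have h3 : ∑ i, ((2 * η * (d - (Finset.univ.filter (R i)).card) : ℝ) : ℂ) • P i =
        ((2 * η * d : ℝ) : ℂ) • ∑ i, P i -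
          ∑ i, ((2 * η * (Finset.univ.filter (R i)).card : ℝ) : ℂ) • P i := by
      rw [Finset.smul_sum, ← Finset.sum_sub_distrib]
      refine Finset.sum_congr rfl fun i _ => ?_
      rw [← sub_smul]
      congr 1
      push_cast
      ring
    rw [e3, h3]
    push_cast
    module
  have hcast (x : ℝ) (hx : 0 ≤ x) : (0 : ℂ) ≤ (x : ℂ) := by exact_mod_cast hx
  rw [e4]
  refine Matrix.PosSemidef.smul (Matrix.PosSemidef.add ?_ ?_) (hcast _ (by norm_num))
  · exact Matrix.posSemidef_sum _ fun i _ => Matrix.posSemidef_sum _ fun j _ => hT i j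
  · refine Matrix.posSemidef_sum _ fun i _ =>
      (posSemidef_of_proj (hP i) (hPP i)).smul (hcast _ ?_)
    have : ((Finset.univ.filter (R i)).card : ℝ) ≤ d := by exact_mod_cast hd i
    have := sub_nonneg.2 this
    positivity

end SumsOfProjections

/-! ### The regrouped Hamiltonian. -/

section Regrouped

variable {m n : ℕ}

theorem subset_patch (S : Finset (Bond m n)) (i : S) : (term i.1).verts ⊆ (patch S).verts :=
  Region.subset_biUnion term i

/-- The term of the regrouped Hamiltonian. -/
noncomputable def patchTerm (S : Finset (Bond m n)) (i : S) :
    Matrix (patch S).Config (patch S).Config ℂ :=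
  1 - Region.vbsProj (subset_patch S i)

theorem patchTerm_isHermitian (S : Finset (Bond m n)) (i : S) : (patchTerm S i).IsHermitian :=
  Matrix.isHermitian_one.sub (vbsProj_isHermitian _)

theorem patchTerm_mul_self (S : Finset (Bond m n)) (i : S) :
    patchTerm S i * patchTerm S i = patchTerm S i := by
  rw [patchTerm, sub_mul, mul_sub, mul_sub, vbsProj_mul_self]
  simp

theorem vbsProj_eq_locOp {V E : Type} [DecidableEq V] [DecidableEq E] {G : CubicGraph V E}
    {A B C : Region G} (h : A.verts ⊆ B.verts) (h' : B.verts ⊆ C.verts)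
    (h'' : A.verts ⊆ C.verts) :
    Region.vbsProj h'' = locOp (incl h') (Region.vbsProj h) := by
  rw [Region.vbsProj, Region.vbsProj, extend_eq_locOp, extend_eq_locOp,
    locOp_locOp (incl_injective h')]
  rfl

/-- The anticommutator bound on the union of two terms passes to the whole patch by tensoring with
the identity; terms that do not overlap commute, and at most four others overlap a given one within
`S`. -/
theorem regrouped_sq_sub_posSemidef (hm : m ≠ 1) (hn : n ≠ 1) {η : ℝ} (hη : 0 ≤ η) (hη1 : η < 1)
    (h : ∀ i j : Bond m n, Overlap i j → FriedrichsAngle (projLeft i j) (projRight i j) η)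
    (S : Finset (Bond m n)) :
    (regrouped S * regrouped S - ((1 - 4 * η : ℝ) : ℂ) • regrouped S).PosSemidef := by
  classical
  have hsymm (i j : Bond m n) (hij : Overlap i j) : Overlap j i :=
    ⟨hij.1.symm, fun h => hij.2 h.symm⟩
  refine posSemidef_sum_sq_sub (P := patchTerm S) (R := fun i j => Overlap i.1 j.1) (d := 4)
    (fun i j => hsymm _ _) (fun i hi => hi.1 rfl) (fun i => ?_) hη (patchTerm_isHermitian S)
    (patchTerm_mul_self S) (fun i j hij => ?_) fun i j hij hno => ?_
  · rw [← ncard_overlap hm hn i.1, ← Finset.card_image_of_injective _ Subtype.val_injective,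
      ← Set.ncard_coe_finset]
    refine Set.ncard_le_ncard ?_ (Set.finite_of_ncard_ne_zero ?_)
    · intro j hj
      obtain ⟨k, hk, rfl⟩ := Finset.mem_image.1 (Finset.mem_coe.1 hj)
      exact (Finset.mem_filter.1 hk).2
    · rw [ncard_overlap hm hn]; norm_num
  · have hY : ((term i.1).union (term j.1)).verts ⊆ (patch S).verts :=
      Finset.union_subset (subset_patch S i) (subset_patch S j)
    have hi : patchTerm S i = locOp (incl hY) (1 - projLeft i.1 j.1) := by
      rw [locOp_sub, locOp_one (incl_injective hY), patchTerm, projLeft,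
        vbsProj_eq_locOp (Region.subset_union_left (term i.1) (term j.1)) hY]
    have hj : patchTerm S j = locOp (incl hY) (1 - projRight i.1 j.1) := by
      rw [locOp_sub, locOp_one (incl_injective hY), patchTerm, projRight,
        vbsProj_eq_locOp (Region.subset_union_right (term i.1) (term j.1)) hY]
    have h1 := locOp_posSemidef (incl_injective hY) ((h i j hij).isLeast_anticommutatorBounds hη1).1
    rwa [locOp_add, locOp_add, locOp_smul, locOp_add, locOp_mul (incl_injective hY),
      locOp_mul (incl_injective hY), ← hi, ← hj] at h1
  · have hd : Disjoint (term i.1).verts (term j.1).verts := by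
      by_contra hd
      exact hno ⟨fun h => hij (Subtype.ext h.symm), hd⟩
    have h1 := vbsProj_commute (subset_patch S i) (subset_patch S j) hd
    simp only [patchTerm, sub_mul, mul_sub, one_mul, mul_one, h1]
    abel

end Regrouped

end AKLT

namespace AKLT

open Matrix Function Star

/-! ### Common spectral gaps of finite families. -/

section FiniteFamilies

theorem exists_pos_le_of_finite {s : Set ℝ} (hs : s.Finite) :
    ∃ g : ℝ, 0 < g ∧ ∀ x ∈ s, 0 < x → g ≤ x := by
  induction s, hs using Set.Finite.induction_on with
  | empty => exact ⟨1, one_pos, by simp⟩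
  | @insert a s _ _ ih =>
    obtain ⟨g, hg, h⟩ := ih
    by_cases ha : 0 < a
    · refine ⟨min a g, lt_min ha hg, fun x hx h0 => ?_⟩
      rcases hx with rfl | hx
      · exact min_le_left _ _
      · exact (min_le_right _ _).trans (h x hx h0)
    · refine ⟨g, hg, fun x hx h0 => ?_⟩
      rcases hx with rfl | hx
      · exact (ha h0).elim
      · exact h x hx h0

variable {n : Type} [Fintype n] [DecidableEq n]

theorem nonneg_of_mem_spectrum {A : Matrix n n ℂ} (hA : A.PosSemidef) {l : ℝ}
    (hl : l ∈ spectrum ℝ A) : 0 ≤ l := by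
  obtain ⟨x, hx, h⟩ := mem_spectrum_iff.1 hl
  have h1 := (posSemidef_iff_inner.1 hA).2 x
  rw [h, inner_smul_left, inner_self_eq_norm_sq_to_K, Complex.conj_ofReal] at h1
  have h2 : 0 ≤ l * ‖x‖ ^ 2 := by
    refine le_of_le_of_eq h1 ?_
    have : (l : ℂ) * ((‖x‖ : ℝ) : ℂ) ^ 2 = ((l * ‖x‖ ^ 2 : ℝ) : ℂ) := by push_cast; rfl
    exact (congrArg Complex.re this).trans (Complex.ofReal_re _)
  exact nonneg_of_mul_nonneg_left h2 (by positivity)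

/-- A finite family of positive operators has a common spectral gap. -/
theorem exists_common_gap {D : Type} [Finite D] (H : D → Matrix n n ℂ)
    (hH : ∀ d, (H d).PosSemidef) :
    ∃ g : ℝ, 0 < g ∧ ∀ d, ∀ l ∈ spectrum ℝ (H d), l ≠ 0 → g ≤ l := by
  obtain ⟨g, hg, h⟩ := exists_pos_le_of_finite
    (Set.finite_iUnion fun d => Matrix.finite_real_spectrum (A := H d))
  exact ⟨g, hg, fun d l hl h0 => h l (Set.mem_iUnion.2 ⟨d, hl⟩)
    (lt_of_le_of_ne (nonneg_of_mem_spectrum (hH d) hl) (Ne.symm h0))⟩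

theorem re_inner_sum_apply {I : Type*} (s : Finset I) (A : I → Matrix n n ℂ)
    (x : EuclideanSpace ℂ n) : RCLike.re (inner ℂ (toEuclideanLin (∑ i ∈ s, A i) x) x) =
      ∑ i ∈ s, RCLike.re (inner ℂ (toEuclideanLin (A i) x) x) := by
  rw [map_sum, LinearMap.sum_apply, sum_inner, map_sum]

/-- The kernel of a sum of positive operators. -/
theorem sum_apply_eq_zero_iff {I : Type*} (s : Finset I) {P : I → Matrix n n ℂ}
    (hP : ∀ i ∈ s, (P i).IsHermitian) (hPP : ∀ i ∈ s, P i * P i = P i) (x : EuclideanSpace ℂ n) :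
    toEuclideanLin (∑ i ∈ s, P i) x = 0 ↔ ∀ i ∈ s, toEuclideanLin (P i) x = 0 := by
  constructor
  · intro h i hi
    have h1 := re_inner_sum_apply s P x
    rw [h, inner_zero_left, map_zero, eq_comm,
      Finset.sum_congr rfl fun i hi => re_inner_self_nonneg_of_proj (hP i hi) (hPP i hi) x,
      Finset.sum_eq_zero_iff_of_nonneg fun i _ => sq_nonneg _] at h1
    exact norm_eq_zero.1 (pow_eq_zero_iff (two_ne_zero) |>.1 (h1 i hi))
  · intro h
    rw [map_sum, LinearMap.sum_apply]
    exact Finset.sum_eq_zero h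

theorem isHermitian_sum {I : Type*} (s : Finset I) {P : I → Matrix n n ℂ}
    (hP : ∀ i ∈ s, (P i).IsHermitian) : (∑ i ∈ s, P i).IsHermitian := by
  rw [Matrix.IsHermitian, conjTranspose_sum]
  exact Finset.sum_congr rfl hP

/-- A positive operator with gap `g` is bounded below by `g` times the projection onto the
orthogonal complement of its kernel. -/
theorem posSemidef_sub_smul_orthProj {A : Matrix n n ℂ} (hA : A.IsHermitian) {g : ℝ}
    (hg : ∀ l ∈ spectrum ℝ A, l ≠ 0 → g ≤ l) (K : Submodule ℂ (EuclideanSpace ℂ n))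
    (hK : ∀ x, toEuclideanLin A x = 0 ↔ x ∈ K) :
    (A - (g : ℂ) • (1 - orthProj K)).PosSemidef := by
  have hQ : (1 - orthProj K).IsHermitian := Matrix.isHermitian_one.sub (orthProj_isHermitian K)
  have hQQ : (1 - orthProj K) * (1 - orthProj K) = 1 - orthProj K := by
    rw [sub_mul, mul_sub, mul_sub, orthProj_mul_self]
    simp
  rw [posSemidef_iff_inner]
  refine ⟨hA.sub ?_, fun x => ?_⟩
  · rw [Matrix.IsHermitian, conjTranspose_smul, hQ]; simp
  · set y := toEuclideanLin (1 - orthProj K) x with hy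
    have hy' : y = x - toEuclideanLin (orthProj K) x := by
      rw [hy, map_sub, LinearMap.sub_apply, toEuclideanLin_one]
    have hz : toEuclideanLin A (toEuclideanLin (orthProj K) x) = 0 := by
      rw [hK, ← orthProj_eq_self_iff, ← toEuclideanLin_mul, orthProj_mul_self]
    have hAy : toEuclideanLin A y = toEuclideanLin A x := by rw [hy', map_sub, hz, sub_zero]
    have h1 : inner ℂ (toEuclideanLin A x) x = inner ℂ (toEuclideanLin A y) y := by
      rw [hAy, hy', inner_sub_right, inner_toEuclideanLin hA x (toEuclideanLin (orthProj K) x), hz,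
        inner_zero_right, sub_zero]
    have h2 := mul_norm_sq_le_of_orthogonal_ker hA hg (x := y) fun z hz => by
      rw [hy, ← inner_toEuclideanLin hQ, map_sub, LinearMap.sub_apply, toEuclideanLin_one,
        (orthProj_eq_self_iff K z).2 ((hK z).1 hz), sub_self, inner_zero_left]
    have h3 := re_inner_self_nonneg_of_proj hQ hQQ x
    rw [map_sub, LinearMap.sub_apply, inner_sub_left, map_sub, h1, map_smul, LinearMap.smul_apply,
      inner_smul_left, Complex.conj_ofReal]
    have h4 : RCLike.re ((g : ℂ) * inner ℂ (toEuclideanLin (1 - orthProj K) x) x) =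
        g * ‖y‖ ^ 2 := by
      rw [← h3]
      exact Complex.re_ofReal_mul _ _
    rw [h4]
    linarith

end FiniteFamilies

/-! ### Relabelling of Hamiltonians. -/

section Relabelling

variable {κ ι μ : Type} [Fintype κ] [DecidableEq κ] [Fintype ι] [DecidableEq ι] [Fintype μ]
  [DecidableEq μ]

theorem locOp_equiv_comp (f : κ ≃ ι) (j : μ → κ) (M : Matrix (μ → Fin 4) (μ → Fin 4) ℂ)
    (ψ : EuclideanSpace ℂ (κ → Fin 4)) :
    toEuclideanLin (locOp (f ∘ j) M) (relabel f ψ) = relabel f (toEuclideanLin (locOp j M) ψ) := by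
  ext σ
  change ∑ τ, locOp (f ∘ j) M σ τ * ψ (τ ∘ f) = ∑ τ, locOp j M (σ ∘ f) τ * ψ τ
  rw [← (Equiv.arrowCongr f (Equiv.refl (Fin 4))).sum_comp]
  refine Finset.sum_congr rfl fun τ _ => ?_
  have h1 : (Equiv.arrowCongr f (Equiv.refl (Fin 4))) τ ∘ f = τ := by
    funext k; simp
  rw [h1]
  congr 1
  simp only [locOp, of_apply]
  have h2 : (∀ i, i ∉ Set.range (f ∘ j) → σ i = (Equiv.arrowCongr f (Equiv.refl (Fin 4))) τ i) ↔
      ∀ k, k ∉ Set.range j → (σ ∘ f) k = τ k := by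
    rw [f.surjective.forall]
    refine forall_congr' fun k => ?_
    have : f k ∈ Set.range (f ∘ j) ↔ k ∈ Set.range j := by
      simp [Set.mem_range]
    rw [this]
    simp
  have h3 : (Equiv.arrowCongr f (Equiv.refl (Fin 4))) τ ∘ (f ∘ j) = τ ∘ j := by
    rw [← comp_assoc, h1]
  rw [h3]
  exact if_congr h2 rfl rfl

/-- The sum of the edge terms of a labelled graph. -/
noncomputable def edgeSum {E : Type} [Fintype E] (d : E → κ × κ) :
    Matrix (κ → Fin 4) (κ → Fin 4) ℂ := ∑ e, pairTerm (d e).1 (d e).2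

theorem edgeSum_relabel {E : Type} [Fintype E] (f : κ ≃ ι) (d : E → κ × κ)
    (ψ : EuclideanSpace ℂ (κ → Fin 4)) :
    toEuclideanLin (edgeSum fun e => (f (d e).1, f (d e).2)) (relabel f ψ) =
      relabel f (toEuclideanLin (edgeSum d) ψ) := by
  simp only [edgeSum, map_sum, LinearMap.sum_apply]
  refine Finset.sum_congr rfl fun e _ => ?_
  rw [pairTerm, pairTerm, ← locOp_equiv_comp]
  congr 3
  funext k
  fin_cases k <;> rfl

theorem pairTerm_posSemidef {u v : κ} (h : u ≠ v) : (pairTerm u v).PosSemidef :=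
  posSemidef_of_proj (pairTerm_isHermitian u v) (pairTerm_mul_self h)

end Relabelling

/-! ### Ground states and gaps of the AKLT Hamiltonian. -/

section Gap

variable {V E : Type} [DecidableEq V] [DecidableEq E] {G : CubicGraph V E}

theorem hamiltonian_eq_edgeSum (A : Region G) :
    A.hamiltonian = edgeSum fun e => (src A e, tgt A e) := by
  simp only [Region.hamiltonian, edgeSum, edgeTerm_eq_pairTerm]

theorem hamiltonian_isHermitian (A : Region G) : A.hamiltonian.IsHermitian := by
  rw [hamiltonian_eq_edgeSum]
  exact isHermitian_sum _ fun e _ => pairTerm_isHermitian _ _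

theorem hamiltonian_posSemidef (A : Region G) : A.hamiltonian.PosSemidef := by
  rw [hamiltonian_eq_edgeSum]
  exact Matrix.posSemidef_sum _ fun e _ => pairTerm_posSemidef (src_ne_tgt A e)

/-- The ground states are the valence bond states. -/
theorem hamiltonian_eq_zero_iff (hG : IsSimple G) (A : Region G) (ψ : A.Phys) :
    toEuclideanLin A.hamiltonian ψ = 0 ↔ ψ ∈ A.vbs := by
  rw [hamiltonian_eq_edgeSum, edgeSum, sum_apply_eq_zero_iff _
    (fun e _ => pairTerm_isHermitian _ _) (fun e _ => pairTerm_mul_self (src_ne_tgt A e)),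
    vbs_eq_iInf hG, Submodule.mem_iInf]
  simp only [Finset.mem_univ, forall_const, pairTerm_eq_zero_iff (src_ne_tgt A _)]

/-- The Hamiltonians of all subgraphs with given numbers of vertices and edges have a common
spectral gap. -/
theorem exists_uniform_gap (a b : ℕ) : ∃ g : ℝ, 0 < g ∧
    ∀ {V E : Type} [DecidableEq V] [DecidableEq E] {G : CubicGraph V E} (A : Region G),
      A.verts.card = a → A.edges.card = b →
      ∀ l ∈ spectrum ℝ A.hamiltonian, l ≠ 0 → g ≤ l := by
  -- Up to numbering of vertices and edges there are finitely many edge lists; multiple edges are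
  -- harmless, loops are excluded. The surrounding graph plays no role.
  obtain ⟨g, hg, h⟩ := exists_common_gap
    (D := {d : Fin b → Fin a × Fin a // ∀ e, (d e).1 ≠ (d e).2}) (fun d => edgeSum d.1)
    fun d => Matrix.posSemidef_sum _ fun e _ => pairTerm_posSemidef (d.2 e)
  refine ⟨g, hg, fun {V E} _ _ {G} A ha hb l hl h0 => ?_⟩
  have f : A.verts ≃ Fin a := Fintype.equivFinOfCardEq (by rw [Fintype.card_coe, ha])
  have e : Fin b ≃ A.edges := (Fintype.equivFinOfCardEq (by rw [Fintype.card_coe, hb])).symm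
  refine h ⟨fun k => (f (src A (e k)), f (tgt A (e k))), fun k hk =>
    src_ne_tgt A (e k) (f.injective hk)⟩ l ?_ h0
  obtain ⟨x, hx, hlx⟩ := mem_spectrum_iff.1 hl
  refine mem_spectrum_iff.2 ⟨relabel f x, fun h0 => hx ?_, ?_⟩
  · exact (relabel f).injective (by rw [h0, map_zero])
  · have h1 : A.hamiltonian = edgeSum fun k => (src A (e k), tgt A (e k)) := by
      rw [hamiltonian_eq_edgeSum, edgeSum, edgeSum]
      exact (e.sum_comp fun e => pairTerm (src A e) (tgt A e)).symm
    rw [edgeSum_relabel f fun k => (src A (e k), tgt A (e k)), ← h1, hlx, map_smul]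

/-- Eigenvectors with nonzero eigenvalue are orthogonal to the kernel, and a column of the tensor
shows that the kernel is nontrivial. -/
theorem hasSpectralGap_of_le (hG : IsSimple G) (A : Region G) {γ : ℝ}
    (h : ∀ x : A.Phys, (∀ y, toEuclideanLin A.hamiltonian y = 0 → inner ℂ y x = 0) →
      γ * ‖x‖ ^ 2 ≤ RCLike.re (inner ℂ (toEuclideanLin A.hamiltonian x) x)) :
    HasSpectralGap A.hamiltonian 0 γ := by
  refine ⟨hamiltonian_isHermitian A, ⟨?_, fun l hl =>
    nonneg_of_mem_spectrum (hamiltonian_posSemidef A) hl⟩, fun l hl h0 => ?_⟩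
  · refine mem_spectrum_iff.2 ⟨column A 0, column_ne_zero A 0, ?_⟩
    rw [(hamiltonian_eq_zero_iff hG A _).2 (column_mem_vbs A 0), Complex.ofReal_zero, zero_smul]
  · obtain ⟨x, hx, hlx⟩ := mem_spectrum_iff.1 hl
    have h1 := h x fun y hy => by
      have h2 : inner ℂ (toEuclideanLin A.hamiltonian y) x = (l : ℂ) * inner ℂ y x := by
        rw [inner_toEuclideanLin (hamiltonian_isHermitian A), hlx, inner_smul_right]
      rw [hy, inner_zero_left, eq_comm, mul_eq_zero] at h2
      exact h2.resolve_left (by exact_mod_cast h0)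
    rw [hlx, inner_smul_left, inner_self_eq_norm_sq_to_K, Complex.conj_ofReal] at h1
    have h2 : γ * ‖x‖ ^ 2 ≤ l * ‖x‖ ^ 2 := by
      refine le_of_le_of_eq h1 ?_
      have : (l : ℂ) * ((‖x‖ : ℝ) : ℂ) ^ 2 = ((l * ‖x‖ ^ 2 : ℝ) : ℂ) := by push_cast; rfl
      exact (congrArg Complex.re this).trans (Complex.ofReal_re _)
    rw [zero_add]
    exact le_of_mul_le_mul_right h2 (by positivity)

end Gap

/-! ### Comparison of the two Hamiltonians on a patch. -/

section Patch

variable {m n : ℕ}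

theorem patchTerm_eq_zero_iff (S : Finset (Bond m n)) (i : S) (ψ : (patch S).Phys) :
    toEuclideanLin (patchTerm S i) ψ = 0 ↔ ∀ e ∈ (term i.1).edges,
      ψ ∈ siteKernel (patch S) ((lattice m n).src e) ((lattice m n).tgt e) := by
  rw [patchTerm, map_sub, LinearMap.sub_apply, toEuclideanLin_one, sub_eq_zero, eq_comm,
    vbsProj_eq_self_iff_siteKernel (lattice_isSimple m n)]

theorem mem_patch_edges (S : Finset (Bond m n)) {e : Edge m n} :
    e ∈ (patch S).edges ↔ ∃ i : S, e ∈ (term i.1).edges := by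
  rw [patch, Region.biUnion, Finset.mem_biUnion]
  simp

/-- This inclusion of kernels turns orthogonality to the AKLT ground states into orthogonality to
the kernel of the regrouped Hamiltonian. -/
theorem regrouped_eq_zero (S : Finset (Bond m n)) (ψ : (patch S).Phys)
    (h : toEuclideanLin (regrouped S) ψ = 0) : toEuclideanLin (patch S).hamiltonian ψ = 0 := by
  rw [hamiltonian_eq_zero_iff (lattice_isSimple m n), mem_vbs_iff (lattice_isSimple m n)]
  intro e he
  obtain ⟨i, hi⟩ := (mem_patch_edges S).1 he
  have h1 := (sum_apply_eq_zero_iff Finset.univ (P := patchTerm S)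
    (fun i _ => patchTerm_isHermitian S i) (fun i _ => patchTerm_mul_self S i) ψ).1 h i
    (Finset.mem_univ i)
  exact (patchTerm_eq_zero_iff S i ψ).1 h1 e hi

/-- A triangle edge lies in the terms of the bonds at its triangle, which have different labels; a
bond lies only in its own term. -/
theorem card_terms_at_le (S : Finset (Bond m n)) (e : Edge m n) :
    (Finset.univ.filter fun i : S => e ∈ (term i.1).edges).card ≤ 3 := by
  have h : Set.InjOn (fun i : S => i.1.2)
      (Finset.univ.filter fun i : S => e ∈ (term i.1).edges : Finset S) := by
    intro i hi j hj hij
    have hi' := (Finset.mem_filter.1 (Finset.mem_coe.1 hi)).2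
    have hj' := (Finset.mem_filter.1 (Finset.mem_coe.1 hj)).2
    refine Subtype.ext ?_
    rcases e with v | b
    · rw [inl_mem_term_edges] at hi' hj'
      exact eq_of_cellEnd_eq (hi'.symm.trans hj') hij
    · rw [inr_mem_term_edges] at hi' hj'
      rw [← hi', ← hj']
  exact (Finset.card_le_card_of_injOn _ (fun i _ => Finset.mem_univ _) h).trans
    (by simp)

theorem locOp_hamiltonian {V E : Type} [DecidableEq V] [DecidableEq E] {G : CubicGraph V E}
    {A B : Region G} (h : A.verts ⊆ B.verts) (he : A.edges ⊆ B.edges) :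
    locOp (incl h) A.hamiltonian = ∑ e : B.edges, if e.1 ∈ A.edges then B.edgeTerm e else 0 := by
  rw [hamiltonian_eq_edgeSum, edgeSum, locOp_sum, ← Finset.sum_filter]
  refine Finset.sum_bij (fun e _ => (⟨e.1, he e.2⟩ : B.edges)) (fun e _ => ?_)
    (fun e _ e' _ h => Subtype.ext (congrArg (fun x : B.edges => x.1) h)) (fun e he' => ?_) fun e _ => ?_
  · exact Finset.mem_filter.2 ⟨Finset.mem_univ _, e.2⟩
  · exact ⟨⟨e.1, (Finset.mem_filter.1 he').2⟩, Finset.mem_univ _, rfl⟩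
  · rw [edgeTerm_eq_pairTerm, pairTerm, pairTerm, locOp_locOp (incl_injective h)]
    congr 1
    funext k
    fin_cases k <;> rfl

/-- The Hamiltonian is bounded below by a multiple of the regrouped one. -/
theorem regrouped_le_hamiltonian {g : ℝ} (hg : ∀ (b : Bond m n),
    ∀ l ∈ spectrum ℝ (term b).hamiltonian, l ≠ 0 → g ≤ l) (S : Finset (Bond m n))
    (x : (patch S).Phys) : g * RCLike.re (inner ℂ (toEuclideanLin (regrouped S) x) x) ≤
      3 * RCLike.re (inner ℂ (toEuclideanLin (patch S).hamiltonian x) x) := by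
  have hedge (i : S) : (term i.1).edges ⊆ (patch S).edges := fun e he =>
    (mem_patch_edges S).2 ⟨i, he⟩
  have h1 (i : S) : g * RCLike.re (inner ℂ (toEuclideanLin (patchTerm S i) x) x) ≤
      RCLike.re (inner ℂ (toEuclideanLin (locOp (incl (subset_patch S i))
        (term i.1).hamiltonian) x) x) := by
    -- On a term the Hamiltonian dominates `g (1 - Π)`, where `Π` projects onto its kernel;
    -- tensoring with the identity preserves this.
    have h2 := locOp_posSemidef (incl_injective (subset_patch S i))
      (posSemidef_sub_smul_orthProj (hamiltonian_isHermitian (term i.1)) (hg i.1) _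
        (hamiltonian_eq_zero_iff (lattice_isSimple m n) (term i.1)))
    have h3 : locOp (incl (subset_patch S i)) (1 - orthProj (term i.1).vbs) = patchTerm S i := by
      rw [locOp_sub, locOp_one (incl_injective _), patchTerm, Region.vbsProj, extend_eq_locOp]
    rw [locOp_sub, locOp_smul, h3] at h2
    have h4 := (posSemidef_iff_inner.1 h2).2 x
    rw [map_sub, LinearMap.sub_apply, inner_sub_left, map_sub, map_smul, LinearMap.smul_apply,
      inner_smul_left, Complex.conj_ofReal] at h4
    have h5 : RCLike.re ((g : ℂ) * inner ℂ (toEuclideanLin (patchTerm S i) x) x) =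
      g * RCLike.re (inner ℂ (toEuclideanLin (patchTerm S i) x) x) := Complex.re_ofReal_mul _ _
    rw [h5] at h4
    linarith
  have h2 : RCLike.re (inner ℂ (toEuclideanLin (regrouped S) x) x) =
      ∑ i, RCLike.re (inner ℂ (toEuclideanLin (patchTerm S i) x) x) :=
    re_inner_sum_apply Finset.univ (patchTerm S) x
  have h3 : RCLike.re (inner ℂ (toEuclideanLin (patch S).hamiltonian x) x) =
      ∑ e, RCLike.re (inner ℂ (toEuclideanLin ((patch S).edgeTerm e) x) x) :=
    re_inner_sum_apply Finset.univ _ x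
  rw [h2, h3, Finset.mul_sum, Finset.mul_sum]
  refine (Finset.sum_le_sum fun i _ => h1 i).trans ?_
  have h4 (i : S) : RCLike.re (inner ℂ (toEuclideanLin (locOp (incl (subset_patch S i))
      (term i.1).hamiltonian) x) x) = ∑ e : (patch S).edges, if e.1 ∈ (term i.1).edges then
        RCLike.re (inner ℂ (toEuclideanLin ((patch S).edgeTerm e) x) x) else 0 := by
    rw [locOp_hamiltonian (subset_patch S i) (hedge i), re_inner_sum_apply]
    refine Finset.sum_congr rfl fun e _ => ?_
    split_ifs
    · rfl
    · simp
  simp only [h4]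
  -- After the exchange each edge term is counted once for every term that contains it, at most
  -- three times.
  rw [Finset.sum_comm]
  refine Finset.sum_le_sum fun e _ => ?_
  rw [← Finset.sum_filter, Finset.sum_const, nsmul_eq_mul]
  have h5 : 0 ≤ RCLike.re (inner ℂ (toEuclideanLin ((patch S).edgeTerm e) x) x) := by
    rw [edgeTerm_eq_pairTerm]
    exact (posSemidef_iff_inner.1 (pairTerm_posSemidef (src_ne_tgt _ e))).2 x
  have h6 : ((Finset.univ.filter fun i : S => e.1 ∈ (term i.1).edges).card : ℝ) ≤ 3 := by
    exact_mod_cast card_terms_at_le S e.1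
  exact mul_le_mul_of_nonneg_right h6 h5

theorem regrouped_posSemidef (S : Finset (Bond m n)) : (regrouped S).PosSemidef :=
  Matrix.posSemidef_sum _ fun i _ =>
    posSemidef_of_proj (patchTerm_isHermitian S i) (patchTerm_mul_self S i)

/-- The hypothesis `hc` puts the nonzero eigenvalues of the regrouped Hamiltonian above `c`, and
`regrouped_le_hamiltonian` costs the factor `g / 3`. -/
theorem hasSpectralGap_patch {g c : ℝ} (hg0 : 0 < g) (hg : ∀ (b : Bond m n),
    ∀ l ∈ spectrum ℝ (term b).hamiltonian, l ≠ 0 → g ≤ l) (S : Finset (Bond m n))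
    (hc : (regrouped S * regrouped S - (c : ℂ) • regrouped S).PosSemidef) :
    HasSpectralGap (patch S).hamiltonian 0 (g * c / 3) := by
  refine hasSpectralGap_of_le (lattice_isSimple m n) _ fun x hx => ?_
  have hH := (posSemidef_iff_inner.1 (regrouped_posSemidef S)).1
  have h1 : c * ‖x‖ ^ 2 ≤ RCLike.re (inner ℂ (toEuclideanLin (regrouped S) x) x) := by
    refine mul_norm_sq_le_of_orthogonal_ker hH (fun l hl h0 => ?_) fun y hy =>
      hx y (regrouped_eq_zero S y hy)
    have h2 := (posSemidef_sq_sub_smul_iff hH c).1 hc l hl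
    have h3 : 0 < l :=
      lt_of_le_of_ne (nonneg_of_mem_spectrum (regrouped_posSemidef S) hl) (Ne.symm h0)
    nlinarith
  have h2 := regrouped_le_hamiltonian hg S x
  have h3 := mul_le_mul_of_nonneg_left h1 hg0.le
  linarith

end Patch

end AKLT

/-! ### The main theorem. -/

open AKLT in
theorem mainTheorem3 :
    ∃ η : ℝ, |η - 0.1110430220| < 5 / 10 ^ 11 ∧ η < 1 / 4 ∧
      (∀ m n : ℕ, m ≠ 1 → n ≠ 1 →
        (∀ i : Star.Bond m n, {j | Star.Overlap i j}.ncard = 4) ∧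
        (∀ i j : Star.Bond m n, Star.Overlap i j →
          IsLeast (anticommutatorBounds (1 - Star.projLeft i j) (1 - Star.projRight i j)) η ∧
          Module.finrank ℂ (Star.term i).vbs = 2 ^ 4 ∧
          Module.finrank ℂ ((Star.term i).diff (Star.term j)).vbs = 2 ^ 3 ∧
          Module.finrank ℂ ((Star.term i).inter (Star.term j)).vbs = 2 ^ 3 ∧
          Module.finrank ℂ ((Star.term j).diff (Star.term i)).vbs = 2 ^ 3 ∧
          Module.finrank ℂ ((Star.term i).union (Star.term j)).vbs = 2 ^ 5 ∧
          Module.End.eigenspace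
              (Matrix.toEuclideanLin (Star.projLeft i j + Star.projRight i j)) 2 =
            ((Star.term i).union (Star.term j)).vbs ∧
          Module.finrank ℂ (Star.reducedSpace i j) = 2 ^ 9 ∧
          nonintegerEigenvalues (Star.reducedOperator i j) =
            nonintegerEigenvalues
              (Matrix.toEuclideanLin (Star.projLeft i j + Star.projRight i j)) ∧
          IsGreatest (nonintegerEigenvalues (Star.reducedOperator i j)) (1 + η) ∧
          IsLeast (nonintegerEigenvalues (Star.reducedOperator i j)) (1 - η)) ∧
        (∀ S : Finset (Star.Bond m n),
          (Star.regrouped S * Star.regrouped S -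
            ((1 - 4 * η : ℝ) : ℂ) • Star.regrouped S).PosSemidef)) ∧
      ∃ γ : ℝ, 0 < γ ∧ ∀ m n : ℕ, m ≠ 1 → n ≠ 1 → ∀ S : Finset (Star.Bond m n),
        HasSpectralGap (Star.patch S).hamiltonian 0 γ := by
  obtain ⟨η, hlo, hhi, hangle⟩ := exists_chain_angle
  have hη0 : 0 < η := lt_of_lt_of_le (by norm_num) hlo
  have hη4 : η < 1 / 4 := lt_of_le_of_lt hhi (by norm_num)
  have hη1 : η < 1 := hη4.trans (by norm_num)
  have hIsAngle : IsAngle (chainSpace {true}) (chainSpace {false}) η := by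
    rw [IsAngle, ← chainSpace_univ]
    exact hangle
  have hFA (m n : ℕ) (hm : m ≠ 1) (hn : n ≠ 1) (i j : Star.Bond m n) (h : Star.Overlap i j) :
      FriedrichsAngle (Star.projLeft i j) (Star.projRight i j) η := by
    obtain ⟨hk, s, hs⟩ := overlap_iff.1 h
    exact friedrichsAngle_of_chain hIsAngle hk hs (cellEnd_not_ne hm hn hk hs)
  have hreg (m n : ℕ) (hm : m ≠ 1) (hn : n ≠ 1) (S : Finset (Star.Bond m n)) :=
    regrouped_sq_sub_posSemidef hm hn hη0.le hη1 (hFA m n hm hn) S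
  refine ⟨η, ?_, hη4, fun m n hm hn => ⟨ncard_overlap hm hn, fun i j hij => ?_, hreg m n hm hn⟩, ?_⟩
  · rw [abs_lt]
    constructor
    · have : (0.1110430220 : ℝ) - 5 / 10 ^ 11 < 0.111043021955 := by norm_num
      linarith
    · have : (0 : ℝ) < 5 / 10 ^ 11 := by norm_num
      linarith
  · obtain ⟨hk, s, hs⟩ := overlap_iff.1 hij
    have hne := cellEnd_not_ne hm hn hk hs
    have h := hFA m n hm hn i j hij
    have hred := nonintegerEigenvalues_reducedOperator h hk hs hne
    refine ⟨h.isLeast_anticommutatorBounds hη1, finrank_vbs_term i, ?_, ?_, ?_,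
      finrank_vbs_union hk hs hne, eigenspace_two_eq_vbs h, finrank_reducedSpace hk hs hne, hred,
      ?_, ?_⟩
    · rw [diff_eq hs hne, finrank_vbs_triRegion]
    · rw [inter_eq hk hs hne, finrank_vbs_triRegion]
    · rw [diff_eq hs.symm hne.symm, finrank_vbs_triRegion]
    · rw [hred]
      exact h.isGreatest_nonintegerEigenvalues hη0 hη1
    · rw [hred]
      exact h.isLeast_nonintegerEigenvalues hη0 hη1
  -- Every term has 6 vertices and 7 edges, so one `g` serves all `m`, `n` and `S`.
  · obtain ⟨g, hg0, hg⟩ := exists_uniform_gap 6 7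
    refine ⟨g * (1 - 4 * η) / 3, ?_, fun m n hm hn S => ?_⟩
    · have : 0 < 1 - 4 * η := by linarith
      positivity
    · exact hasSpectralGap_patch hg0
        (fun b => hg (Star.term b) (card_term_verts b) (card_term_edges b)) S (hreg m n hm hn S)
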